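/- Let $\mathcal{K}_{o,2+}$ be the family of origin-symmetric convex disks (compact convex sets with nonempty interior) in the Euclidean plane whose boundary is of class $C^2$ and has strictly positive curvature. For a convex disk $K$ and a Borel set $\sigma \subseteq \mathbb{S}^1$ let $A_K(\sigma)$ (the surface area measure) be the one-dimensional Hausdorff measure of the set of boundary points of $K$ at which some $u \in \sigma$ is an outer unit normal vector, and let $\mathcal{H}(\sigma)$ be the one-dimensional Hausdorff measure of $\sigma$. Equip $\mathcal{K}_{o,2+}$ with the topology induced by the perimeter measure (PM) distance $$d_{PM}(C,D)=\inf\{\tau\ge 0 : |A_C(\sigma)-A_D(\sigma)|\le \tau\,\mathcal{H}(\sigma)\text{ for every Borel set }\sigma\subseteq\mathbb{S}^1\}\in[0,\infty].$$ For an origin-symmetric convex disk $C$, the $C$-spindle $[p,q]_C$ of two points $p,q$ is the intersection of all translates of $C$ containing both ($\mathbb{R}^2$ if there is none), and a convex disk $K$ is $C$-convex if $[p,q]_C\subseteq K$ for all $p,q\in K$. For distinct boundary points $p,q$ of a $C$-convex disk $K$, let $\widehat{pq}$ be the counterclockwise arc of $\mathrm{bd}(K)$ from $p$ to $q$, and let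 $r_K(p,q)$ be the region bounded by $\widehat{pq}$ and the counterclockwise arc of $\mathrm{bd}([p,q]_C)$ from $p$ to $q$. We say that $C$ has the Quadrangle Property if $$\mathrm{area}(r_K(x_1,x_4))+\mathrm{area}(r_K(x_2,x_3))\ \ge\ \mathrm{area}(r_K(x_1,x_3))+\mathrm{area}(r_K(x_2,x_4))$$ for every $C$-convex disk $K$ and all distinct points $x_1,x_2,x_3,x_4\in\mathrm{bd}(K)$ in this counterclockwise order such that $\widehat{x_1x_4}$ has turning angle strictly less than $\pi$, i.e. contains no point $y$ such that $K$ has two distinct parallel supporting lines, one through $x_1$ and one through $y$. Theorem. A typical element of $\mathcal{K}_{o,2+}$ with the PM topology does not satisfy the Quadrangle Property; that is, the set of all $C\in\mathcal{K}_{o,2+}$ that do not have the Quadrangle Property is residual (contains a countable intersection of dense open sets) in $\mathcal{K}_{o,2+}$ with the topology induced by $d_{PM}$. -/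

import Mathlib

open MeasureTheory Set
open scoped NNReal ENNReal Topology

/-- The Euclidean plane. -/
abbrev Plane : Type := EuclideanSpace ℝ (Fin 2)

/-- The determinant of the matrix with columns `p` and `q`. -/
def det2 (p q : Plane) : ℝ := p 0 * q 1 - p 1 * q 0

/-- A convex disk: a compact convex set with nonempty interior. -/
def IsConvexDisk (K : Set Plane) : Prop :=
  IsCompact K ∧ Convex ℝ K ∧ (interior K).Nonempty

/-- The family of convex disks that are symmetric about the origin. -/
def SymDisk : Type := {C : Set Plane // IsConvexDisk C ∧ ∀ x ∈ C, -x ∈ C}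

/-- The boundary of `C` is of class `C²` and its curvature is strictly positive:
the boundary has a counterclockwise arclength parametrization `γ` of class `C²`
(running around the boundary, so not injective on the whole line), and its curvature
`det2 γ' γ''` is positive everywhere. For a convex `C` the sign of `det2 γ' γ''` forces the
counterclockwise orientation. -/
def IsC2Plus (C : Set Plane) : Prop :=
  ∃ γ : ℝ → Plane, ContDiff ℝ 2 γ ∧ (∀ t, ‖deriv γ t‖ = 1) ∧ range γ = frontier C ∧
    ∀ t, 0 < det2 (deriv γ t) (deriv (deriv γ) t)

/-! ### Surface area measure and the perimeter measure distance -/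

/-- `u` is an outer normal vector of `K` at `p`. -/
def IsOuterNormal (K : Set Plane) (p u : Plane) : Prop :=
  ∀ z ∈ K, inner ℝ u z ≤ inner ℝ u p

/-- The boundary points of `K` at which some element of `σ` is an outer normal vector. -/
def normalPreimage (K σ : Set Plane) : Set Plane :=
  {p | p ∈ frontier K ∧ ∃ u ∈ σ, IsOuterNormal K p u}

/-- The surface area measure of `K`, evaluated at a set `σ` of unit vectors. -/
noncomputable def surfaceArea (K σ : Set Plane) : ℝ≥0∞ := μH[1] (normalPreimage K σ)

/-- `|A_C(σ) - A_D(σ)| ≤ τ ℋ(σ)` for every Borel subset `σ` of the unit circle. -/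
def PMBound (C D : Set Plane) (τ : ℝ≥0) : Prop :=
  ∀ σ : Set Plane, σ ⊆ Metric.sphere 0 1 → MeasurableSet σ →
    surfaceArea C σ ≤ surfaceArea D σ + τ * μH[1] σ ∧
    surfaceArea D σ ≤ surfaceArea C σ + τ * μH[1] σ

/-- The perimeter measure distance: the least `τ ≥ 0` such that
`|A_C(σ) - A_D(σ)| ≤ τ ℋ(σ)` for every Borel set `σ`, and `∞` if there is none. -/
noncomputable def pmDist (C D : Set Plane) : ℝ≥0∞ :=
  ⨅ (τ : ℝ≥0) (_ : PMBound C D τ), (τ : ℝ≥0∞)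

theorem pmDist_self (C : Set Plane) : pmDist C C = 0 := by
  refine le_antisymm (iInf₂_le_of_le 0 ?_ (by simp)) bot_le
  intro σ _ _
  simp

theorem pmDist_comm (C D : Set Plane) : pmDist C D = pmDist D C := by
  have h : ∀ τ, PMBound C D τ ↔ PMBound D C τ := fun τ =>
    ⟨fun h σ h1 h2 => (h σ h1 h2).symm, fun h σ h1 h2 => (h σ h1 h2).symm⟩
  simp only [pmDist, h]

theorem PMBound.trans {C D E : Set Plane} {τ ρ : ℝ≥0} (h : PMBound C D τ)
    (h' : PMBound D E ρ) : PMBound C E (τ + ρ) := by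
  intro σ h1 h2
  obtain ⟨a, b⟩ := h σ h1 h2
  obtain ⟨a', b'⟩ := h' σ h1 h2
  push_cast
  constructor
  · calc surfaceArea C σ ≤ surfaceArea D σ + τ * μH[1] σ := a
      _ ≤ (surfaceArea E σ + ρ * μH[1] σ) + τ * μH[1] σ := by gcongr
      _ = surfaceArea E σ + (τ + ρ) * μH[1] σ := by ring
  · calc surfaceArea E σ ≤ surfaceArea D σ + ρ * μH[1] σ := b'
      _ ≤ (surfaceArea C σ + τ * μH[1] σ) + ρ * μH[1] σ := by gcongr
      _ = surfaceArea C σ + (τ + ρ) * μH[1] σ := by ring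

theorem pmDist_triangle (C D E : Set Plane) : pmDist C E ≤ pmDist C D + pmDist D E := by
  refine ENNReal.le_iInf₂_add_iInf₂ ?_
  intro τ hτ ρ hρ
  exact iInf₂_le_of_le (τ + ρ) (hτ.trans hρ) (by simp)

/-- The family of origin-symmetric convex disks with the perimeter measure distance and the
topology induced by it. -/
noncomputable instance instPseudoEMetricSpaceSymDisk : PseudoEMetricSpace SymDisk where
  edist C D := pmDist C.1 D.1
  edist_self C := pmDist_self C.1
  edist_comm C D := pmDist_comm C.1 D.1
  edist_triangle C D E := pmDist_triangle C.1 D.1 E.1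

/-! ### Spindle convexity and the Quadrangle Property -/

/-- The `C`-spindle of `p` and `q`: the intersection of all translates of `C` that contain `p`
and `q` (the whole plane if there is no such translate). -/
def spindle (C : Set Plane) (p q : Plane) : Set Plane :=
  {z | ∀ v : Plane, p - v ∈ C → q - v ∈ C → z - v ∈ C}

/-- `K` is a `C`-convex disk. -/
def IsSpindleConvexDisk (C K : Set Plane) : Prop :=
  IsConvexDisk K ∧ ∀ p ∈ K, ∀ q ∈ K, spindle C p q ⊆ K

/-- The unit vector of direction `θ`. -/
noncomputable def dir (θ : ℝ) : Plane := !₂[Real.cos θ, Real.sin θ]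

/-- `x` is the boundary point of `K` in direction `θ`, as seen from `c`. -/
def IsBoundaryPointAt (K : Set Plane) (c : Plane) (θ : ℝ) (x : Plane) : Prop :=
  x ∈ frontier K ∧ ∃ r : ℝ, 0 < r ∧ x = c + r • dir θ

/-- The closed boundary arc of `K` that is seen from the interior point `c` under the angles
`θ ∈ [a, b]`; for `a < b < a + 2π` it runs counterclockwise from the boundary point in
direction `a` to the boundary point in direction `b`. -/
def boundaryArc (K : Set Plane) (c : Plane) (a b : ℝ) : Set Plane :=
  {z | ∃ θ ∈ Icc a b, IsBoundaryPointAt K c θ z}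

/-- `p` and `q` lie on parallel supporting lines of `K` that bound `K` from opposite sides. -/
def IsAntipodal (K : Set Plane) (p q : Plane) : Prop :=
  ∃ u : Plane, u ≠ 0 ∧ IsOuterNormal K p u ∧ IsOuterNormal K q (-u)

/-- The region bounded by the counterclockwise boundary arc of `K` from `p` to `q` and by the
counterclockwise boundary arc of the `C`-spindle of `p` and `q` from `p` to `q`. Both arcs lie
on the right of the directed line from `p` to `q`, where `K` contains the spindle. -/
def arcRegion (C K : Set Plane) (p q : Plane) : Set Plane :=
  {z | z ∈ K ∧ det2 (q - p) (z - p) ≤ 0} \ spindle C p q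

/-- The Quadrangle Property. The counterclockwise order of the boundary points is that of their
polar angles around an interior point `c` of `K`. -/
def QuadrangleProperty (C : Set Plane) : Prop :=
  ∀ K : Set Plane, IsSpindleConvexDisk C K →
  ∀ c ∈ interior K, ∀ θ₁ θ₂ θ₃ θ₄ : ℝ,
    θ₁ < θ₂ → θ₂ < θ₃ → θ₃ < θ₄ → θ₄ < θ₁ + 2 * Real.pi →
  ∀ x₁ x₂ x₃ x₄ : Plane,
    IsBoundaryPointAt K c θ₁ x₁ → IsBoundaryPointAt K c θ₂ x₂ →
    IsBoundaryPointAt K c θ₃ x₃ → IsBoundaryPointAt K c θ₄ x₄ →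
    (∀ y ∈ boundaryArc K c θ₁ θ₄, ¬ IsAntipodal K x₁ y) →
    volume (arcRegion C K x₁ x₃) + volume (arcRegion C K x₂ x₄) ≤
      volume (arcRegion C K x₁ x₄) + volume (arcRegion C K x₂ x₃)

/-! ### Coordinates in the plane -/

/-! A disk of the class is described by its radius of curvature `ρ` as a function of the normal
angle: its boundary is a curve with `γ' θ = ρ θ • tang θ`, where `dir θ` is the outer normal at `γ
θ` (`exists_supportCurve`, with converse `isC2Plus_region`). The perimeter measure distance is the
uniform distance of the radii of curvature (`pmDist_le`, `abs_radius_sub_le`). It therefore suffices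
to show that every `ρ` has, arbitrarily close to it, a uniform ball of radius functions for which
the Quadrangle Property fails; the set of failures then has dense interior.

Failure is tested on a lens `K`, the intersection of two translates of `C`, with `x₁`, `x₂` on one
arc and `x₃`, `x₄` on the other. The right half of the spindle of `p` and `q` is a translate of the
cap that a chord of `C` equal to `q - p` cuts off (`rightPart_inter_spindle`), so each area in the
Quadrangle Property is the area of `K` beyond a line minus the area of a cap. The areas of `K`
cancel up to two triangles (`volume_rightPart_add`). What remains is a mixed second difference of
the function "area of the cap with chord `v`", corrected by a determinant
(`not_quadrangleProperty`).

Shrink both arcs to points at which the tangents are parallel. The determinant vanishes in the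
limit, and the sign is decided by the second derivative of the cap area in the common tangent
direction. If that direction is orthogonal to the bisector of the normals `dir α`, `dir β` at the
ends of the chord, this derivative is negative exactly when the sum of `⟪dir β, v⟫ / ρ α` and `-⟪dir
α, v⟫ / ρ β` is less than `sin² (β - α)` (`not_quadrangleProperty_of_chord`).

For a circle the sum is `2 (1 - c)` and the right side is `(1 - c) (1 + c)` with `c = cos (β - α)`,
so the condition just fails for short chords. It holds once the radii at the two ends exceed the
mean radius between them by a fixed amount and the chord is short. Adding `ε (1 + cos (2nθ))` to
`ρ`, with `n` large, achieves this between `0` and `π / n`: the added radius is `2ε` at the ends but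
about `ε` on average. The inequality is strict with room to spare, so it survives small uniform
changes of `ρ` (`exists_near_not_quadrangleProperty`). -/

/-- The unit vector of direction `θ + π / 2`. -/
noncomputable def tang (θ : ℝ) : Plane := !₂[-Real.sin θ, Real.cos θ]

@[simp] theorem dir_apply_zero (θ : ℝ) : dir θ 0 = Real.cos θ := rfl
@[simp] theorem dir_apply_one (θ : ℝ) : dir θ 1 = Real.sin θ := rfl
@[simp] theorem tang_apply_zero (θ : ℝ) : tang θ 0 = -Real.sin θ := rfl
@[simp] theorem tang_apply_one (θ : ℝ) : tang θ 1 = Real.cos θ := rfl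

theorem plane_ext {x y : Plane} (h0 : x 0 = y 0) (h1 : x 1 = y 1) : x = y := by
  ext i
  fin_cases i
  · exact h0
  · exact h1

theorem inner_plane (x y : Plane) : inner ℝ x y = x 0 * y 0 + x 1 * y 1 := by
  simp [PiLp.inner_apply, Fin.sum_univ_two, mul_comm]

theorem norm_sq_plane (x : Plane) : ‖x‖ ^ 2 = x 0 ^ 2 + x 1 ^ 2 := by
  rw [← real_inner_self_eq_norm_sq, inner_plane]; ring

theorem norm_dir (θ : ℝ) : ‖dir θ‖ = 1 := by
  have h := norm_sq_plane (dir θ)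
  simp only [dir_apply_zero, dir_apply_one, Real.cos_sq_add_sin_sq] at h
  nlinarith [norm_nonneg (dir θ)]

theorem norm_tang (θ : ℝ) : ‖tang θ‖ = 1 := by
  have h := norm_sq_plane (tang θ)
  simp only [tang_apply_zero, tang_apply_one, neg_sq, Real.sin_sq_add_cos_sq] at h
  nlinarith [norm_nonneg (tang θ)]

theorem inner_dir_tang (θ s : ℝ) : inner ℝ (dir θ) (tang s) = Real.sin (θ - s) := by
  rw [inner_plane, Real.sin_sub]; simp; ring

theorem inner_dir_dir (θ s : ℝ) : inner ℝ (dir θ) (dir s) = Real.cos (θ - s) := by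
  rw [inner_plane, Real.cos_sub]; simp

theorem inner_tang_tang (θ s : ℝ) : inner ℝ (tang θ) (tang s) = Real.cos (θ - s) := by
  rw [inner_plane, Real.cos_sub]; simp; ring

theorem det2_tang_left (θ : ℝ) (v : Plane) : det2 (tang θ) v = -inner ℝ (dir θ) v := by
  rw [inner_plane, det2]; simp; ring

theorem det2_tang_right (θ : ℝ) (v : Plane) : det2 v (tang θ) = inner ℝ (dir θ) v := by
  rw [inner_plane, det2]; simp; ring

theorem det2_add_left (x y z : Plane) : det2 (x + y) z = det2 x z + det2 y z := by
  simp [det2]; ring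
theorem det2_add_right (x y z : Plane) : det2 x (y + z) = det2 x y + det2 x z := by
  simp [det2]; ring
theorem det2_sub_left (x y z : Plane) : det2 (x - y) z = det2 x z - det2 y z := by
  simp [det2]; ring
theorem det2_sub_right (x y z : Plane) : det2 x (y - z) = det2 x y - det2 x z := by
  simp [det2]; ring
theorem det2_smul_left (r : ℝ) (x y : Plane) : det2 (r • x) y = r * det2 x y := by
  simp [det2]; ring
theorem det2_smul_right (r : ℝ) (x y : Plane) : det2 x (r • y) = r * det2 x y := by
  simp [det2]; ring
theorem det2_swap (x y : Plane) : det2 x y = -det2 y x := by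
  simp only [det2]; ring
theorem det2_self (x : Plane) : det2 x x = 0 := by
  simp [det2]; ring

theorem dir_add_pi (θ : ℝ) : dir (θ + Real.pi) = -dir θ := by
  apply plane_ext <;> simp [Real.cos_add_pi, Real.sin_add_pi]

theorem tang_add_pi (θ : ℝ) : tang (θ + Real.pi) = -tang θ := by
  apply plane_ext <;> simp [Real.cos_add_pi, Real.sin_add_pi]

theorem dir_periodic : Function.Periodic dir (2 * Real.pi) := fun θ => by
  apply plane_ext <;> simp

theorem eq_of_inner_dir_tang {θ : ℝ} {x y : Plane} (h0 : inner ℝ (dir θ) x = inner ℝ (dir θ) y)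
    (h1 : inner ℝ (tang θ) x = inner ℝ (tang θ) y) : x = y := by
  simp only [inner_plane, dir_apply_zero, dir_apply_one, tang_apply_zero, tang_apply_one] at h0 h1
  have h := Real.sin_sq_add_cos_sq θ
  apply plane_ext
  · linear_combination Real.cos θ * h0 - Real.sin θ * h1 + (y 0 - x 0) * h
  · linear_combination Real.sin θ * h0 + Real.cos θ * h1 + (y 1 - x 1) * h

theorem exists_eq_smul_dir (z : Plane) : ∃ θ : ℝ, z = ‖z‖ • dir θ := by
  set w : ℂ := ⟨z 0, z 1⟩
  have hn : ‖w‖ = ‖z‖ := by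
    have h1 : ‖w‖ ^ 2 = z 0 ^ 2 + z 1 ^ 2 := by
      rw [Complex.sq_norm, Complex.normSq_apply]; simp [w]; ring
    rw [← norm_sq_plane] at h1
    nlinarith [norm_nonneg w, norm_nonneg z, sq_nonneg (‖w‖ - ‖z‖)]
  refine ⟨w.arg, plane_ext ?_ ?_⟩
  · simpa [hn, w] using (Complex.norm_mul_cos_arg w).symm
  · simpa [hn, w] using (Complex.norm_mul_sin_arg w).symm

theorem hasDerivAt_plane_apply {f : ℝ → Plane} {f' : Plane} {t : ℝ} (h : HasDerivAt f f' t)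
    (i : Fin 2) : HasDerivAt (fun s => f s i) (f' i) t :=
  (EuclideanSpace.proj i : Plane →L[ℝ] ℝ).hasFDerivAt.comp_hasDerivAt t h

theorem hasDerivAt_plane {f : ℝ → Plane} {f' : Plane} {t : ℝ}
    (h0 : HasDerivAt (fun s => f s 0) (f' 0) t) (h1 : HasDerivAt (fun s => f s 1) (f' 1) t) :
    HasDerivAt f f' t := by
  rw [hasDerivAt_iff_hasFDerivAt, ← hasFDerivWithinAt_univ, hasFDerivWithinAt_euclidean]
  intro i
  rw [hasFDerivWithinAt_univ]
  fin_cases i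
  · exact h0.hasFDerivAt.congr_fderiv (by ext; simp)
  · exact h1.hasFDerivAt.congr_fderiv (by ext; simp)

theorem hasDerivAt_det2 {f g : ℝ → Plane} {f' g' : Plane} {t : ℝ} (hf : HasDerivAt f f' t)
    (hg : HasDerivAt g g' t) :
    HasDerivAt (fun s => det2 (f s) (g s)) (det2 f' (g t) + det2 (f t) g') t := by
  have h := ((hasDerivAt_plane_apply hf 0).mul (hasDerivAt_plane_apply hg 1)).sub
    ((hasDerivAt_plane_apply hf 1).mul (hasDerivAt_plane_apply hg 0))
  refine h.congr_deriv ?_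
  simp only [det2]; ring

theorem hasDerivAt_inner_const {f : ℝ → Plane} {f' : Plane} {t : ℝ} (w : Plane)
    (hf : HasDerivAt f f' t) : HasDerivAt (fun s => inner ℝ w (f s)) (inner ℝ w f') t :=
  (innerSL ℝ w).hasFDerivAt.comp_hasDerivAt t hf

theorem hasDerivAt_dir (θ : ℝ) : HasDerivAt dir (tang θ) θ :=
  hasDerivAt_plane (Real.hasDerivAt_cos θ) (Real.hasDerivAt_sin θ)

theorem hasDerivAt_tang (θ : ℝ) : HasDerivAt tang (-dir θ) θ :=
  hasDerivAt_plane ((Real.hasDerivAt_sin θ).neg)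
    (by simpa using Real.hasDerivAt_cos θ)

theorem continuous_dir : Continuous dir :=
  continuous_iff_continuousAt.2 fun θ => (hasDerivAt_dir θ).continuousAt

theorem continuous_tang : Continuous tang :=
  continuous_iff_continuousAt.2 fun θ => (hasDerivAt_tang θ).continuousAt

theorem continuous_det2 {X : Type*} [TopologicalSpace X] {f g : X → Plane} (hf : Continuous f)
    (hg : Continuous g) : Continuous fun x => det2 (f x) (g x) := by
  unfold det2; fun_prop

/-! ### Curves parametrized by their outer normal -/

/-- `γ` is a centrally symmetric closed curve with outer normal `dir θ` and radius of
curvature `ρ θ > 0` at `γ θ`. -/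
structure SupportCurve (γ : ℝ → Plane) (ρ : ℝ → ℝ) : Prop where
  hasDerivAt : ∀ θ, HasDerivAt γ (ρ θ • tang θ) θ
  cont : Continuous ρ
  pos : ∀ θ, 0 < ρ θ
  antip : ∀ θ, γ (θ + Real.pi) = -γ θ

/-- The intersection of the halfplanes with outer normals `dir θ` that have `γ θ` on their
boundary. -/
def region (γ : ℝ → Plane) : Set Plane := {z | ∀ θ, inner ℝ (dir θ) z ≤ inner ℝ (dir θ) (γ θ)}

namespace SupportCurve

variable {γ : ℝ → Plane} {ρ : ℝ → ℝ}

theorem continuous (h : SupportCurve γ ρ) : Continuous γ :=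
  continuous_iff_continuousAt.2 fun θ => (h.hasDerivAt θ).continuousAt

theorem periodic (h : SupportCurve γ ρ) : Function.Periodic γ (2 * Real.pi) := fun θ => by
  rw [two_mul, ← add_assoc, h.antip, h.antip, neg_neg]

theorem hasDerivAt_inner (h : SupportCurve γ ρ) (θ s : ℝ) :
    HasDerivAt (fun s => inner ℝ (dir θ) (γ s)) (ρ s * Real.sin (θ - s)) s := by
  refine (hasDerivAt_inner_const (dir θ) (h.hasDerivAt s)).congr_deriv ?_
  rw [inner_smul_right, inner_dir_tang]

theorem strictMonoOn (h : SupportCurve γ ρ) (θ : ℝ) :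
    StrictMonoOn (fun s => inner ℝ (dir θ) (γ s)) (Icc (θ - Real.pi) θ) := by
  refine strictMonoOn_of_deriv_pos (convex_Icc _ _)
    (fun s _ => (h.hasDerivAt_inner θ s).continuousAt.continuousWithinAt) fun s hs => ?_
  rw [interior_Icc] at hs
  rw [(h.hasDerivAt_inner θ s).deriv]
  exact mul_pos (h.pos s) (Real.sin_pos_of_pos_of_lt_pi (by linarith [hs.2]) (by linarith [hs.1]))

theorem strictAntiOn (h : SupportCurve γ ρ) (θ : ℝ) :
    StrictAntiOn (fun s => inner ℝ (dir θ) (γ s)) (Icc θ (θ + Real.pi)) := by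
  refine strictAntiOn_of_deriv_neg (convex_Icc _ _)
    (fun s _ => (h.hasDerivAt_inner θ s).continuousAt.continuousWithinAt) fun s hs => ?_
  rw [interior_Icc] at hs
  rw [(h.hasDerivAt_inner θ s).deriv]
  exact mul_neg_of_pos_of_neg (h.pos s)
    (Real.sin_neg_of_neg_of_neg_pi_lt (by linarith [hs.1]) (by linarith [hs.2]))

/-- Off its parameter `θ`, modulo `2π`, the curve stays strictly below its supporting line. -/
theorem inner_lt (h : SupportCurve γ ρ) {θ s : ℝ} (h1 : θ - Real.pi ≤ s) (h2 : s ≤ θ + Real.pi)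
    (h3 : s ≠ θ) : inner ℝ (dir θ) (γ s) < inner ℝ (dir θ) (γ θ) := by
  rcases lt_or_gt_of_ne h3 with h3 | h3
  · exact h.strictMonoOn θ ⟨h1, h3.le⟩ ⟨by linarith [Real.pi_pos], le_rfl⟩ h3
  · exact h.strictAntiOn θ ⟨le_rfl, by linarith [Real.pi_pos]⟩ ⟨h3.le, h2⟩ h3

theorem inner_le (h : SupportCurve γ ρ) (θ s : ℝ) :
    inner ℝ (dir θ) (γ s) ≤ inner ℝ (dir θ) (γ θ) := by
  obtain ⟨t, ht, e⟩ := h.periodic.exists_mem_Ico Real.two_pi_pos s (θ - Real.pi)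
  rw [e]
  by_cases h3 : t = θ
  · rw [h3]
  · exact (h.inner_lt ht.1 (by linarith [ht.2]) h3).le

theorem mem_region (h : SupportCurve γ ρ) (θ : ℝ) : γ θ ∈ region γ := fun s => h.inner_le s θ

theorem inner_pos (h : SupportCurve γ ρ) (θ : ℝ) : 0 < inner ℝ (dir θ) (γ θ) := by
  have := h.inner_lt (θ := θ) (s := θ + Real.pi) (by linarith [Real.pi_pos]) le_rfl
    (by linarith [Real.pi_pos])
  rw [h.antip, inner_neg_right] at this
  linarith

theorem hasDerivAt_support (h : SupportCurve γ ρ) (θ : ℝ) :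
    HasDerivAt (fun s => inner ℝ (dir s) (γ s)) (inner ℝ (tang θ) (γ θ)) θ := by
  refine ((hasDerivAt_dir θ).inner ℝ (h.hasDerivAt θ)).congr_deriv ?_
  rw [inner_smul_right, inner_dir_tang]; simp

/-- The support function minus `⟪dir s, z⟫` is nonnegative and vanishes at `s = θ`, so its
derivative vanishes there too. This fixes the tangential component of `z`, the normal one being
given. -/
theorem eq_of_inner_eq (h : SupportCurve γ ρ) {z : Plane} (hz : z ∈ region γ) {θ : ℝ}
    (e : inner ℝ (dir θ) z = inner ℝ (dir θ) (γ θ)) : z = γ θ := by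
  have hd : HasDerivAt (fun s => inner ℝ (dir s) (γ s) - inner ℝ (dir s) z)
      (inner ℝ (tang θ) (γ θ) - inner ℝ (tang θ) z) θ := by
    refine (h.hasDerivAt_support θ).sub ?_
    simpa using (hasDerivAt_dir θ).inner ℝ (hasDerivAt_const θ z)
  have hm : IsLocalMin (fun s => inner ℝ (dir s) (γ s) - inner ℝ (dir s) z) θ := by
    refine Filter.Eventually.of_forall fun s => ?_
    have := hz s
    simp only [e, sub_self]
    linarith
  have := hm.hasDerivAt_eq_zero hd
  exact eq_of_inner_dir_tang e (by linarith)

theorem continuous_support (h : SupportCurve γ ρ) :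
    Continuous fun s => inner ℝ (dir s) (γ s) :=
  continuous_dir.inner h.continuous

/-- The gap to the supporting lines is continuous and periodic in the angle, so it has a positive
minimum, which serves as the radius of a ball. -/
theorem mem_interior_region (h : SupportCurve γ ρ) {z : Plane}
    (hz : ∀ θ, inner ℝ (dir θ) z < inner ℝ (dir θ) (γ θ)) : z ∈ interior (region γ) := by
  have hc : Continuous fun s => inner ℝ (dir s) (γ s) - inner ℝ (dir s) z :=
    h.continuous_support.sub (continuous_dir.inner continuous_const)
  obtain ⟨t, -, ht⟩ := isCompact_Icc.exists_isMinOn (s := Icc 0 (2 * Real.pi))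
    ⟨0, by simp [Real.pi_pos.le]⟩ hc.continuousOn
  rw [mem_interior_iff_mem_nhds, Metric.mem_nhds_iff]
  refine ⟨_, sub_pos.2 (hz t), fun y hy θ => ?_⟩
  have hp : Function.Periodic (fun s => inner ℝ (dir s) (γ s) - inner ℝ (dir s) z)
      (2 * Real.pi) := fun s => by simp only [dir_periodic s, h.periodic s]
  obtain ⟨s, hs, e⟩ := hp.exists_mem_Ico₀ Real.two_pi_pos θ
  have h1 := ht ⟨hs.1, hs.2.le⟩
  simp only [mem_ofPred_eq] at h1
  rw [← e] at h1
  have h2 : inner ℝ (dir θ) (y - z) ≤ ‖y - z‖ := by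
    simpa [norm_dir] using real_inner_le_norm (dir θ) (y - z)
  rw [Metric.mem_ball, dist_eq_norm] at hy
  rw [inner_sub_right] at h2
  linarith

theorem isClosed_region (γ : ℝ → Plane) : IsClosed (region γ) := by
  rw [region, ofPred_forall]
  exact isClosed_iInter fun _ => isClosed_le (by fun_prop) continuous_const

theorem isOuterNormal (γ : ℝ → Plane) (θ : ℝ) :
    IsOuterNormal (region γ) (γ θ) (dir θ) := fun _ hz => hz θ

theorem frontier_region (h : SupportCurve γ ρ) : frontier (region γ) = range γ := by
  ext z
  rw [(isClosed_region γ).frontier_eq, mem_sdiff]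
  constructor
  · rintro ⟨hz, hi⟩
    by_contra hne
    refine hi (h.mem_interior_region fun θ => lt_of_le_of_ne (hz θ) fun e => ?_)
    exact hne ⟨θ, (h.eq_of_inner_eq hz e).symm⟩
  · rintro ⟨θ, rfl⟩
    refine ⟨h.mem_region θ, fun hi => ?_⟩
    rw [mem_interior_iff_mem_nhds, Metric.mem_nhds_iff] at hi
    obtain ⟨ε, hε, hb⟩ := hi
    have : γ θ + (ε / 2) • dir θ ∈ region γ := hb (by
      rw [Metric.mem_ball, dist_eq_norm, add_sub_cancel_left, norm_smul, norm_dir]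
      simp only [Real.norm_eq_abs, mul_one]
      rw [abs_of_pos (by positivity)]; linarith)
    have := this θ
    rw [inner_add_right, inner_smul_right, inner_dir_dir] at this
    simp at this
    linarith

theorem isConvexDisk_region (h : SupportCurve γ ρ) : IsConvexDisk (region γ) := by
  refine ⟨?_, ?_, 0, h.mem_interior_region fun θ => by simpa using h.inner_pos θ⟩
  · refine Metric.isCompact_of_isClosed_isBounded (isClosed_region γ) ?_
    obtain ⟨R, hR⟩ := (h.periodic.compact_of_continuous Real.two_pi_pos.ne'
      h.continuous).isBounded.exists_norm_le
    refine isBounded_iff_forall_norm_le.2 ⟨R, fun z hz => ?_⟩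
    obtain ⟨θ, e⟩ := exists_eq_smul_dir z
    have h1 := hz θ
    rw [e, inner_smul_right, inner_dir_dir] at h1
    have h2 := real_inner_le_norm (dir θ) (γ θ)
    rw [norm_dir, one_mul] at h2
    have h3 := hR _ (mem_range_self θ)
    simp only [sub_self, Real.cos_zero, mul_one] at h1
    linarith
  · rw [region, ofPred_forall]
    exact convex_iInter fun θ => convex_halfSpace_le (innerSL ℝ (dir θ)).isLinear _

theorem neg_mem_region (h : SupportCurve γ ρ) {x : Plane} (hx : x ∈ region γ) :
    -x ∈ region γ := fun θ => by
  have := hx (θ + Real.pi)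
  rw [dir_add_pi, h.antip] at this
  simpa using this

/-- At a point of the curve, only nonnegative multiples of `dir θ` are outer normals. -/
theorem normal_unique (h : SupportCurve γ ρ) {θ : ℝ} {u : Plane}
    (hu : IsOuterNormal (region γ) (γ θ) u) : u = ‖u‖ • dir θ := by
  obtain ⟨φ, e⟩ := exists_eq_smul_dir u
  by_cases h0 : ‖u‖ = 0
  · rw [h0, zero_smul]; exact norm_eq_zero.1 h0
  have hpos : 0 < ‖u‖ := lt_of_le_of_ne (norm_nonneg u) (Ne.symm h0)
  obtain ⟨t, ht, e2⟩ := dir_periodic.exists_mem_Ico Real.two_pi_pos φ (θ - Real.pi)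
  have h1 := hu (γ t) (h.mem_region t)
  rw [e, inner_smul_left, inner_smul_left, e2] at h1
  simp only [conj_trivial] at h1
  have h2 := le_of_mul_le_mul_left h1 hpos
  by_cases hne : t = θ
  · rwa [e2, hne] at e
  · have := h.inner_lt (θ := t) (s := θ) (by linarith [ht.2]) (by linarith [ht.1]) (Ne.symm hne)
    linarith

end SupportCurve

/-! ### Boundaries of class `C²` with positive curvature -/

theorem exists_inverse_of_hasDerivAt_pos {φ κ : ℝ → ℝ} (hφ : ∀ t, HasDerivAt φ (κ t) t)
    (hκ : ∀ t, 0 < κ t) (htop : Filter.Tendsto φ Filter.atTop Filter.atTop)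
    (hbot : Filter.Tendsto φ Filter.atBot Filter.atBot) :
    ∃ ψ : ℝ → ℝ, (∀ x, φ (ψ x) = x) ∧ (∀ t, ψ (φ t) = t) ∧
      ∀ x, HasDerivAt ψ (κ (ψ x))⁻¹ x := by
  have hc : Continuous φ := continuous_iff_continuousAt.2 fun t => (hφ t).continuousAt
  have hm : StrictMono φ := strictMono_of_deriv_pos fun t => by rw [(hφ t).deriv]; exact hκ t
  let e := hm.orderIsoOfSurjective φ (hc.surjective htop hbot)
  have h1 : ∀ x, φ (e.symm x) = x := fun x => e.apply_symm_apply x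
  refine ⟨e.symm, h1, fun t => e.symm_apply_apply t, fun x => ?_⟩
  exact (hφ _).of_local_left_inverse e.symm.continuous.continuousAt (hκ _).ne'
    (Filter.Eventually.of_forall h1)

namespace SupportCurve

variable {γ : ℝ → Plane} {ρ : ℝ → ℝ}

theorem hasDerivAt_add_pi (h : SupportCurve γ ρ) (θ : ℝ) : ρ (θ + Real.pi) = ρ θ := by
  have h1 : HasDerivAt (fun s => γ (s + Real.pi)) (ρ (θ + Real.pi) • tang (θ + Real.pi)) θ :=
    (h.hasDerivAt (θ + Real.pi)).comp_add_const θ Real.pi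
  have h2 : HasDerivAt (fun s => γ (s + Real.pi)) (-(ρ θ • tang θ)) θ := by
    simp only [h.antip]; exact (h.hasDerivAt θ).neg
  have h3 := h1.unique h2
  rw [tang_add_pi, smul_neg, neg_inj] at h3
  have h4 := congrArg (inner ℝ (tang θ)) h3
  rw [inner_smul_right, inner_smul_right, inner_tang_tang] at h4
  simpa using h4

theorem radius_periodic (h : SupportCurve γ ρ) : Function.Periodic ρ Real.pi :=
  h.hasDerivAt_add_pi

theorem exists_radius_bounds (h : SupportCurve γ ρ) :
    ∃ m M : ℝ, 0 < m ∧ ∀ θ, m ≤ ρ θ ∧ ρ θ ≤ M := by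
  obtain ⟨a, -, ha⟩ := isCompact_Icc.exists_isMinOn (s := Icc 0 Real.pi)
    ⟨0, by simp [Real.pi_pos.le]⟩ h.cont.continuousOn
  obtain ⟨b, -, hb⟩ := isCompact_Icc.exists_isMaxOn (s := Icc 0 Real.pi)
    ⟨0, by simp [Real.pi_pos.le]⟩ h.cont.continuousOn
  refine ⟨ρ a, ρ b, h.pos a, fun θ => ?_⟩
  obtain ⟨s, hs, e⟩ := h.radius_periodic.exists_mem_Ico₀ Real.pi_pos θ
  rw [e]
  exact ⟨ha ⟨hs.1, hs.2.le⟩, hb ⟨hs.1, hs.2.le⟩⟩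

/-- The arclength is the integral of `ρ`. Parametrized by its inverse `ψ`, the curve has tangent
`tang (ψ t)` and curvature `1 / ρ (ψ t)`, so continuity of `ρ` is exactly what class `C²` needs. -/
theorem isC2Plus_region (h : SupportCurve γ ρ) : IsC2Plus (region γ) := by
  obtain ⟨m, M, hm, hb⟩ := h.exists_radius_bounds
  set φ : ℝ → ℝ := fun t => ∫ s in (0 : ℝ)..t, ρ s
  have hφ : ∀ t, HasDerivAt φ (ρ t) t := fun t =>
    intervalIntegral.integral_hasDerivAt_right (h.cont.intervalIntegrable _ _)
      (h.cont.stronglyMeasurableAtFilter _ _) h.cont.continuousAt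
  have hφ0 : φ 0 = 0 := by simp [φ]
  have hd : Differentiable ℝ φ := fun t => (hφ t).differentiableAt
  have hlow : ∀ x y, x ≤ y → m * (y - x) ≤ φ y - φ x := fun x y hxy =>
    mul_sub_le_image_sub_of_le_deriv hd (fun t => by rw [(hφ t).deriv]; exact (hb t).1) hxy
  have htop : Filter.Tendsto φ Filter.atTop Filter.atTop := by
    refine Filter.tendsto_atTop_mono' _ ?_ (Filter.tendsto_id.const_mul_atTop hm)
    filter_upwards [Filter.eventually_ge_atTop 0] with t ht
    have := hlow 0 t ht
    simp only [id]; rw [hφ0] at this; linarith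
  have hbot : Filter.Tendsto φ Filter.atBot Filter.atBot := by
    refine Filter.tendsto_atBot_mono' _ ?_ (Filter.tendsto_id.const_mul_atBot hm)
    filter_upwards [Filter.eventually_le_atBot 0] with t ht
    have := hlow t 0 ht
    simp only [id]; rw [hφ0] at this; linarith
  obtain ⟨ψ, h1, h2, h3⟩ := exists_inverse_of_hasDerivAt_pos hφ h.pos htop hbot
  have hψ : Continuous ψ := continuous_iff_continuousAt.2 fun t => (h3 t).continuousAt
  have hd1 : ∀ t, HasDerivAt (γ ∘ ψ) (tang (ψ t)) t := fun t => by
    refine ((h.hasDerivAt (ψ t)).scomp t (h3 t)).congr_deriv ?_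
    rw [smul_smul, inv_mul_cancel₀ (h.pos _).ne', one_smul]
  have hd2 : ∀ t, HasDerivAt (fun t => tang (ψ t)) ((ρ (ψ t))⁻¹ • -dir (ψ t)) t := fun t =>
    (hasDerivAt_tang (ψ t)).scomp t (h3 t)
  have e1 : deriv (γ ∘ ψ) = fun t => tang (ψ t) := funext fun t => (hd1 t).deriv
  have e2 : deriv (fun t => tang (ψ t)) = fun t => (ρ (ψ t))⁻¹ • -dir (ψ t) :=
    funext fun t => (hd2 t).deriv
  refine ⟨γ ∘ ψ, ?_, fun t => ?_, ?_, fun t => ?_⟩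
  · rw [show (2 : WithTop ℕ∞) = 1 + 1 by norm_num, contDiff_succ_iff_deriv]
    refine ⟨fun t => (hd1 t).differentiableAt, by simp, ?_⟩
    rw [e1, contDiff_one_iff_deriv, e2]
    refine ⟨fun t => (hd2 t).differentiableAt, ?_⟩
    exact ((h.cont.comp hψ).inv₀ fun t => (h.pos _).ne').smul (continuous_dir.comp hψ).neg
  · rw [e1]; exact norm_tang _
  · rw [h.frontier_region]
    exact (Function.RightInverse.surjective h2).range_comp γ
  · rw [e1, e2, det2_smul_right, det2_tang_left, inner_neg_right, inner_dir_dir]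
    simpa using h.pos (ψ t)

end SupportCurve

/-- If the tangent angle converged to `l`, the component of the curve along `tang l` would
eventually grow with speed at least `1 / 2`. Over a time `4 R + 2` it would gain more than `2 R`,
the width of the strip that it must stay in. -/
theorem not_tendsto_angle_of_bounded {Γ : ℝ → Plane} {φ : ℝ → ℝ} {R : ℝ}
    (hΓ : ∀ t, HasDerivAt Γ (tang (φ t)) t) (hR : ∀ t, ‖Γ t‖ ≤ R) (l : ℝ) :
    ¬ Filter.Tendsto φ Filter.atTop (𝓝 l) := by
  intro hl
  have hc : Filter.Tendsto (fun t => inner ℝ (tang l) (tang (φ t))) Filter.atTop (𝓝 1) := by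
    have : Continuous fun x => inner ℝ (tang l) (tang x) := continuous_const.inner continuous_tang
    have h1 := (this.tendsto l).comp hl
    simpa only [inner_tang_tang, Function.comp_def, sub_self, Real.cos_zero] using h1
  obtain ⟨T, hT⟩ := Filter.eventually_atTop.1
    (hc.eventually (lt_mem_nhds (show (1 / 2 : ℝ) < 1 by norm_num)))
  have hF : ∀ t, HasDerivAt (fun s => inner ℝ (tang l) (Γ s)) (inner ℝ (tang l) (tang (φ t))) t :=
    fun t => hasDerivAt_inner_const _ (hΓ t)
  have hb : ∀ t, |inner ℝ (tang l) (Γ t)| ≤ R := fun t => by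
    have := abs_real_inner_le_norm (tang l) (Γ t)
    rw [norm_tang, one_mul] at this
    exact this.trans (hR t)
  have hR0 : 0 ≤ R := (norm_nonneg _).trans (hR 0)
  have := (convex_Ici T).mul_sub_le_image_sub_of_le_deriv
    (f := fun s => inner ℝ (tang l) (Γ s)) (C := 1 / 2)
    (fun t _ => (hF t).continuousAt.continuousWithinAt)
    (fun t _ => (hF t).differentiableAt.differentiableWithinAt)
    (fun t ht => by
      rw [(hF t).deriv]
      rw [interior_Ici] at ht
      exact (hT t (le_of_lt ht)).le) T (mem_Ici.2 le_rfl) (T + 4 * R + 2)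
      (mem_Ici.2 (by linarith)) (by linarith)
  have h1 := abs_le.1 (hb T)
  have h2 := abs_le.1 (hb (T + 4 * R + 2))
  linarith

/-- A curve of unit speed and positive curvature that stays in a bounded set can be
parametrized by the direction of its tangent. -/
theorem exists_angle_parametrization {Γ : ℝ → Plane} (hC : ContDiff ℝ 2 Γ)
    (hu : ∀ t, ‖deriv Γ t‖ = 1) (hκ : ∀ t, 0 < det2 (deriv Γ t) (deriv (deriv Γ) t))
    {R : ℝ} (hR : ∀ t, ‖Γ t‖ ≤ R) :
    ∃ (γ : ℝ → Plane) (ρ : ℝ → ℝ), range γ = range Γ ∧ Continuous ρ ∧ (∀ θ, 0 < ρ θ) ∧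
      ∀ θ, HasDerivAt γ (ρ θ • tang θ) θ := by
  set T := deriv Γ with hT
  set κ : ℝ → ℝ := fun t => det2 (T t) (deriv T t) with hκd
  have hC' : ContDiff ℝ (1 + 1) Γ := by convert hC using 1; norm_num
  rw [contDiff_succ_iff_deriv, contDiff_one_iff_deriv] at hC'
  obtain ⟨d1, -, d2, c2⟩ := hC'
  have hΓ : ∀ t, HasDerivAt Γ (T t) t := fun t => (d1 t).hasDerivAt
  have hTd : ∀ t, HasDerivAt T (deriv T t) t := fun t => (d2 t).hasDerivAt
  have hκc : Continuous κ := continuous_det2 d2.continuous c2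
  have horth : ∀ t, T t 0 * deriv T t 0 + T t 1 * deriv T t 1 = 0 := fun t => by
    have h1 : HasDerivAt (fun s => T s 0 ^ 2 + T s 1 ^ 2)
        (2 * (T t 0 * deriv T t 0 + T t 1 * deriv T t 1)) t := by
      refine (((hasDerivAt_plane_apply (hTd t) 0).pow 2).add
        ((hasDerivAt_plane_apply (hTd t) 1).pow 2)).congr_deriv ?_
      push_cast; ring
    have h2 : (fun s => T s 0 ^ 2 + T s 1 ^ 2) = fun _ => 1 := funext fun s => by
      rw [← norm_sq_plane, hu]; norm_num
    rw [h2] at h1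
    linarith [h1.unique (hasDerivAt_const t (1 : ℝ))]
  have hunit : ∀ t, T t 0 ^ 2 + T t 1 ^ 2 = 1 := fun t => by
    rw [← norm_sq_plane, hu]; norm_num
  have hT0 : ∀ t, deriv T t 0 = -κ t * T t 1 := fun t => by
    simp only [hκd, det2]
    linear_combination (-deriv T t 0) * hunit t + T t 0 * horth t
  have hT1 : ∀ t, deriv T t 1 = κ t * T t 0 := fun t => by
    simp only [hκd, det2]
    linear_combination (-deriv T t 1) * hunit t + T t 1 * horth t
  obtain ⟨a, ha⟩ := exists_eq_smul_dir (T 0)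
  rw [hu, one_smul] at ha
  -- `φ` is the normal angle; the shift by `π / 2` makes `tang (φ 0)` the initial tangent `dir a`.
  set φ : ℝ → ℝ := fun t => (a - Real.pi / 2) + ∫ s in (0 : ℝ)..t, κ s
  have hφ : ∀ t, HasDerivAt φ (κ t) t := fun t =>
    (intervalIntegral.integral_hasDerivAt_right (hκc.intervalIntegrable _ _)
      (hκc.stronglyMeasurableAtFilter _ _) hκc.continuousAt).const_add _
  have hφ0 : φ 0 = a - Real.pi / 2 := by simp [φ]
  -- Two unit vectors that turn at the same rate keep a constant inner product, here `1`.
  have hTφ : ∀ t, T t = tang (φ t) := by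
    have hz : ∀ t, HasDerivAt (fun s => inner ℝ (tang (φ s)) (T s)) 0 t := fun t => by
      refine (((hasDerivAt_tang (φ t)).scomp t (hφ t)).inner ℝ (hTd t)).congr_deriv ?_
      simp only [Function.comp, inner_plane, hT0, hT1]
      simp
      ring
    intro t
    have h1 := is_const_of_deriv_eq_zero (fun t => (hz t).differentiableAt)
      (fun t => (hz t).deriv) t 0
    have h2 : tang (φ 0) = T 0 := by
      rw [hφ0, ha]
      apply plane_ext <;> simp [Real.cos_sub_pi_div_two, Real.sin_sub_pi_div_two]
    rw [h2, real_inner_self_eq_norm_sq, hu, one_pow,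
      inner_eq_one_iff_of_norm_eq_one (norm_tang _) (hu t)] at h1
    exact h1.symm
  have hΓφ : ∀ t, HasDerivAt Γ (tang (φ t)) t := fun t => hTφ t ▸ hΓ t
  have hmono : StrictMono φ := strictMono_of_deriv_pos fun t => by rw [(hφ t).deriv]; exact hκ t
  have htop : Filter.Tendsto φ Filter.atTop Filter.atTop := by
    rcases tendsto_atTop_of_monotone hmono.monotone with h | ⟨l, h⟩
    · exact h
    · exact absurd h (not_tendsto_angle_of_bounded hΓφ hR l)
  have hbot : Filter.Tendsto φ Filter.atBot Filter.atBot := by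
    have ha : Antitone fun t => φ (-t) := fun x y hxy => hmono.monotone (neg_le_neg hxy)
    rcases tendsto_atTop_of_antitone ha with h | ⟨l, h⟩
    · simpa [Function.comp_def] using h.comp Filter.tendsto_neg_atBot_atTop
    · refine absurd h (not_tendsto_angle_of_bounded (Γ := fun t => -Γ (-t)) (R := R)
        (fun t => ?_) (fun t => by rw [norm_neg]; exact hR _) l)
      have := ((hΓφ (-t)).scomp t (hasDerivAt_neg t)).neg
      simp only [Function.comp_def, neg_smul, one_smul, neg_neg] at this
      exact this
  obtain ⟨ψ, h1, h2, h3⟩ := exists_inverse_of_hasDerivAt_pos hφ hκ htop hbot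
  have hψ : Continuous ψ := continuous_iff_continuousAt.2 fun t => (h3 t).continuousAt
  refine ⟨Γ ∘ ψ, fun θ => (κ (ψ θ))⁻¹, (Function.RightInverse.surjective h2).range_comp Γ,
    (hκc.comp hψ).inv₀ fun t => (hκ _).ne', fun θ => inv_pos.2 (hκ _), fun θ => ?_⟩
  have := (hΓφ (ψ θ)).scomp θ (h3 θ)
  rwa [h1] at this

/-! ### Symmetric disks as regions of support curves -/

theorem exists_isOuterNormal {C : Set Plane} (hC : IsConvexDisk C) {x : Plane}
    (hx : x ∈ frontier C) : ∃ u : Plane, u ≠ 0 ∧ IsOuterNormal C x u := by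
  obtain ⟨hcomp, hconv, hne⟩ := hC
  obtain ⟨f, hf⟩ := geometric_hahn_banach_open_point hconv.interior isOpen_interior hx.2
  refine ⟨(InnerProductSpace.toDual ℝ Plane).symm f, fun h0 => ?_, fun z hz => ?_⟩
  · obtain ⟨a, ha⟩ := hne
    have : f = 0 := by simpa using h0
    have := hf a ha
    simp_all
  · rw [InnerProductSpace.toDual_symm_apply, InnerProductSpace.toDual_symm_apply]
    have hz' : z ∈ closure (interior C) := by
      rw [hconv.closure_interior_eq_closure_of_nonempty_interior hne]
      exact subset_closure hz
    exact closure_minimal (fun a ha => (hf a ha).le)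
      (isClosed_le f.continuous continuous_const) hz'

/-- The parametrization by tangent angle knows nothing of the side on which `C` lies. Hahn–Banach
gives some normal at `γ θ`; the first-order condition makes it parallel to `dir θ`, and positive
curvature decides the sign. -/
theorem exists_supportCurve {C : Set Plane} (hC : IsConvexDisk C) (hs : ∀ x ∈ C, -x ∈ C)
    (h2 : IsC2Plus C) : ∃ γ ρ, SupportCurve γ ρ ∧ C = region γ := by
  obtain ⟨Γ, hΓ, hu, hr, hκ⟩ := h2
  have hcl : IsClosed C := hC.1.isClosed
  have hsub : frontier C ⊆ C := hcl.frontier_subset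
  obtain ⟨R, hR⟩ := hC.1.isBounded.exists_norm_le
  obtain ⟨γ, ρ, hrange, hc, hpos, hd⟩ := exists_angle_parametrization hΓ hu hκ
    (R := R) fun t => hR _ (hsub (hr ▸ mem_range_self t))
  have hγ : ∀ θ, γ θ ∈ frontier C := fun θ => hr ▸ hrange ▸ mem_range_self θ
  have hmem : ∀ θ, γ θ ∈ C := fun θ => hsub (hγ θ)
  have hnormal : ∀ θ, ∀ z ∈ C, inner ℝ (dir θ) z ≤ inner ℝ (dir θ) (γ θ) := by
    intro θ
    obtain ⟨u, hu0, hn⟩ := exists_isOuterNormal hC (hγ θ)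
    have hpu : 0 < ‖u‖ := norm_pos_iff.2 hu0
    obtain ⟨a, ha⟩ := exists_eq_smul_dir u
    have hF : ∀ s, HasDerivAt (fun s => inner ℝ u (γ s)) (‖u‖ * ρ s * Real.sin (a - s)) s :=
      fun s => by
        refine (hasDerivAt_inner_const u (hd s)).congr_deriv ?_
        rw [inner_smul_right]; nth_rw 1 [ha]
        rw [inner_smul_left, inner_dir_tang]; simp; ring
    have hmax : IsLocalMax (fun s => inner ℝ u (γ s)) θ :=
      Filter.Eventually.of_forall fun s => hn _ (hmem s)
    have hsin : Real.sin (a - θ) = 0 := by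
      have := hmax.hasDerivAt_eq_zero (hF θ)
      have hp := mul_pos hpu (hpos θ)
      rcases mul_eq_zero.1 this with h | h
      · exact absurd h hp.ne'
      · exact h
    have hsc := Real.sin_sq_add_cos_sq (a - θ)
    rw [hsin] at hsc
    have hcos : Real.cos (a - θ) = 1 ∨ Real.cos (a - θ) = -1 := by
      have h0 : (Real.cos (a - θ) - 1) * (Real.cos (a - θ) + 1) = 0 := by linarith
      rcases mul_eq_zero.1 h0 with h | h
      · exact Or.inl (by linarith)
      · exact Or.inr (by linarith)
    -- With the opposite sign, the inner product with `u` would increase along the next half turn,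
    -- although it is maximal at `γ θ`.
    have hcase : Real.cos (a - θ) = 1 := by
      rcases hcos with h | h
      · exact h
      · exfalso
        have hsm : StrictMonoOn (fun s => inner ℝ u (γ s)) (Icc θ (θ + Real.pi)) := by
          refine strictMonoOn_of_deriv_pos (convex_Icc _ _)
            (fun s _ => (hF s).continuousAt.continuousWithinAt) fun s hs => ?_
          rw [interior_Icc] at hs
          rw [(hF s).deriv, show a - s = (a - θ) + (θ - s) by ring, Real.sin_add, hsin, h]
          have : Real.sin (θ - s) < 0 :=
            Real.sin_neg_of_neg_of_neg_pi_lt (by linarith [hs.1]) (by linarith [hs.2])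
          have hp := mul_pos hpu (hpos s)
          nlinarith
        have := hsm ⟨le_rfl, by linarith [Real.pi_pos]⟩ ⟨by linarith [Real.pi_pos], le_rfl⟩
          (show θ < θ + Real.pi by linarith [Real.pi_pos])
        exact absurd (hn _ (hmem (θ + Real.pi))) (not_le.2 this)
    have hda : dir a = dir θ := by
      apply plane_ext
      · simp only [dir_apply_zero]
        rw [show a = (a - θ) + θ by ring, Real.cos_add, hsin, hcase]; ring
      · simp only [dir_apply_one]
        rw [show a = (a - θ) + θ by ring, Real.sin_add, hsin, hcase]; ring
    intro z hz
    have := hn z hz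
    rw [ha, hda, inner_smul_left, inner_smul_left] at this
    exact le_of_mul_le_mul_left this hpu
  have hsupp : ∀ θ, HasDerivAt (fun s => inner ℝ (dir s) (γ s)) (inner ℝ (tang θ) (γ θ)) θ :=
    fun θ => by
      refine ((hasDerivAt_dir θ).inner ℝ (hd θ)).congr_deriv ?_
      rw [inner_smul_right, inner_dir_tang]; simp
  have hsym : ∀ θ, inner ℝ (dir (θ + Real.pi)) (γ (θ + Real.pi)) = inner ℝ (dir θ) (γ θ) := by
    intro θ
    apply le_antisymm
    · have := hnormal θ _ (hs _ (hmem (θ + Real.pi)))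
      rw [dir_add_pi]; simpa using this
    · have := hnormal (θ + Real.pi) _ (hs _ (hmem θ))
      rw [dir_add_pi] at this ⊢
      simpa using this
  refine ⟨γ, ρ, ⟨hd, hc, hpos, fun θ => ?_⟩, ?_⟩
  -- The support function is `π`-periodic by symmetry of `C`. Its value and its derivative are the
  -- normal and the tangential component of `γ`, so both components change sign after a half turn.
  · have h1 : HasDerivAt (fun s => inner ℝ (dir s) (γ s))
        (inner ℝ (tang (θ + Real.pi)) (γ (θ + Real.pi))) θ := by
      have := (hsupp (θ + Real.pi)).comp_add_const θ Real.pi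
      simpa only [hsym] using this
    have h2 := h1.unique (hsupp θ)
    have h3 := hsym θ
    rw [tang_add_pi] at h2
    rw [dir_add_pi] at h3
    refine eq_of_inner_dir_tang (θ := θ) ?_ ?_
    · rw [inner_neg_left] at h3
      rw [inner_neg_right]; linarith
    · rw [inner_neg_left] at h2
      rw [inner_neg_right]; linarith
  · refine Subset.antisymm (fun z hz θ => hnormal θ z hz) fun z hz => ?_
    by_contra hzC
    obtain ⟨f, c, hf1, hf2⟩ := geometric_hahn_banach_closed_point hC.2.1 hcl hzC
    set u := (InnerProductSpace.toDual ℝ Plane).symm f with hu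
    have hfu : ∀ y, f y = inner ℝ u y := fun y => by
      rw [hu, InnerProductSpace.toDual_symm_apply]
    obtain ⟨θ, hθ⟩ := exists_eq_smul_dir u
    have h1 := hf1 _ (hmem θ)
    rw [hfu, hθ, inner_smul_left] at h1 hf2
    have h3 := hz θ
    have : ‖u‖ * inner ℝ (dir θ) z ≤ ‖u‖ * inner ℝ (dir θ) (γ θ) :=
      mul_le_mul_of_nonneg_left h3 (norm_nonneg u)
    simp only [conj_trivial] at h1 hf2
    linarith

/-! ### The perimeter measure distance in terms of the radii of curvature -/

/-- On `S` the hypothesis makes `f` factor through `g`, and the factor is `k`-Lipschitz on `g '' S`.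
-/
theorem hausdorffMeasure_image_le_of_dist_le {X Y : Type*} [MetricSpace X] [MeasurableSpace X]
    [BorelSpace X] [MetricSpace Y] [MeasurableSpace Y] [BorelSpace Y] {f : ℝ → X} {g : ℝ → Y}
    {S : Set ℝ} {k : ℝ≥0}
    (h : ∀ x ∈ S, ∀ y ∈ S, dist (f x) (f y) ≤ k * dist (g x) (g y)) :
    μH[1] (f '' S) ≤ k * μH[1] (g '' S) := by
  have key : ∀ x ∈ S, f (Function.invFunOn g S (g x)) = f x := fun x hx => by
    have h1 : g x ∈ g '' S := mem_image_of_mem g hx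
    have h2 := h _ (Function.invFunOn_mem h1) x hx
    rw [Function.invFunOn_eq h1, dist_self, mul_zero] at h2
    exact dist_le_zero.1 h2
  have hL : LipschitzOnWith k (fun y => f (Function.invFunOn g S y)) (g '' S) := by
    refine LipschitzOnWith.of_dist_le_mul ?_
    rintro _ ⟨x, hx, rfl⟩ _ ⟨y, hy, rfl⟩
    rw [key x hx, key y hy]
    exact h x hx y hy
  have h3 := hL.hausdorffMeasure_image_le zero_le_one
  rw [ENNReal.rpow_one, image_image, image_congr key] at h3
  exact h3

theorem exists_dist_bounds_of_hasStrictDerivAt {f : ℝ → Plane} {v : Plane} {t r : ℝ}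
    (hf : HasStrictDerivAt f v t) (hr : ‖v‖ = r) {η : ℝ} (hη : 0 < η) :
    ∃ δ > 0, ∀ x ∈ Metric.ball t δ, ∀ y ∈ Metric.ball t δ,
      dist (f x) (f y) ≤ (r + η) * dist x y ∧ (r - η) * dist x y ≤ dist (f x) (f y) := by
  have h := hf.isLittleO.def hη
  rw [Metric.eventually_nhds_iff] at h
  obtain ⟨δ, hδ, h⟩ := h
  refine ⟨δ, hδ, fun x hx y hy => ?_⟩
  have h1 := h (y := (x, y)) (by
    rw [Prod.dist_eq]; exact max_lt hx hy)
  simp only [ContinuousLinearMap.toSpanSingleton_apply] at h1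
  have h2 : ‖(x - y) • v‖ = r * ‖x - y‖ := by rw [norm_smul, hr, mul_comm]
  have h3 := abs_le.1 ((abs_norm_sub_norm_le (f x - f y) ((x - y) • v)).trans h1)
  rw [h2] at h3
  rw [dist_eq_norm, dist_eq_norm]
  constructor <;> nlinarith [h3.1, h3.2]

theorem supportCurve_dir : SupportCurve dir fun _ => 1 :=
  ⟨fun θ => by simpa using hasDerivAt_dir θ, continuous_const, fun _ => one_pos, dir_add_pi⟩

/-! ### Comparison of a support curve with the unit circle -/

namespace SupportCurve

variable {γ : ℝ → Plane} {ρ : ℝ → ℝ}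

theorem hasStrictDerivAt (h : SupportCurve γ ρ) (θ : ℝ) :
    HasStrictDerivAt γ (ρ θ • tang θ) θ :=
  hasStrictDerivAt_of_hasDerivAt_of_continuousAt (Filter.Eventually.of_forall h.hasDerivAt)
    (h.cont.smul continuous_tang).continuousAt

theorem normalPreimage_region (h : SupportCurve γ ρ) (S : Set ℝ) :
    normalPreimage (region γ) (dir '' S) = γ '' S := by
  ext p
  rw [normalPreimage, h.frontier_region]
  constructor
  · rintro ⟨⟨θ, rfl⟩, _, ⟨s, hs, rfl⟩, hn⟩
    exact ⟨s, hs, (h.eq_of_inner_eq (h.mem_region θ)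
      (le_antisymm (h.inner_le s θ) (hn _ (h.mem_region s)))).symm⟩
  · rintro ⟨s, hs, rfl⟩
    exact ⟨mem_range_self s, dir s, mem_image_of_mem _ hs, isOuterNormal γ s⟩

theorem injOn_Ico (h : SupportCurve γ ρ) : InjOn γ (Ico 0 (2 * Real.pi)) := by
  have key : ∀ s t, t < s → s < t + 2 * Real.pi → γ s ≠ γ t := by
    intro s t h1 h2 e
    rcases le_or_gt s (t + Real.pi) with h3 | h3
    · have := h.inner_lt (θ := t) (s := s) (by linarith [Real.pi_pos]) h3 h1.ne'
      rw [e] at this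
      exact lt_irrefl _ this
    · have := h.inner_lt (θ := t) (s := s - 2 * Real.pi) (by linarith) (by linarith [Real.pi_pos])
        (by linarith)
      rw [h.periodic.sub_eq, e] at this
      exact lt_irrefl _ this
  intro s hs t ht e
  rcases lt_trichotomy s t with h1 | h1 | h1
  · exact absurd e.symm (key t s h1 (by linarith [ht.2, hs.1]))
  · exact h1
  · exact absurd e (key s t h1 (by linarith [hs.2, ht.1]))

theorem exists_dist_le (h : SupportCurve γ ρ) (θ : ℝ) {k : ℝ≥0} (hk : ρ θ < k) :
    ∃ δ > 0, ∀ x ∈ Metric.ball θ δ, ∀ y ∈ Metric.ball θ δ,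
      dist (γ x) (γ y) ≤ k * dist (dir x) (dir y) := by
  -- This `η` solves `ρ θ + η = k (1 - η)`: the upper Lipschitz bound for `γ` then equals `k` times
  -- the lower one for `dir`.
  have hη : 0 < (k - ρ θ) / (1 + k) := div_pos (by linarith) (by positivity)
  have e : (k - ρ θ) / (1 + k) * (1 + k) = k - ρ θ := div_mul_cancel₀ _ (by positivity)
  set η := (k - ρ θ) / (1 + k)
  obtain ⟨δ₁, h₁, hb₁⟩ := exists_dist_bounds_of_hasStrictDerivAt (h.hasStrictDerivAt θ)
    (r := ρ θ) (by rw [norm_smul, norm_tang, mul_one, Real.norm_of_nonneg (h.pos θ).le]) hη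
  obtain ⟨δ₂, h₂, hb₂⟩ := exists_dist_bounds_of_hasStrictDerivAt
    (supportCurve_dir.hasStrictDerivAt θ) (r := 1) (by simp [norm_tang]) hη
  refine ⟨min δ₁ δ₂, lt_min h₁ h₂, fun x hx y hy => ?_⟩
  have a := (hb₁ x (Metric.ball_subset_ball (min_le_left _ _) hx) y
    (Metric.ball_subset_ball (min_le_left _ _) hy)).1
  have b := (hb₂ x (Metric.ball_subset_ball (min_le_right _ _) hx) y
    (Metric.ball_subset_ball (min_le_right _ _) hy)).2
  refine a.trans (le_trans (le_of_eq ?_) (mul_le_mul_of_nonneg_left b k.2))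
  linear_combination dist x y * e

theorem exists_le_dist (h : SupportCurve γ ρ) (θ : ℝ) {k : ℝ≥0} (hk : k < ρ θ) :
    ∃ δ > 0, ∀ x ∈ Metric.ball θ δ, ∀ y ∈ Metric.ball θ δ,
      k * dist (dir x) (dir y) ≤ dist (γ x) (γ y) := by
  -- This `η` solves `ρ θ - η = k (1 + η)`.
  have hη : 0 < (ρ θ - k) / (1 + k) := div_pos (by linarith) (by positivity)
  have e : (ρ θ - k) / (1 + k) * (1 + k) = ρ θ - k := div_mul_cancel₀ _ (by positivity)
  set η := (ρ θ - k) / (1 + k)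
  obtain ⟨δ₁, h₁, hb₁⟩ := exists_dist_bounds_of_hasStrictDerivAt (h.hasStrictDerivAt θ)
    (r := ρ θ) (by rw [norm_smul, norm_tang, mul_one, Real.norm_of_nonneg (h.pos θ).le]) hη
  obtain ⟨δ₂, h₂, hb₂⟩ := exists_dist_bounds_of_hasStrictDerivAt
    (supportCurve_dir.hasStrictDerivAt θ) (r := 1) (by simp [norm_tang]) hη
  refine ⟨min δ₁ δ₂, lt_min h₁ h₂, fun x hx y hy => ?_⟩
  have a := (hb₁ x (Metric.ball_subset_ball (min_le_left _ _) hx) y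
    (Metric.ball_subset_ball (min_le_left _ _) hy)).2
  have b := (hb₂ x (Metric.ball_subset_ball (min_le_right _ _) hx) y
    (Metric.ball_subset_ball (min_le_right _ _) hy)).1
  refine (mul_le_mul_of_nonneg_left b k.2).trans (le_trans (le_of_eq ?_) a)
  simp only [NNReal.val_eq_coe]
  linear_combination dist x y * e

theorem exists_hausdorffMeasure_image_le (h : SupportCurve γ ρ) (θ : ℝ) {k : ℝ≥0}
    (hk : ρ θ < k) :
    ∃ δ > 0, ∀ S ⊆ Metric.ball θ δ, μH[1] (γ '' S) ≤ k * μH[1] (dir '' S) := by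
  obtain ⟨δ, hδ, hd⟩ := h.exists_dist_le θ hk
  exact ⟨δ, hδ, fun S hS => hausdorffMeasure_image_le_of_dist_le
    fun x hx y hy => hd x (hS hx) y (hS hy)⟩

theorem exists_le_hausdorffMeasure_image (h : SupportCurve γ ρ) (θ : ℝ) {k : ℝ≥0}
    (hk : k < ρ θ) :
    ∃ δ > 0, ∀ S ⊆ Metric.ball θ δ, k * μH[1] (dir '' S) ≤ μH[1] (γ '' S) := by
  by_cases h0 : k = 0
  · exact ⟨1, one_pos, fun S _ => by simp [h0]⟩
  obtain ⟨δ, hδ, hd⟩ := h.exists_le_dist θ hk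
  have hk0 : 0 < k := pos_iff_ne_zero.2 h0
  refine ⟨δ, hδ, fun S hS => ?_⟩
  have h1 := hausdorffMeasure_image_le_of_dist_le (f := dir) (g := γ) (S := S) (k := k⁻¹)
    fun x hx y hy => by
      rw [NNReal.coe_inv, inv_mul_eq_div, le_div_iff₀ (NNReal.coe_pos.2 hk0), mul_comm]
      exact hd x (hS hx) y (hS hy)
  rw [ENNReal.coe_inv h0] at h1
  calc (k : ℝ≥0∞) * μH[1] (dir '' S) ≤ k * ((k : ℝ≥0∞)⁻¹ * μH[1] (γ '' S)) := by gcongr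
    _ = μH[1] (γ '' S) := by
      rw [← mul_assoc, ENNReal.mul_inv_cancel (by simpa using h0) ENNReal.coe_ne_top, one_mul]

theorem measurableSet_image (h : SupportCurve γ ρ) {S : Set ℝ} (hS : MeasurableSet S)
    (hsub : S ⊆ Ico 0 (2 * Real.pi)) : MeasurableSet (γ '' S) :=
  hS.image_of_continuousOn_injOn h.continuous.continuousOn (h.injOn_Ico.mono hsub)

/-- Near each angle `γ` stretches the unit circle by less than `g + τ` and `γ'` stretches it by more
than `g`, for a suitable constant `g`; compactness and additivity of the measure make this global.
The half-open period keeps the curves injective, so that disjoint parameter sets have disjoint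
images. -/
theorem hausdorffMeasure_image_le (hγ : SupportCurve γ ρ) {γ' : ℝ → Plane} {ρ' : ℝ → ℝ}
    (hγ' : SupportCurve γ' ρ') {τ : ℝ≥0} (hτ : ∀ θ, ρ θ < ρ' θ + τ) {S : Set ℝ}
    (hS : MeasurableSet S) (hsub : S ⊆ Ico 0 (2 * Real.pi)) :
    μH[1] (γ '' S) ≤ μH[1] (γ' '' S) + τ * μH[1] (dir '' S) := by
  have hd := supportCurve_dir
  suffices H : ∃ T : Set ℝ, MeasurableSet T ∧ Icc 0 (2 * Real.pi) ⊆ T ∧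
      ∀ S ⊆ T ∩ Ico 0 (2 * Real.pi), MeasurableSet S →
        μH[1] (γ '' S) ≤ μH[1] (γ' '' S) + τ * μH[1] (dir '' S) by
    obtain ⟨T, -, hT, h⟩ := H
    exact h S (subset_inter ((hsub.trans Ico_subset_Icc_self).trans hT) hsub) hS
  -- The measurable superset `T` is part of the predicate because a union is handled by cutting `S`
  -- along it.
  refine isCompact_Icc.induction_on (p := fun U => ∃ T : Set ℝ, MeasurableSet T ∧ U ⊆ T ∧
      ∀ S ⊆ T ∩ Ico 0 (2 * Real.pi), MeasurableSet S →
        μH[1] (γ '' S) ≤ μH[1] (γ' '' S) + τ * μH[1] (dir '' S)) ?_ ?_ ?_ ?_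
  · refine ⟨∅, MeasurableSet.empty, Subset.rfl, fun S hS _ => ?_⟩
    rw [empty_inter, subset_empty_iff] at hS
    simp [hS]
  · rintro U V hUV ⟨T, h1, h2, h3⟩
    exact ⟨T, h1, hUV.trans h2, h3⟩
  · rintro U V ⟨T, h1, h2, h3⟩ ⟨T', h1', h2', h3'⟩
    refine ⟨T ∪ T', h1.union h1', union_subset_union h2 h2', fun S hS hm => ?_⟩
    have hA : S ∩ T ⊆ Ico 0 (2 * Real.pi) := fun x hx => (hS hx.1).2
    have hB : S \ T ⊆ Ico 0 (2 * Real.pi) := fun x hx => (hS hx.1).2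
    have a := h3 (S ∩ T) (fun x hx => ⟨hx.2, hA hx⟩) (hm.inter h1)
    have b := h3' (S \ T) (fun x hx => ⟨(hS hx.1).1.resolve_left hx.2, hB hx⟩) (hm.diff h1)
    have split : ∀ {g : ℝ → Plane} {r : ℝ → ℝ}, SupportCurve g r →
        μH[1] (g '' S) = μH[1] (g '' (S ∩ T)) + μH[1] (g '' (S \ T)) := by
      intro g r hg
      conv_lhs => rw [← inter_union_sdiff S T, image_union]
      refine measure_union ?_ (hg.measurableSet_image (hm.diff h1) hB)
      rw [Set.disjoint_left]
      rintro _ ⟨x, hx, rfl⟩ ⟨y, hy, e⟩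
      rw [hg.injOn_Ico (hB hy) (hA hx) e] at hy
      exact hy.2 hx.2
    rw [split hγ, split hγ', split hd]
    calc _ ≤ _ := add_le_add a b
      _ = _ := by ring
  · intro θ _
    -- The strictness of `hτ` leaves room for `g` between `ρ θ - τ` and `ρ' θ`; it must be
    -- nonnegative to serve as a Lipschitz constant.
    obtain ⟨g, hg1, hg2⟩ : ∃ g : ℝ, max 0 (ρ θ - τ) < g ∧ g < ρ' θ :=
      exists_between (max_lt (hγ'.pos θ) (by linarith [hτ θ]))
    have hg0 : 0 ≤ g := (le_max_left _ _).trans hg1.le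
    have hg3 : ρ θ - τ < g := (le_max_right _ _).trans_lt hg1
    lift g to ℝ≥0 using hg0
    obtain ⟨δ₁, h₁, hb₁⟩ := hγ.exists_hausdorffMeasure_image_le θ (k := g + τ) (by
      push_cast
      linarith)
    obtain ⟨δ₂, h₂, hb₂⟩ := hγ'.exists_le_hausdorffMeasure_image θ (k := g) hg2
    refine ⟨Metric.ball θ (min δ₁ δ₂), mem_nhdsWithin_of_mem_nhds
      (Metric.ball_mem_nhds _ (lt_min h₁ h₂)), Metric.ball θ (min δ₁ δ₂),
      measurableSet_ball, Subset.rfl, fun S hS _ => ?_⟩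
    have a := hb₁ S fun x hx => Metric.ball_subset_ball (min_le_left _ _) (hS hx).1
    have b := hb₂ S fun x hx => Metric.ball_subset_ball (min_le_right _ _) (hS hx).1
    refine a.trans ?_
    rw [ENNReal.coe_add, add_mul]
    gcongr

theorem exists_dir_image_eq {σ : Set Plane} (hσ : σ ⊆ Metric.sphere 0 1)
    (hm : MeasurableSet σ) :
    ∃ S : Set ℝ, MeasurableSet S ∧ S ⊆ Ico 0 (2 * Real.pi) ∧ dir '' S = σ := by
  refine ⟨Ico 0 (2 * Real.pi) ∩ dir ⁻¹' σ,
    measurableSet_Ico.inter (continuous_dir.measurable hm), inter_subset_left, ?_⟩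
  ext u
  constructor
  · rintro ⟨s, hs, rfl⟩; exact hs.2
  · intro hu
    obtain ⟨θ, e⟩ := exists_eq_smul_dir u
    rw [mem_sphere_zero_iff_norm.1 (hσ hu), one_smul] at e
    obtain ⟨s, hs, e2⟩ := dir_periodic.exists_mem_Ico₀ Real.two_pi_pos θ
    exact ⟨s, ⟨hs, by rw [mem_preimage, ← e2, ← e]; exact hu⟩, by rw [← e2, ← e]⟩

theorem pmDist_le (hγ : SupportCurve γ ρ) {γ' : ℝ → Plane} {ρ' : ℝ → ℝ}
    (hγ' : SupportCurve γ' ρ') {τ : ℝ≥0} (hτ : ∀ θ, |ρ θ - ρ' θ| < τ) :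
    pmDist (region γ) (region γ') ≤ τ := by
  refine iInf₂_le τ fun σ hσ hm => ?_
  obtain ⟨S, hS, hsub, rfl⟩ := exists_dir_image_eq hσ hm
  rw [surfaceArea, surfaceArea, hγ.normalPreimage_region, hγ'.normalPreimage_region]
  exact ⟨hγ.hausdorffMeasure_image_le hγ' (fun θ => by linarith [(abs_lt.1 (hτ θ)).2]) hS hsub,
    hγ'.hausdorffMeasure_image_le hγ (fun θ => by linarith [(abs_lt.1 (hτ θ)).1]) hS hsub⟩

theorem hausdorffMeasure_dir_Icc (θ : ℝ) :
    ∃ δ > 0, ∀ r, 0 < r → r < δ →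
      0 < μH[1] (dir '' Icc θ (θ + r)) ∧ μH[1] (dir '' Icc θ (θ + r)) < ∞ := by
  obtain ⟨δ, hδ, hd⟩ := exists_dist_bounds_of_hasStrictDerivAt
    (supportCurve_dir.hasStrictDerivAt θ) (r := 1) (by simp [norm_tang])
    (show (0 : ℝ) < 1 / 2 by norm_num)
  refine ⟨δ, hδ, fun r h0 h1 => ?_⟩
  have hsub : Icc θ (θ + r) ⊆ Metric.ball θ δ := fun x hx => by
    rw [Metric.mem_ball, Real.dist_eq, abs_lt]; constructor <;> linarith [hx.1, hx.2]
  have a := hausdorffMeasure_image_le_of_dist_le (f := dir) (g := (id : ℝ → ℝ)) (k := 2)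
    (S := Icc θ (θ + r)) fun x hx y hy => by
      have := (hd x (hsub hx) y (hsub hy)).1
      simp only [id, NNReal.coe_ofNat]
      linarith [dist_nonneg (x := x) (y := y)]
  have b := hausdorffMeasure_image_le_of_dist_le (f := (id : ℝ → ℝ)) (g := dir) (k := 2)
    (S := Icc θ (θ + r)) fun x hx y hy => by
      have := (hd x (hsub hx) y (hsub hy)).2
      simp only [id, NNReal.coe_ofNat]
      linarith
  rw [image_id, hausdorffMeasure_real, Real.volume_Icc, add_sub_cancel_left] at a b
  constructor
  · by_contra h
    rw [not_lt, nonpos_iff_eq_zero] at h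
    rw [h, mul_zero, nonpos_iff_eq_zero, ENNReal.ofReal_eq_zero] at b
    linarith
  · exact a.trans_lt (ENNReal.mul_lt_top (by simp) ENNReal.ofReal_lt_top)

/-- On a short arc of normals at `θ` the surface area measures are nearly `ρ θ` and `ρ' θ` times the
arc length. A violation would give `g ≤ f + τ` for constants chosen with `f + τ < g`, after division
by the length of the arc, which is positive and finite. -/
theorem radius_le_of_pmBound (hγ : SupportCurve γ ρ) {γ' : ℝ → Plane} {ρ' : ℝ → ℝ}
    (hγ' : SupportCurve γ' ρ') {τ : ℝ≥0} (hb : PMBound (region γ) (region γ') τ) (θ : ℝ) :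
    ρ θ ≤ ρ' θ + τ := by
  by_contra! hlt
  obtain ⟨g, hg1, hg2⟩ := exists_between hlt
  have hgg : 0 ≤ g := by linarith [hγ'.pos θ, show (0 : ℝ) ≤ τ from τ.2]
  obtain ⟨f, hf1, hf2⟩ := exists_between (lt_sub_iff_add_lt.2 hg1)
  have hf0 : 0 ≤ f := by linarith [hγ'.pos θ]
  lift g to ℝ≥0 using hgg
  lift f to ℝ≥0 using hf0
  obtain ⟨δ₁, h₁, hb₁⟩ := hγ.exists_le_hausdorffMeasure_image θ (k := g) hg2
  obtain ⟨δ₂, h₂, hb₂⟩ := hγ'.exists_hausdorffMeasure_image_le θ (k := f) hf1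
  obtain ⟨δ₃, h₃, hb₃⟩ := hausdorffMeasure_dir_Icc θ
  set r := min δ₁ (min δ₂ δ₃) / 2 with hr
  have hr0 : 0 < r := by positivity
  have hr1 : r < δ₁ := (half_lt_self (by positivity)).trans_le (min_le_left _ _)
  have hr2 : r < δ₂ := (half_lt_self (by positivity)).trans_le
    ((min_le_right _ _).trans (min_le_left _ _))
  have hr3 : r < δ₃ := (half_lt_self (by positivity)).trans_le
    ((min_le_right _ _).trans (min_le_right _ _))
  have hsub : ∀ δ, r < δ → Icc θ (θ + r) ⊆ Metric.ball θ δ := fun δ hδ x hx => by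
    rw [Metric.mem_ball, Real.dist_eq, abs_lt]; constructor <;> linarith [hx.1, hx.2]
  obtain ⟨hpos, hfin⟩ := hb₃ r hr0 hr3
  have a := hb₁ _ (hsub δ₁ hr1)
  have b := hb₂ _ (hsub δ₂ hr2)
  have c := (hb (dir '' Icc θ (θ + r)) (by
    rintro _ ⟨s, -, rfl⟩; simp [norm_dir])
    (isCompact_Icc.image continuous_dir).isClosed.measurableSet).1
  rw [surfaceArea, surfaceArea, hγ.normalPreimage_region, hγ'.normalPreimage_region] at c
  have e := (a.trans c).trans (add_le_add_left b _)
  rw [← add_mul, ← ENNReal.coe_add] at e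
  have e2 := (ENNReal.mul_le_mul_iff_left hpos.ne' hfin.ne).1 e
  rw [ENNReal.coe_le_coe, ← NNReal.coe_le_coe] at e2
  push_cast at e2
  linarith

theorem abs_radius_sub_le (hγ : SupportCurve γ ρ) {γ' : ℝ → Plane} {ρ' : ℝ → ℝ}
    (hγ' : SupportCurve γ' ρ') {τ : ℝ≥0} (hd : pmDist (region γ) (region γ') < τ) (θ : ℝ) :
    |ρ θ - ρ' θ| ≤ τ := by
  simp only [pmDist, iInf_lt_iff] at hd
  obtain ⟨s, hs, hlt⟩ := hd
  have hlt' : (s : ℝ) < τ := by exact_mod_cast hlt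
  have hs' : PMBound (region γ') (region γ) s := fun σ h1 h2 => (hs σ h1 h2).symm
  have a := hγ.radius_le_of_pmBound hγ' hs θ
  have b := hγ'.radius_le_of_pmBound hγ hs' θ
  rw [abs_le]; constructor <;> linarith

end SupportCurve

/-! ### Areas in the plane -/

theorem volume_preserving_toPair :
    MeasurePreserving (fun z : Plane => ((z 0, z 1) : ℝ × ℝ)) volume volume :=
  (volume_preserving_finTwoArrow ℝ).comp (PiLp.volume_preserving_ofLp (Fin 2))

theorem volume_image_toPair (s : Set Plane) :
    volume ((fun z : Plane => ((z 0, z 1) : ℝ × ℝ)) '' s) = volume s := by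
  let e : Plane ≃ᵐ ℝ × ℝ :=
    (MeasurableEquiv.toLp 2 (Fin 2 → ℝ)).symm.trans (MeasurableEquiv.finTwoArrow)
  have he : MeasurePreserving e volume volume := volume_preserving_toPair
  have : (fun z : Plane => ((z 0, z 1) : ℝ × ℝ)) '' s = e.symm ⁻¹' s := by
    rw [← MeasurableEquiv.image_eq_preimage_symm]; rfl
  rw [this, he.symm.measure_preimage_equiv]

theorem volume_line (p : Plane) {v : Plane} (hv : v ≠ 0) :
    volume {z : Plane | det2 v (z - p) = 0} = 0 := by
  let s : AffineSubspace ℝ Plane :=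
    { carrier := {z : Plane | det2 v (z - p) = 0}
      smul_vsub_vadd_mem' := by
        intro c x y z hx hy hz
        simp only [mem_ofPred_eq, det2, vsub_eq_sub, vadd_eq_add] at *
        simp at *
        linear_combination c * hx - c * hy + hz }
  refine Measure.addHaar_affineSubspace volume s fun h => hv ?_
  have h0 : ∀ z, det2 v (z - p) = 0 := fun z => by
    have : z ∈ s := h ▸ AffineSubspace.mem_top ℝ Plane z
    exact this
  have h1 := h0 (p + dir 0)
  have h2 := h0 (p + tang 0)
  rw [add_sub_cancel_left] at h1 h2
  simp [det2] at h1 h2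
  exact plane_ext (by simpa using h2) (by simpa using h1)

/-- The union of the segments from `p` to the points of the curve `c` over `(a, b)`,
without `p`. -/
def fan (p : Plane) (c : ℝ → Plane) (a b : ℝ) : Set Plane :=
  (fun x : ℝ × ℝ => p + x.2 • (c x.1 - p)) '' (Ioo a b ×ˢ Ioc 0 1)

/-- Change of variables to polar coordinates adapted to the curve: the Jacobian at `(s, r)` is `r`
times `det2 (c s - p) (c' s)`, up to sign, and the factor `r` contributes `1 / 2`. -/
theorem volume_fan {p : Plane} {c c' : ℝ → Plane} {a b : ℝ} (hab : a ≤ b)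
    (hc : ∀ s, HasDerivAt c (c' s) s) (hc' : Continuous c')
    (hpos : ∀ s ∈ Ioo a b, 0 < det2 (c s - p) (c' s))
    (hinj : ∀ s ∈ Ioo a b, ∀ t ∈ Ioo a b, s < t → 0 < det2 (c s - p) (c t - p)) :
    volume (fan p c a b) = ENNReal.ofReal (1 / 2 * ∫ s in a..b, det2 (c s - p) (c' s)) := by
  have hcc : Continuous c := continuous_iff_continuousAt.2 fun s => (hc s).continuousAt
  have hdc : Continuous fun s => det2 (c s - p) (c' s) :=
    continuous_det2 (hcc.sub continuous_const) hc'
  set F : ℝ × ℝ → ℝ × ℝ := fun x =>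
    (p 0 + x.2 * (c x.1 0 - p 0), p 1 + x.2 * (c x.1 1 - p 1)) with hF
  set F' : ℝ × ℝ → ℝ × ℝ →L[ℝ] ℝ × ℝ := fun x =>
    (Matrix.toLin (.finTwoProd ℝ) (.finTwoProd ℝ)
      !![x.2 * c' x.1 0, c x.1 0 - p 0;
        x.2 * c' x.1 1, c x.1 1 - p 1]).toContinuousLinearMap with hF'
  have himg : (fun z : Plane => ((z 0, z 1) : ℝ × ℝ)) '' fan p c a b =
      F '' (Ioo a b ×ˢ Ioc 0 1) := by
    rw [fan, image_image]
    exact image_congr fun x _ => by simp [hF]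
  have hder : ∀ x ∈ Ioo a b ×ˢ Ioc (0 : ℝ) 1,
      HasFDerivWithinAt F (F' x) (Ioo a b ×ˢ Ioc (0 : ℝ) 1) x := by
    intro x _
    apply HasFDerivAt.hasFDerivWithinAt
    have hi : ∀ i, HasFDerivAt (fun y : ℝ × ℝ => p i + y.2 * (c y.1 i - p i))
        (x.2 • (c' x.1 i • ContinuousLinearMap.fst ℝ ℝ ℝ) +
          (c x.1 i - p i) • ContinuousLinearMap.snd ℝ ℝ ℝ) x := fun i => by
      have h1 : HasFDerivAt (fun y : ℝ × ℝ => c y.1 i - p i)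
          (c' x.1 i • ContinuousLinearMap.fst ℝ ℝ ℝ) x :=
        ((hasDerivAt_plane_apply (hc x.1) i).sub_const (p i)).comp_hasFDerivAt x hasFDerivAt_fst
      exact (hasFDerivAt_snd.mul h1).const_add _
    refine ((hi 0).prodMk (hi 1)).congr_fderiv ?_
    simp only [hF']
    rw [Matrix.toLin_finTwoProd_toContinuousLinearMap]
    simp [smul_smul]
  have hdet : ∀ x ∈ Ioo a b ×ˢ Ioc (0 : ℝ) 1, ENNReal.ofReal |(F' x).det| =
      ENNReal.ofReal (det2 (c x.1 - p) (c' x.1)) * ENNReal.ofReal x.2 := by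
    intro x hx
    have h1 : (F' x).det = -(det2 (c x.1 - p) (c' x.1) * x.2) := by
      simp only [hF', LinearMap.det_toContinuousLinearMap, LinearMap.det_toLin,
        Matrix.det_fin_two_of, det2, PiLp.sub_apply]
      ring
    rw [h1, abs_neg, abs_of_pos (mul_pos (hpos _ hx.1) hx.2.1),
      ENNReal.ofReal_mul (hpos _ hx.1).le]
  have hinjF : InjOn F (Ioo a b ×ˢ Ioc 0 1) := by
    rintro ⟨s, r⟩ ⟨hs, hr⟩ ⟨t, q⟩ ⟨ht, hq⟩ e
    simp only [hF, Prod.mk.injEq, add_right_inj] at e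
    simp only at hs hr ht hq
    obtain ⟨e0, e1⟩ := e
    have hst : s = t := by
      have key : r * det2 (c s - p) (c t - p) = 0 := by
        simp only [det2, PiLp.sub_apply]
        linear_combination (c t 1 - p 1) * e0 - (c t 0 - p 0) * e1
      have key0 : det2 (c s - p) (c t - p) = 0 :=
        (mul_eq_zero.1 key).resolve_left hr.1.ne'
      rcases lt_trichotomy s t with h | h | h
      · exact absurd key0 (hinj s hs t ht h).ne'
      · exact h
      · have := hinj t ht s hs h
        rw [det2_swap, key0] at this
        simp at this
    subst hst
    have hne : c s 0 - p 0 ≠ 0 ∨ c s 1 - p 1 ≠ 0 := by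
      by_contra! h
      have := hpos s hs
      simp [det2, h.1, h.2] at this
    rcases hne with h | h
    · rw [mul_right_cancel₀ h e0]
    · rw [mul_right_cancel₀ h e1]
  have hm : MeasurableSet (Ioo a b ×ˢ Ioc (0 : ℝ) 1) := measurableSet_Ioo.prod measurableSet_Ioc
  rw [← volume_image_toPair, himg,
    ← lintegral_abs_det_fderiv_eq_addHaar_image volume hm hder hinjF,
    setLIntegral_congr_fun hm hdet, Measure.volume_eq_prod, ← Measure.prod_restrict,
    lintegral_prod_mul (f := fun s => ENNReal.ofReal (det2 (c s - p) (c' s)))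
      (g := fun r => ENNReal.ofReal r) hdc.measurable.ennreal_ofReal.aemeasurable
      ENNReal.measurable_ofReal.aemeasurable]
  have i1 : ∫⁻ s in Ioo a b, ENNReal.ofReal (det2 (c s - p) (c' s)) =
      ENNReal.ofReal (∫ s in a..b, det2 (c s - p) (c' s)) := by
    rw [intervalIntegral.integral_of_le hab, integral_Ioc_eq_integral_Ioo,
      ofReal_integral_eq_lintegral_ofReal]
    · exact (hdc.integrableOn_Icc (a := a) (b := b)).mono_set Ioo_subset_Icc_self
    · exact (ae_restrict_iff' measurableSet_Ioo).2 (Filter.Eventually.of_forall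
        fun s hs => (hpos s hs).le)
  have i2 : ∫⁻ r in Ioc (0 : ℝ) 1, ENNReal.ofReal r = ENNReal.ofReal (1 / 2) := by
    rw [← ofReal_integral_eq_lintegral_ofReal, ← intervalIntegral.integral_of_le zero_le_one]
    · norm_num
    · exact (continuous_id.integrableOn_Icc (a := (0 : ℝ)) (b := 1)).mono_set Ioc_subset_Icc_self
    · exact (ae_restrict_iff' measurableSet_Ioc).2 (Filter.Eventually.of_forall
        fun s hs => hs.1.le)
  rw [i1, i2, mul_comm, ← ENNReal.ofReal_mul (by norm_num)]

/-- The open triangle with the counterclockwise vertices `a`, `b`, `c`. -/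
def openTriangle (a b c : Plane) : Set Plane :=
  {z | 0 < det2 (b - a) (z - a) ∧ 0 < det2 (c - b) (z - b) ∧ 0 < det2 (a - c) (z - c)}

/-- The barycentric coordinates of `z` with respect to a triangle. -/
theorem barycentric (a b c z : Plane) :
    det2 (b - a) (c - a) • z = det2 (c - b) (z - b) • a + det2 (a - c) (z - c) • b +
      det2 (b - a) (z - a) • c := by
  apply plane_ext <;> simp [det2] <;> ring

theorem barycentric_sum (a b c z : Plane) :
    det2 (c - b) (z - b) + det2 (a - c) (z - c) + det2 (b - a) (z - a) =
      det2 (b - a) (c - a) := by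
  simp [det2]; ring

/-- Up to the line through `b` and `c`, the triangle is the fan from `a` over the segment from `b`
to `c`. -/
theorem volume_openTriangle {a b c : Plane} (h : 0 < det2 (b - a) (c - a)) :
    volume (openTriangle a b c) = ENNReal.ofReal (det2 (b - a) (c - a) / 2) := by
  have hcb : c - b ≠ 0 := fun h0 => by
    rw [sub_eq_zero.1 h0, det2_self] at h; exact lt_irrefl _ h
  have hd : ∀ s : ℝ, det2 (b + s • (c - b) - a) (c - b) = det2 (b - a) (c - a) := fun s => by
    simp [det2]; ring
  have hf := volume_fan (p := a) (c := fun s => b + s • (c - b)) (c' := fun _ => c - b)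
    (a := 0) (b := 1) zero_le_one
    (fun s => by simpa using ((hasDerivAt_id s).smul_const (c - b)).const_add b) continuous_const
    (fun s _ => by rw [hd]; exact h)
    (fun s _ t _ hst => by
      have : det2 (b + s • (c - b) - a) (b + t • (c - b) - a) =
          (t - s) * det2 (b - a) (c - a) := by simp [det2]; ring
      rw [this]; exact mul_pos (sub_pos.2 hst) h)
  simp only [hd, intervalIntegral.integral_const, sub_zero, one_smul] at hf
  rw [show det2 (b - a) (c - a) / 2 = 1 / 2 * det2 (b - a) (c - a) by ring, ← hf,
    ← measure_sdiff_null (s := fan a _ 0 1) (volume_line b hcb)]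
  congr 1
  ext z
  constructor
  · rintro ⟨h1, h2, h3⟩
    have hs := barycentric_sum a b c z
    have hb := barycentric a b c z
    set x := det2 (c - b) (z - b)
    set y := det2 (a - c) (z - c)
    set w := det2 (b - a) (z - a)
    set D := det2 (b - a) (c - a)
    refine ⟨⟨(w / (y + w), (y + w) / D), ⟨⟨by positivity, ?_⟩, by positivity, ?_⟩, ?_⟩, h2.ne'⟩
    · rw [div_lt_one (by positivity)]; linarith
    · rw [div_le_one h]; linarith
    · have hD : D ≠ 0 := h.ne'
      have hyw : y + w ≠ 0 := by positivity
      have : z = D⁻¹ • (x • a + y • b + w • c) := by rw [← hb, smul_smul, inv_mul_cancel₀ hD, one_smul]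
      have hx : x = D - y - w := by linarith
      rw [this, hx]
      apply plane_ext <;> simp <;> field_simp <;> ring
  · rintro ⟨⟨⟨s, r⟩, ⟨hs, hr⟩, rfl⟩, hz⟩
    simp only at hs hr hz ⊢
    have e2 : det2 (c - b) (a + r • (b + s • (c - b) - a) - b) =
        (1 - r) * det2 (b - a) (c - a) := by simp [det2]; ring
    have e1 : det2 (b - a) (a + r • (b + s • (c - b) - a) - a) =
        (r * s) * det2 (b - a) (c - a) := by simp [det2]; ring
    have e3 : det2 (a - c) (a + r • (b + s • (c - b) - a) - c) =
        (r * (1 - s)) * det2 (b - a) (c - a) := by simp [det2]; ring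
    simp only [mem_ofPred_eq, e2] at hz
    have hr1 : r < 1 := lt_of_le_of_ne hr.2 fun h0 => hz (by rw [h0]; ring)
    refine ⟨?_, ?_, ?_⟩
    · rw [e1]; exact mul_pos (mul_pos hr.1 hs.1) h
    · rw [e2]; exact mul_pos (sub_pos.2 hr1) h
    · rw [e3]; exact mul_pos (mul_pos hr.1 (sub_pos.2 hs.2)) h

/-- The part of `K` on the right of the directed line from `p` to `q`. -/
def rightPart (K : Set Plane) (p q : Plane) : Set Plane :=
  {z | z ∈ K ∧ det2 (q - p) (z - p) ≤ 0}

/-- A point of a convex set opposite to a vertex of a triangle cannot be beyond that vertex if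
the set is supported there. -/
theorem not_beyond_vertex {K : Set Plane} {a b c z u : Plane} (hb : b ∈ K) (hc : c ∈ K)
    (hz : z ∈ K) (hu : u ≠ 0) (hn : IsOuterNormal K a u)
    (hD : 0 < det2 (b - a) (c - a)) (h1 : det2 (b - a) (z - a) < 0)
    (h2 : det2 (a - c) (z - c) < 0) : False := by
  have hbar := barycentric a b c z
  have hsum := barycentric_sum a b c z
  have hb' := hn b hb
  have hc' := hn c hc
  have hz' := hn z hz
  have e := congrArg (inner ℝ u) hbar
  simp only [inner_add_right, inner_smul_right] at e
  set x := det2 (c - b) (z - b)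
  set y := det2 (a - c) (z - c)
  set w := det2 (b - a) (z - a)
  have e' : det2 (b - a) (c - a) * (inner ℝ u a - inner ℝ u z) =
      y * (inner ℝ u a - inner ℝ u b) + w * (inner ℝ u a - inner ℝ u c) := by
    linear_combination -e - inner ℝ u a * hsum
  have hB : inner ℝ u b = inner ℝ u a := by
    by_contra hne
    have : inner ℝ u b < inner ℝ u a := lt_of_le_of_ne hb' hne
    linarith [mul_pos (neg_pos.2 h2) (sub_pos.2 this), mul_nonneg (neg_pos.2 h1).le
      (sub_nonneg.2 hc'), mul_nonneg hD.le (sub_nonneg.2 hz')]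
  have hC : inner ℝ u c = inner ℝ u a := by
    by_contra hne
    have : inner ℝ u c < inner ℝ u a := lt_of_le_of_ne hc' hne
    linarith [mul_pos (neg_pos.2 h1) (sub_pos.2 this), mul_nonneg (neg_pos.2 h2).le
      (sub_nonneg.2 hb'), mul_nonneg hD.le (sub_nonneg.2 hz')]
  apply hu
  rw [inner_plane, inner_plane] at hB hC
  simp only [det2, PiLp.sub_apply] at hD
  apply plane_ext
  · have : u 0 * ((b 0 - a 0) * (c 1 - a 1) - (b 1 - a 1) * (c 0 - a 0)) = 0 := by
      linear_combination (c 1 - a 1) * hB - (b 1 - a 1) * hC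
    simpa using (mul_eq_zero.1 this).resolve_right hD.ne'
  · have : u 1 * ((b 0 - a 0) * (c 1 - a 1) - (b 1 - a 1) * (c 0 - a 0)) = 0 := by
      linear_combination (b 0 - a 0) * hC - (c 0 - a 0) * hB
    simpa using (mul_eq_zero.1 this).resolve_right hD.ne'

theorem det2_cyclic (a b c : Plane) : det2 (c - b) (a - b) = det2 (b - a) (c - a) := by
  simp [det2]; ring

theorem measurableSet_rightPart {K : Set Plane} (hK : IsClosed K) (p q : Plane) :
    MeasurableSet (rightPart K p q) :=
  (hK.inter (isClosed_le (continuous_det2 continuous_const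
    (continuous_id.sub continuous_const)) continuous_const)).measurableSet

theorem measurableSet_openTriangle (a b c : Plane) : MeasurableSet (openTriangle a b c) := by
  have h : ∀ p q : Plane, IsOpen {z : Plane | 0 < det2 (q - p) (z - p)} := fun p q =>
    isOpen_lt continuous_const
      (continuous_det2 continuous_const (continuous_id.sub continuous_const))
  exact ((h a b).inter ((h b c).inter (h c a))).measurableSet

/-- The part of `K` beyond `ac` splits into the triangle and the parts beyond `ab` and `bc`.
Supporting lines at the three vertices exclude points of `K` that lie beyond two sides at once, so
the pieces neither overlap nor stick out across `ac`. The side lines themselves are discarded as a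
null set. -/
theorem volume_rightPart_add {K : Set Plane} (hK : IsClosed K) (hconv : Convex ℝ K)
    {a b c ua ub uc : Plane} (ha : a ∈ K) (hb : b ∈ K) (hc : c ∈ K)
    (hua : ua ≠ 0) (hna : IsOuterNormal K a ua) (hub : ub ≠ 0) (hnb : IsOuterNormal K b ub)
    (huc : uc ≠ 0) (hnc : IsOuterNormal K c uc) (hD : 0 < det2 (b - a) (c - a)) :
    volume (rightPart K a c) = volume (rightPart K a b) + volume (rightPart K b c) +
      ENNReal.ofReal (det2 (b - a) (c - a) / 2) := by
  rw [← volume_openTriangle hD]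
  have hDb : 0 < det2 (c - b) (a - b) := by rwa [det2_cyclic]
  have hDc : 0 < det2 (a - c) (b - c) := by rwa [det2_cyclic, det2_cyclic]
  have hab : b - a ≠ 0 := fun h0 => by rw [h0] at hD; simp [det2] at hD
  have hcb : c - b ≠ 0 := fun h0 => by rw [h0] at hDb; simp [det2] at hDb
  have hac : a - c ≠ 0 := fun h0 => by rw [h0] at hDc; simp [det2] at hDc
  set N : Set Plane := {z | det2 (b - a) (z - a) = 0} ∪ {z | det2 (c - b) (z - b) = 0} ∪
    {z | det2 (a - c) (z - c) = 0} with hN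
  have hN0 : volume N = 0 := measure_union_null
    (measure_union_null (volume_line a hab) (volume_line b hcb)) (volume_line c hac)
  have hNm : NullMeasurableSet N volume := NullMeasurableSet.of_null hN0
  have hflip : ∀ z, det2 (c - a) (z - a) = -det2 (a - c) (z - c) := fun z => by
    simp [det2]; ring
  have hset : rightPart K a c \ N =
      ((rightPart K a b \ N) ∪ (rightPart K b c \ N)) ∪ (openTriangle a b c \ N) := by
    ext z
    simp only [rightPart, openTriangle, hN, mem_sdiff, mem_union, mem_ofPred_eq, hflip]
    have hsum := barycentric_sum a b c z
    have hbar := barycentric a b c z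
    constructor
    · rintro ⟨⟨hz, h1⟩, h2⟩
      push Not at h2
      obtain ⟨⟨n1, n2⟩, n3⟩ := h2
      have h1' : 0 < det2 (a - c) (z - c) := lt_of_le_of_ne (by linarith) (Ne.symm n3)
      rcases lt_or_gt_of_ne n1 with g1 | g1
      · exact Or.inl (Or.inl ⟨⟨hz, g1.le⟩, by push Not; exact ⟨⟨n1, n2⟩, n3⟩⟩)
      rcases lt_or_gt_of_ne n2 with g2 | g2
      · exact Or.inl (Or.inr ⟨⟨hz, g2.le⟩, by push Not; exact ⟨⟨n1, n2⟩, n3⟩⟩)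
      · exact Or.inr ⟨⟨g1, g2, h1'⟩, by push Not; exact ⟨⟨n1, n2⟩, n3⟩⟩
    · rintro ((⟨⟨hz, h1⟩, h2⟩ | ⟨⟨hz, h1⟩, h2⟩) | ⟨⟨h1, h3, h4⟩, h2⟩)
      · refine ⟨⟨hz, ?_⟩, h2⟩
        push Not at h2
        obtain ⟨⟨n1, n2⟩, n3⟩ := h2
        by_contra! g
        exact not_beyond_vertex hb hc hz hua hna hD (lt_of_le_of_ne h1 n1) (by linarith)
      · refine ⟨⟨hz, ?_⟩, h2⟩
        push Not at h2
        obtain ⟨⟨n1, n2⟩, n3⟩ := h2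
        by_contra! g
        exact not_beyond_vertex ha hb hz huc hnc hDc (by linarith) (lt_of_le_of_ne h1 n2)
      · refine ⟨⟨?_, by linarith⟩, h2⟩
        have hz : z = (det2 (c - b) (z - b) / det2 (b - a) (c - a)) • a +
            (det2 (a - c) (z - c) / det2 (b - a) (c - a)) • b +
            (det2 (b - a) (z - a) / det2 (b - a) (c - a)) • c := by
          have := congrArg (fun y => (det2 (b - a) (c - a))⁻¹ • y) hbar
          simp only [smul_add, smul_smul, inv_mul_cancel₀ hD.ne', one_smul] at this
          simpa only [div_eq_inv_mul] using this
        rw [hz]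
        have h3K := hconv.sum_mem (t := Finset.univ)
          (w := ![det2 (c - b) (z - b) / det2 (b - a) (c - a),
            det2 (a - c) (z - c) / det2 (b - a) (c - a),
            det2 (b - a) (z - a) / det2 (b - a) (c - a)]) (z := ![a, b, c])
          (by intro i _; fin_cases i <;> simp <;> positivity)
          (by rw [Fin.sum_univ_three]; simp only [Matrix.cons_val]
              rw [← add_div, ← add_div, hsum, div_self hD.ne'])
          (by intro i _; fin_cases i <;> assumption)
        rw [Fin.sum_univ_three] at h3K
        simpa using h3K
  have hd1 : Disjoint (rightPart K a b \ N) (rightPart K b c \ N) := by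
    rw [Set.disjoint_left]
    rintro z ⟨⟨hz, h1⟩, h2⟩ ⟨⟨-, h3⟩, -⟩
    simp only [hN, mem_union, mem_ofPred_eq] at h2
    push Not at h2
    obtain ⟨⟨n1, n2⟩, n3⟩ := h2
    exact not_beyond_vertex hc ha hz hub hnb hDb (lt_of_le_of_ne h3 n2) (lt_of_le_of_ne h1 n1)
  have hd2 : Disjoint ((rightPart K a b \ N) ∪ (rightPart K b c \ N))
      (openTriangle a b c \ N) := by
    rw [Set.disjoint_left]
    rintro z (⟨⟨hz, h1⟩, h2⟩ | ⟨⟨hz, h1⟩, h2⟩) ⟨⟨h3, h4, h5⟩, -⟩ <;> linarith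
  have hm1 := (measurableSet_rightPart hK b c).nullMeasurableSet.diff hNm
  have hm2 := (measurableSet_openTriangle a b c).nullMeasurableSet.diff hNm
  have := congrArg volume hset
  rwa [measure_union₀ hm2 hd2.aedisjoint, measure_union₀ hm1 hd1.aedisjoint,
    measure_sdiff_null hN0, measure_sdiff_null hN0, measure_sdiff_null hN0,
    measure_sdiff_null hN0] at this

/-! ### Caps and spindles -/

theorem sin_smul_dir (a b θ : ℝ) :
    Real.sin (b - a) • dir θ = Real.sin (b - θ) • dir a + Real.sin (θ - a) • dir b := by
  apply plane_ext <;> simp [Real.sin_sub] <;> ring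

theorem sin_smul_eq_tang (a b : ℝ) (x : Plane) :
    Real.sin (b - a) • x = (-inner ℝ (dir a) x) • tang b + inner ℝ (dir b) x • tang a := by
  apply plane_ext <;> simp [Real.sin_sub, inner_plane] <;> ring

theorem det2_mul_sin (a b : ℝ) (v w : Plane) :
    det2 v w * Real.sin (b - a) =
      inner ℝ (dir a) v * inner ℝ (dir b) w - inner ℝ (dir a) w * inner ℝ (dir b) v := by
  simp [det2, Real.sin_sub, inner_plane]; ring

/-- By `sin_smul_eq_tang`, `b - a` is a positive combination of `tang α` and `tang β`, and `c - b`
one of `tang β` and `tang δ`. These tangents are in counterclockwise order within less than a half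
turn. -/
theorem det2_pos_of_normals {α β δ : ℝ} (h1 : α < β) (h2 : β < δ) (h3 : δ < α + Real.pi)
    {a b c : Plane} (hab : inner ℝ (dir α) (b - a) < 0) (hba : 0 < inner ℝ (dir β) (b - a))
    (hbc : inner ℝ (dir β) (c - b) < 0) (hcb : 0 < inner ℝ (dir δ) (c - b)) :
    0 < det2 (b - a) (c - a) := by
  have e : det2 (b - a) (c - a) = det2 (b - a) (c - b) := by simp [det2]; ring
  have s1 : 0 < Real.sin (β - α) := Real.sin_pos_of_pos_of_lt_pi (by linarith) (by linarith)
  have s2 : 0 < Real.sin (δ - β) := Real.sin_pos_of_pos_of_lt_pi (by linarith) (by linarith)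
  have s3 : 0 < Real.sin (δ - α) := Real.sin_pos_of_pos_of_lt_pi (by linarith) (by linarith)
  have k : Real.sin (β - α) * (Real.sin (δ - β) * det2 (b - a) (c - b)) =
      (-inner ℝ (dir α) (b - a)) * (-inner ℝ (dir β) (c - b)) * Real.sin (δ - β) +
      inner ℝ (dir β) (b - a) * (-inner ℝ (dir β) (c - b)) * Real.sin (δ - α) +
      inner ℝ (dir β) (b - a) * inner ℝ (dir δ) (c - b) * Real.sin (β - α) := by
    rw [← det2_smul_right, ← det2_smul_left, sin_smul_eq_tang α β (b - a),
      sin_smul_eq_tang β δ (c - b)]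
    have ht : ∀ s t, det2 (tang s) (tang t) = Real.sin (t - s) := fun s t => by
      rw [det2_tang_left, inner_dir_tang, ← Real.sin_neg, neg_sub]
    simp only [det2_add_left, det2_add_right, det2_smul_left, det2_smul_right, ht, sub_self,
      Real.sin_zero]
    ring
  rw [e]
  have : 0 < Real.sin (β - α) * (Real.sin (δ - β) * det2 (b - a) (c - b)) := by
    rw [k]
    have n1 := neg_pos.2 hab
    have n2 := neg_pos.2 hbc
    positivity
  exact pos_of_mul_pos_right (pos_of_mul_pos_right this s1.le) s2.le

/-- The arithmetic behind `cap_add_mem`. `A` and `B` are the coordinates of a normal in the basis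
`dir a`, `dir b`, up to a positive factor. A point of the triangle between the chord and the
tangents at its ends can exceed both ends in the direction of that normal only if `A` and `B` are
nonnegative; but then a translation with nonpositive components `da`, `db` cannot move outward. -/
theorem cap_arith {A B da db X Y N P : ℝ} (hda : da ≤ 0) (hdb : db ≤ 0) (hX0 : X ≤ 0)
    (hY' : Y - P ≤ 0) (hN0 : 0 < N) (hP0 : 0 < P) (g0 : 0 < A * da + B * db)
    (g1 : 0 < A * X + B * Y) (g2 : 0 < A * (X + N) + B * (Y - P)) (g3 : 0 ≤ N * Y + X * P) :
    False := by
  rcases le_or_gt 0 A with hA | hA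
  · rcases le_or_gt 0 B with hB | hB
    · nlinarith [mul_nonneg hA (neg_nonneg.2 hda), mul_nonneg hB (neg_nonneg.2 hdb)]
    · have hY0 : Y < 0 := by
        by_contra! hc
        nlinarith [mul_nonneg hA (neg_nonneg.2 hX0), mul_nonneg (neg_pos.2 hB).le hc]
      nlinarith [mul_pos hN0 (neg_pos.2 hY0), mul_nonneg (neg_nonneg.2 hX0) hP0.le]
  · rcases le_or_gt 0 B with hB | hB
    · have hX1 : X + N < 0 := by
        by_contra! hc
        nlinarith [mul_nonneg hB (neg_nonneg.2 hY'), mul_nonneg (neg_pos.2 hA).le hc]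
      nlinarith [mul_pos hP0 (neg_pos.2 hX1), mul_nonneg (neg_nonneg.2 hY') hN0.le]
    · have hY0 : 0 ≤ Y := by
        by_contra! hc
        nlinarith [mul_pos hN0 (neg_pos.2 hc), mul_nonneg (neg_nonneg.2 hX0) hP0.le]
      have hX1 : 0 ≤ X + N := by
        by_contra! hc
        nlinarith [mul_pos hP0 (neg_pos.2 hc), mul_nonneg (neg_nonneg.2 hY') hN0.le]
      have hX2 : X < 0 := by
        by_contra! hc
        nlinarith [mul_nonneg (neg_pos.2 hA).le hc, mul_nonneg (neg_pos.2 hB).le hY0]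
      have hY2 : Y - P < 0 := by
        by_contra! hc
        nlinarith [mul_nonneg (neg_pos.2 hB).le hc, mul_nonneg (neg_pos.2 hA).le hX1]
      have k1 : B * P * X < A * N * X := by
        nlinarith [mul_pos hN0 g1, mul_nonneg (neg_pos.2 hB).le g3]
      have k2 : A * N * (Y - P) < B * P * (Y - P) := by
        nlinarith [mul_pos hP0 g2, mul_nonneg (neg_pos.2 hA).le g3]
      nlinarith

/-- The area that the chord from `γ a` to `γ b` cuts off. -/
noncomputable def capArea (γ : ℝ → Plane) (ρ : ℝ → ℝ) (a b : ℝ) : ℝ :=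
  1 / 2 * ∫ s in a..b, det2 (γ s - γ a) (ρ s • tang s)

namespace SupportCurve

variable {γ : ℝ → Plane} {ρ : ℝ → ℝ}

theorem inner_chord_left_neg (h : SupportCurve γ ρ) {a b : ℝ} (hab : a < b)
    (hb : b < a + Real.pi) : inner ℝ (dir a) (γ b - γ a) < 0 := by
  rw [inner_sub_right, sub_neg]
  exact h.inner_lt (by linarith [Real.pi_pos]) hb.le hab.ne'

theorem inner_chord_right_pos (h : SupportCurve γ ρ) {a b : ℝ} (hab : a < b)
    (hb : b < a + Real.pi) : 0 < inner ℝ (dir b) (γ b - γ a) := by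
  rw [inner_sub_right, sub_pos]
  exact h.inner_lt (by linarith) (by linarith [Real.pi_pos]) hab.ne

theorem det2_chord_pos (h : SupportCurve γ ρ) {a s t : ℝ} (h1 : a < s) (h2 : s < t)
    (h3 : t < a + Real.pi) : 0 < det2 (γ s - γ a) (γ t - γ a) :=
  det2_pos_of_normals h1 h2 h3 (h.inner_chord_left_neg h1 (by linarith))
    (h.inner_chord_right_pos h1 (by linarith)) (h.inner_chord_left_neg h2 (by linarith))
    (h.inner_chord_right_pos h2 (by linarith))

theorem convex_region (h : SupportCurve γ ρ) : Convex ℝ (region γ) := h.isConvexDisk_region.2.1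

/-- The determinant `g` vanishes at `a`, is positive just after `a` since `z` lies strictly inside
the supporting line at `γ a`, and is negative at `b`. At a zero in between, the ray from `γ a`
through `z` hits the curve, and the supporting line at the hit shows that `z` is not beyond it. -/
theorem exists_mem_fan (h : SupportCurve γ ρ) {a b : ℝ} (hab : a < b) (hb : b < a + Real.pi)
    {z : Plane} (hz : z ∈ region γ) (hd : det2 (γ b - γ a) (z - γ a) < 0) :
    z ∈ fan (γ a) γ a b := by
  have hza : z ≠ γ a := fun e => by rw [e, sub_self] at hd; simp [det2] at hd
  have hneg : inner ℝ (dir a) (z - γ a) < 0 := by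
    rw [inner_sub_right, sub_neg]
    exact lt_of_le_of_ne (hz a) fun e => hza (h.eq_of_inner_eq hz e)
  set g : ℝ → ℝ := fun s => det2 (γ s - γ a) (z - γ a) with hg
  have hgd : ∀ s, HasDerivAt g (ρ s * -inner ℝ (dir s) (z - γ a)) s := fun s => by
    refine (hasDerivAt_det2 ((h.hasDerivAt s).sub_const (γ a))
      (hasDerivAt_const s (z - γ a))).congr_deriv ?_
    rw [det2_smul_left, det2_tang_left]; simp [det2]
  have hgc : Continuous g := continuous_iff_continuousAt.2 fun s => (hgd s).continuousAt
  have hga : g a = 0 := by simp [hg, det2]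
  obtain ⟨s₀, hs₀, hgs₀⟩ : ∃ s ∈ Ioo a b, 0 < g s := by
    have hpos : 0 < ρ a * -inner ℝ (dir a) (z - γ a) := mul_pos (h.pos a) (neg_pos.2 hneg)
    have h1 := (hasDerivAt_iff_tendsto_slope.1 (hgd a)).eventually (lt_mem_nhds hpos)
    have h2 : ∀ᶠ s in 𝓝[>] a, 0 < slope g a s :=
      h1.filter_mono (nhdsWithin_mono a fun s hs => ne_of_gt hs)
    obtain ⟨s, hs1, hs2⟩ := (h2.and (Ioo_mem_nhdsGT hab)).exists
    refine ⟨s, hs2, ?_⟩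
    rw [slope_def_field, hga, sub_zero] at hs1
    exact (div_pos_iff_of_pos_right (sub_pos.2 hs2.1)).1 hs1
  obtain ⟨s, hs, hgs⟩ := intermediate_value_Ioo' hs₀.2.le hgc.continuousOn
    (show (0 : ℝ) ∈ Ioo (g b) (g s₀) from ⟨hd, hgs₀⟩)
  have hsab : s ∈ Ioo a b := ⟨hs₀.1.trans hs.1, hs.2⟩
  have hv : det2 (γ b - γ a) (γ s - γ a) < 0 := by
    have := h.det2_chord_pos hsab.1 hsab.2 hb
    rw [det2_swap] at this; linarith
  set r := det2 (γ b - γ a) (z - γ a) / det2 (γ b - γ a) (γ s - γ a) with hr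
  have hr0 : 0 < r := div_pos_of_neg_of_neg hd hv
  have hzr : z - γ a = r • (γ s - γ a) := by
    have hgs' : det2 (γ s - γ a) (z - γ a) = 0 := hgs
    have hv' := hv.ne
    simp only [det2, PiLp.sub_apply] at hgs' hv' hr
    apply plane_ext
    · simp only [PiLp.smul_apply, PiLp.sub_apply, smul_eq_mul]
      rw [hr, div_mul_eq_mul_div, eq_div_iff hv']
      linear_combination (-(γ b 0 - γ a 0)) * hgs'
    · simp only [PiLp.smul_apply, PiLp.sub_apply, smul_eq_mul]
      rw [hr, div_mul_eq_mul_div, eq_div_iff hv']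
      linear_combination (-(γ b 1 - γ a 1)) * hgs'
  have hr1 : r ≤ 1 := by
    have h1 := hz s
    have h2 := h.inner_chord_right_pos hsab.1 (by linarith [hsab.2])
    have h3 : inner ℝ (dir s) z = inner ℝ (dir s) (γ a) + r * inner ℝ (dir s) (γ s - γ a) := by
      rw [← inner_smul_right, ← hzr, inner_sub_right]; ring
    rw [inner_sub_right] at h2 h3
    nlinarith
  exact ⟨(s, r), ⟨hsab, hr0, hr1⟩, by simp only; rw [← hzr]; abel⟩

theorem volume_cap (h : SupportCurve γ ρ) {a b : ℝ} (hab : a < b) (hb : b < a + Real.pi) :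
    volume (rightPart (region γ) (γ a) (γ b)) = ENNReal.ofReal (capArea γ ρ a b) := by
  have hne : γ b - γ a ≠ 0 := fun e => by
    have := h.inner_chord_right_pos hab hb
    rw [e] at this; simp at this
  rw [capArea, ← volume_fan hab.le h.hasDerivAt (h.cont.smul continuous_tang)]
  · rw [← measure_sdiff_null (volume_line (γ a) hne),
      ← measure_sdiff_null (s := fan (γ a) γ a b) (volume_line (γ a) hne)]
    congr 1
    ext z
    constructor
    · rintro ⟨⟨hz, h1⟩, h2⟩
      exact ⟨h.exists_mem_fan hab hb hz (lt_of_le_of_ne h1 h2), h2⟩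
    · rintro ⟨⟨⟨s, r⟩, ⟨hs, hr⟩, rfl⟩, h2⟩
      simp only at hs hr h2 ⊢
      refine ⟨⟨?_, ?_⟩, h2⟩
      · exact h.convex_region.add_smul_sub_mem (h.mem_region a) (h.mem_region s) ⟨hr.1.le, hr.2⟩
      · rw [add_sub_cancel_left, det2_smul_right, det2_swap]
        have := h.det2_chord_pos hs.1 hs.2 hb
        nlinarith [mul_pos hr.1 this]
  · intro s hs
    rw [det2_smul_right, det2_tang_right]
    exact mul_pos (h.pos s) (h.inner_chord_right_pos hs.1 (by linarith [hs.2]))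
  · intro s hs t ht hst
    exact h.det2_chord_pos hs.1 hst (by linarith [ht.2])

/-- The cap cut off by a chord lies in every translate of the region that contains both ends of
the chord. -/
theorem cap_add_mem (h : SupportCurve γ ρ) {a b : ℝ} (hab : a < b) (hb : b < a + Real.pi)
    {z d : Plane} (hz : z ∈ region γ) (hdet : det2 (γ b - γ a) (z - γ a) ≤ 0)
    (ha' : γ a + d ∈ region γ) (hb' : γ b + d ∈ region γ) : z + d ∈ region γ := by
  intro θ
  by_contra! hlt
  have hS : 0 < Real.sin (b - a) := Real.sin_pos_of_pos_of_lt_pi (by linarith) (by linarith)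
  have hN := h.inner_chord_left_neg hab hb
  have hP := h.inner_chord_right_pos hab hb
  have key : ∀ y, Real.sin (b - a) * inner ℝ (dir θ) y =
      Real.sin (b - θ) * inner ℝ (dir a) y + Real.sin (θ - a) * inner ℝ (dir b) y := fun y => by
    have := congrArg (fun x => inner ℝ x y) (sin_smul_dir a b θ)
    simpa [inner_add_left, inner_smul_left] using this
  have hdet' := det2_mul_sin a b (γ b - γ a) (z - γ a)
  have e1 := key d
  have e2 := key (z - γ a)
  have e3 := key (z - γ b)
  have f1 := ha' θ
  have f2 := hb' θ
  have f3 := hz θ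
  have f4 := ha' a
  have f5 := hb' b
  have f6 := hz a
  have f7 := hz b
  simp only [inner_add_right, inner_sub_right] at *
  set A := Real.sin (b - θ)
  set B := Real.sin (θ - a)
  set S := Real.sin (b - a)
  set za := inner ℝ (dir a) z
  set zb := inner ℝ (dir b) z
  set aa := inner ℝ (dir a) (γ a)
  set ab := inner ℝ (dir b) (γ a)
  set ba := inner ℝ (dir a) (γ b)
  set bb := inner ℝ (dir b) (γ b)
  set da := inner ℝ (dir a) d
  set db := inner ℝ (dir b) d
  -- The constraint with normal `dir θ` holds for `z` and for both translated ends but fails for `z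
  -- + d`. Hence `d`, `z - γ a` and `z - γ b` all have positive component along `dir θ`.
  have g0 : 0 < A * da + B * db := by rw [← e1]; exact mul_pos hS (by linarith)
  have g1 : 0 < A * (za - aa) + B * (zb - ab) := by rw [← e2]; exact mul_pos hS (by linarith)
  have g2 : 0 < A * (za - ba) + B * (zb - bb) := by rw [← e3]; exact mul_pos hS (by linarith)
  have g3 : 0 ≤ (aa - ba) * (zb - ab) + (za - aa) * (bb - ab) := by
    have : det2 (γ b - γ a) (z - γ a) * S ≤ 0 := mul_nonpos_of_nonpos_of_nonneg hdet hS.le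
    linarith
  have hda : da ≤ 0 := by linarith
  have hdb : db ≤ 0 := by linarith
  obtain ⟨X, hX⟩ : ∃ X, X = za - aa := ⟨_, rfl⟩
  obtain ⟨Y, hY⟩ : ∃ Y, Y = zb - ab := ⟨_, rfl⟩
  obtain ⟨N, hNe⟩ : ∃ N, N = aa - ba := ⟨_, rfl⟩
  obtain ⟨P, hPe⟩ : ∃ P, P = bb - ab := ⟨_, rfl⟩
  have hX0 : X ≤ 0 := by linarith
  have hY' : Y - P ≤ 0 := by linarith
  have hN0 : 0 < N := by linarith
  have hP0 : 0 < P := by linarith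
  rw [← hX, ← hY] at g1
  rw [show za - ba = X + N by linarith, show zb - bb = Y - P by linarith] at g2
  rw [← hX, ← hY, ← hNe, ← hPe] at g3
  exact cap_arith hda hdb hX0 hY' hN0 hP0 g0 g1 g2 g3

/-- The translate of `C` that carries `γ a` to `p` and `γ b` to `q` contains the spindle, which
gives one inclusion. For the other, the cap of that translate lies in every translate containing `p`
and `q` by `cap_add_mem`, hence in the spindle, and so in `K`. -/
theorem rightPart_inter_spindle (h : SupportCurve γ ρ) {K : Set Plane}
    (hK : IsSpindleConvexDisk (region γ) K) {p q : Plane} (hp : p ∈ K) (hq : q ∈ K) {a b : ℝ}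
    (hab : a < b) (hb : b < a + Real.pi) (hpq : q - p = γ b - γ a) :
    rightPart K p q ∩ spindle (region γ) p q =
      (fun z => z - (p - γ a)) ⁻¹' rightPart (region γ) (γ a) (γ b) := by
  have hsub : ∀ z, z - (p - γ a) - γ a = z - p := fun z => by abel
  ext z
  constructor
  · rintro ⟨⟨-, h1⟩, h2⟩
    refine ⟨h2 (p - γ a) ?_ ?_, ?_⟩
    · rw [sub_sub_cancel]; exact h.mem_region a
    · rw [show q - (p - γ a) = γ b by rw [sub_sub_eq_add_sub, add_comm, add_sub_assoc, hpq]; abel]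
      exact h.mem_region b
    · rwa [hsub, ← hpq]
  · rintro ⟨h1, h2⟩
    rw [hsub, ← hpq] at h2
    have hs : z ∈ spindle (region γ) p q := by
      intro w hw1 hw2
      have := h.cap_add_mem hab hb (z := z - (p - γ a)) (d := p - γ a - w) h1
        (by rwa [hsub, ← hpq]) (by convert hw1 using 1; abel)
        (by convert hw2 using 1; rw [eq_sub_iff_add_eq] at hpq; rw [← hpq]; abel_nf)
      convert this using 1; abel
    exact ⟨⟨hK.2 p hp q hq hs, h2⟩, hs⟩

theorem volume_arcRegion_add (h : SupportCurve γ ρ) {K : Set Plane}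
    (hK : IsSpindleConvexDisk (region γ) K) {p q : Plane} (hp : p ∈ K) (hq : q ∈ K) {a b : ℝ}
    (hab : a < b) (hb : b < a + Real.pi) (hpq : q - p = γ b - γ a) :
    volume (arcRegion (region γ) K p q) + ENNReal.ofReal (capArea γ ρ a b) =
      volume (rightPart K p q) := by
  have hE := h.rightPart_inter_spindle hK hp hq hab hb hpq
  have hm : MeasurableSet (rightPart K p q ∩ spindle (region γ) p q) := by
    rw [hE]
    exact (measurable_id.sub_const _) (measurableSet_rightPart (isClosed_region γ) _ _)
  have hv : volume (rightPart K p q ∩ spindle (region γ) p q) =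
      ENNReal.ofReal (capArea γ ρ a b) := by
    rw [hE, ← h.volume_cap hab hb]
    simp only [sub_eq_add_neg]
    exact measure_preimage_add_right volume _ _
  have hA : arcRegion (region γ) K p q =
      rightPart K p q \ (rightPart K p q ∩ spindle (region γ) p q) := by
    rw [sdiff_self_inter]; rfl
  rw [← hv, hA, add_comm]
  have := measure_inter_add_sdiff (μ := volume) (rightPart K p q) hm
  rwa [inter_eq_self_of_subset_right inter_subset_left] at this

end SupportCurve

/-! ### A configuration that violates the Quadrangle Property -/

theorem IsOuterNormal.mem_frontier {K : Set Plane} {x u : Plane} (hu : u ≠ 0) (hx : x ∈ K)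
    (hn : IsOuterNormal K x u) : x ∈ frontier K := by
  refine ⟨subset_closure hx, fun hi => ?_⟩
  have h1 : ∀ᶠ t : ℝ in 𝓝 0, x + t • u ∈ K := by
    have hc : Filter.Tendsto (fun t : ℝ => x + t • u) (𝓝 0) (𝓝 x) := by
      have : Continuous fun t : ℝ => x + t • u := by fun_prop
      simpa using this.tendsto 0
    exact hc.eventually (mem_interior_iff_mem_nhds.1 hi)
  obtain ⟨t, ht, ht0⟩ := ((h1.filter_mono nhdsWithin_le_nhds).and
    (self_mem_nhdsWithin (s := Ioi (0 : ℝ)))).exists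
  have := hn _ ht
  rw [inner_add_right, inner_smul_right] at this
  have hp : 0 < inner ℝ u u := real_inner_self_pos.2 hu
  nlinarith [mul_pos (show (0 : ℝ) < t from ht0) hp]

theorem exists_angle_of_det2_pos {θ₁ : ℝ} {z : Plane} (h : 0 < det2 (dir θ₁) z) :
    ∃ θ, θ₁ < θ ∧ θ < θ₁ + Real.pi ∧ 0 < ‖z‖ ∧ z = ‖z‖ • dir θ := by
  have hz : 0 < ‖z‖ := norm_pos_iff.2 fun e => by rw [e] at h; simp [det2] at h
  obtain ⟨φ, e⟩ := exists_eq_smul_dir z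
  obtain ⟨θ, hθ, e2⟩ := dir_periodic.exists_mem_Ico Real.two_pi_pos φ θ₁
  rw [e, e2, det2_smul_right] at h
  have hs : 0 < Real.sin (θ - θ₁) := by
    have : det2 (dir θ₁) (dir θ) = Real.sin (θ - θ₁) := by
      simp [det2, Real.sin_sub]; ring
    rw [← this]
    exact pos_of_mul_pos_right h hz.le
  refine ⟨θ, ?_, ?_, hz, by rw [← e2, ← e]⟩
  · refine lt_of_le_of_ne hθ.1 fun h0 => ?_
    rw [h0, sub_self, Real.sin_zero] at hs; exact lt_irrefl _ hs
  · by_contra! hge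
    have := Real.sin_nonpos_of_nonpos_of_neg_pi_le (x := θ - θ₁ - 2 * Real.pi)
      (by linarith [hθ.2]) (by linarith)
    rw [Real.sin_sub_two_pi] at this
    linarith

theorem det2_dir_dir (a b : ℝ) : det2 (dir a) (dir b) = Real.sin (b - a) := by
  simp [det2, Real.sin_sub]; ring

/-- Angular order, as seen from the midpoint of the longest side, of the vertices of a
quadrangle. -/
theorem exists_angles_of_quadrangle {x₁ x₂ x₃ x₄ : Plane}
    (h123 : 0 < det2 (x₂ - x₁) (x₃ - x₁)) (h124 : 0 < det2 (x₂ - x₁) (x₄ - x₁))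
    (h134 : 0 < det2 (x₃ - x₁) (x₄ - x₁)) (h234 : 0 < det2 (x₃ - x₂) (x₄ - x₂)) :
    ∃ (c : Plane) (θ₁ θ₂ θ₃ r₁ r₂ r₃ : ℝ), c = (1 / 2 : ℝ) • x₁ + (1 / 2 : ℝ) • x₄ ∧
      θ₁ < θ₂ ∧ θ₂ < θ₃ ∧ θ₃ < θ₁ + Real.pi ∧ 0 < r₁ ∧ 0 < r₂ ∧ 0 < r₃ ∧
      x₁ = c + r₁ • dir θ₁ ∧ x₂ = c + r₂ • dir θ₂ ∧ x₃ = c + r₃ • dir θ₃ ∧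
      x₄ = c + r₁ • dir (θ₁ + Real.pi) := by
  obtain ⟨c, hc⟩ : ∃ c, c = (1 / 2 : ℝ) • x₁ + (1 / 2 : ℝ) • x₄ := ⟨_, rfl⟩
  obtain ⟨θ₁, e1⟩ := exists_eq_smul_dir (x₁ - c)
  have k2 : det2 (x₁ - c) (x₂ - c) = 1 / 2 * det2 (x₂ - x₁) (x₄ - x₁) := by
    rw [hc]; simp [det2]; ring
  have k3 : det2 (x₁ - c) (x₃ - c) = 1 / 2 * det2 (x₃ - x₁) (x₄ - x₁) := by
    rw [hc]; simp [det2]; ring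
  have k23 : det2 (x₂ - c) (x₃ - c) =
      1 / 2 * (det2 (x₂ - x₁) (x₃ - x₁) + det2 (x₃ - x₂) (x₄ - x₂)) := by
    rw [hc]; simp [det2]; ring
  have hr1 : 0 < ‖x₁ - c‖ := norm_pos_iff.2 fun e => by
    rw [e] at k2; simp [det2] at k2 h124; linarith
  have p2 : 0 < det2 (dir θ₁) (x₂ - c) := by
    rw [e1, det2_smul_left] at k2
    exact pos_of_mul_pos_right (by rw [k2]; linarith) hr1.le
  have p3 : 0 < det2 (dir θ₁) (x₃ - c) := by
    rw [e1, det2_smul_left] at k3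
    exact pos_of_mul_pos_right (by rw [k3]; linarith) hr1.le
  obtain ⟨θ₂, a1, a2, a3, e2⟩ := exists_angle_of_det2_pos p2
  obtain ⟨θ₃, b1, b2, b3, e3⟩ := exists_angle_of_det2_pos p3
  refine ⟨c, θ₁, θ₂, θ₃, ‖x₁ - c‖, ‖x₂ - c‖, ‖x₃ - c‖, hc, a1, ?_, b2, hr1, a3, b3, ?_, ?_, ?_, ?_⟩
  · by_contra! hle
    have hs := Real.sin_nonpos_of_nonpos_of_neg_pi_le (x := θ₃ - θ₂) (by linarith) (by linarith)
    rw [e2, e3, det2_smul_left, det2_smul_right, det2_dir_dir] at k23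
    have := mul_nonpos_of_nonneg_of_nonpos (mul_pos a3 b3).le hs
    nlinarith
  · rw [← e1]; abel
  · rw [← e2]; abel
  · rw [← e3]; abel
  · rw [dir_add_pi, smul_neg, ← e1, hc]
    apply plane_ext <;> simp <;> ring

/-! ### Lenses as test bodies -/

/-- The intersection of two translates of `C`. -/
def lens (C : Set Plane) (v w : Plane) : Set Plane := {z | z - v ∈ C ∧ z - w ∈ C}

theorem lens_comm (C : Set Plane) (v w : Plane) : lens C v w = lens C w v := by
  ext z; exact and_comm

namespace SupportCurve

variable {γ : ℝ → Plane} {ρ : ℝ → ℝ}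

theorem inner_lt_of_mem_interior {z : Plane} (hz : z ∈ interior (region γ)) (θ : ℝ) :
    inner ℝ (dir θ) z < inner ℝ (dir θ) (γ θ) := by
  refine lt_of_le_of_ne (interior_subset hz θ) fun e => ?_
  have hn : IsOuterNormal (region γ) z (dir θ) := fun y hy => by rw [e]; exact hy θ
  exact (hn.mem_frontier (norm_ne_zero_iff.1 (by rw [norm_dir]; exact one_ne_zero))
    (interior_subset hz)).2 hz

theorem isClosed_lens (γ : ℝ → Plane) (v w : Plane) : IsClosed (lens (region γ) v w) :=
  ((isClosed_region γ).preimage (continuous_id.sub continuous_const)).inter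
    ((isClosed_region γ).preimage (continuous_id.sub continuous_const))

theorem convex_lens (h : SupportCurve γ ρ) (v w : Plane) : Convex ℝ (lens (region γ) v w) := by
  have hc : ∀ v : Plane, Convex ℝ {z : Plane | z - v ∈ region γ} := fun v => by
    simpa only [sub_eq_add_neg, preimage] using h.convex_region.translate_preimage_left (-v)
  exact (hc v).inter (hc w)

theorem mem_interior_lens {v w z : Plane} (h1 : z - v ∈ interior (region γ))
    (h2 : z - w ∈ interior (region γ)) : z ∈ interior (lens (region γ) v w) := by
  refine mem_interior.2 ⟨{z | z - v ∈ interior (region γ)} ∩ {z | z - w ∈ interior (region γ)},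
    fun y hy => ⟨interior_subset hy.1, interior_subset hy.2⟩, ?_, h1, h2⟩
  exact (isOpen_interior.preimage (continuous_id.sub continuous_const)).inter
    (isOpen_interior.preimage (continuous_id.sub continuous_const))

theorem isOuterNormal_lens (v w : Plane) (θ : ℝ) :
    IsOuterNormal (lens (region γ) v w) (v + γ θ) (dir θ) := by
  intro z hz
  have := hz.1 θ
  rw [inner_sub_right] at this
  rw [inner_add_right]; linarith

theorem isSpindleConvexDisk_lens (h : SupportCurve γ ρ) {v w : Plane}
    (hne : (interior (lens (region γ) v w)).Nonempty) :
    IsSpindleConvexDisk (region γ) (lens (region γ) v w) := by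
  refine ⟨⟨?_, h.convex_lens v w, hne⟩, fun p hp q hq z hz =>
    ⟨hz v hp.1 hq.1, hz w hp.2 hq.2⟩⟩
  have hc : IsCompact ((fun z => z + v) '' region γ) :=
    h.isConvexDisk_region.1.image (continuous_id.add continuous_const)
  refine hc.of_isClosed_subset (isClosed_lens γ v w) fun z hz => ⟨z - v, hz.1, by simp⟩

/-- Where the lens is locally bounded by one translate only, its normals are those of that
translate. -/
theorem normal_unique_lens (h : SupportCurve γ ρ) {v w u : Plane} {θ : ℝ}
    (hi : v + γ θ - w ∈ interior (region γ))
    (hu : IsOuterNormal (lens (region γ) v w) (v + γ θ) u) : u = ‖u‖ • dir θ := by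
  refine h.normal_unique fun z hz => ?_
  have hev : ∀ᶠ t : ℝ in 𝓝 0, v + γ θ - w + t • (z - γ θ) ∈ region γ := by
    have hc : Filter.Tendsto (fun t : ℝ => v + γ θ - w + t • (z - γ θ)) (𝓝 0)
        (𝓝 (v + γ θ - w)) := by
      have : Continuous fun t : ℝ => v + γ θ - w + t • (z - γ θ) := by fun_prop
      simpa using this.tendsto 0
    exact hc.eventually (mem_interior_iff_mem_nhds.1 hi)
  obtain ⟨t, ht, ht0⟩ := ((hev.filter_mono nhdsWithin_le_nhds).and
    (Ioo_mem_nhdsGT (zero_lt_one (α := ℝ)))).exists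
  have hmem : v + γ θ + t • (z - γ θ) ∈ lens (region γ) v w := by
    constructor
    · rw [show v + γ θ + t • (z - γ θ) - v = γ θ + t • (z - γ θ) by abel]
      exact h.convex_region.add_smul_sub_mem (h.mem_region θ) hz ⟨ht0.1.le, ht0.2.le⟩
    · rw [show v + γ θ + t • (z - γ θ) - w = v + γ θ - w + t • (z - γ θ) by abel]
      exact ht
  have h1 := hu _ hmem
  rw [inner_add_right (x := u) (y := v + γ θ), inner_smul_right, inner_sub_right] at h1
  nlinarith [ht0.1]

/-- The only normal direction at the first point is `dir φ₁`, so an antipodal `y` would minimize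
`⟪dir φ₁, ·⟫` on the lens. Since `y` lies on the right of the chord, this functional is not larger
at `w + γ φ₄` than at `y`. Hence `-dir φ₁` would be normal there too, although the unique unit
normal at that point is `dir φ₄` and `φ₄ - φ₁ < π`. -/
theorem not_isAntipodal_lens (h : SupportCurve γ ρ) {v w : Plane} {φ₁ φ₄ : ℝ}
    (h14 : φ₁ < φ₄) (h41 : φ₄ < φ₁ + Real.pi)
    (hi₁ : v + γ φ₁ - w ∈ interior (region γ)) (hi₄ : w + γ φ₄ - v ∈ interior (region γ))
    {y : Plane} (hy : y ∈ lens (region γ) v w)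
    (hdet : det2 (w + γ φ₄ - (v + γ φ₁)) (y - (w + γ φ₄)) ≤ 0) :
    ¬ IsAntipodal (lens (region γ) v w) (v + γ φ₁) y := by
  rintro ⟨u, hu0, hu1, hu2⟩
  have hu := h.normal_unique_lens hi₁ hu1
  have hpos : 0 < ‖u‖ := norm_pos_iff.2 hu0
  have hS : 0 < Real.sin (φ₄ - φ₁) := Real.sin_pos_of_pos_of_lt_pi (by linarith) (by linarith)
  have a1 : inner ℝ (dir φ₁) (w + γ φ₄ - (v + γ φ₁)) < 0 := by
    have := inner_lt_of_mem_interior hi₄ φ₁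
    simp only [inner_sub_right, inner_add_right] at this ⊢
    linarith
  have a2 : 0 < inner ℝ (dir φ₄) (w + γ φ₄ - (v + γ φ₁)) := by
    have := inner_lt_of_mem_interior hi₁ φ₄
    simp only [inner_sub_right, inner_add_right] at this ⊢
    linarith
  have a3 : inner ℝ (dir φ₄) (y - (w + γ φ₄)) ≤ 0 := by
    have := hy.2 φ₄
    simp only [inner_sub_right, inner_add_right] at this ⊢
    linarith
  have hd := det2_mul_sin φ₁ φ₄ (w + γ φ₄ - (v + γ φ₁)) (y - (w + γ φ₄))
  have a4 : 0 ≤ inner ℝ (dir φ₁) (y - (w + γ φ₄)) := by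
    by_contra! hc
    have : det2 (w + γ φ₄ - (v + γ φ₁)) (y - (w + γ φ₄)) * Real.sin (φ₄ - φ₁) ≤ 0 :=
      mul_nonpos_of_nonpos_of_nonneg hdet hS.le
    nlinarith [mul_nonneg (neg_pos.2 a1).le (neg_nonneg.2 a3), mul_pos (neg_pos.2 hc) a2]
  have hn : IsOuterNormal (lens (region γ) w v) (w + γ φ₄) (-dir φ₁) := by
    intro z hz
    rw [lens_comm] at hz
    have := hu2 z hz
    rw [hu, inner_neg_left, inner_neg_left, inner_smul_left, inner_smul_left] at this
    simp only [conj_trivial] at this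
    have h2 : inner ℝ (dir φ₁) y ≤ inner ℝ (dir φ₁) z :=
      le_of_mul_le_mul_left (by linarith) hpos
    rw [inner_sub_right] at a4
    rw [inner_neg_left, inner_neg_left]
    linarith
  have h5 := h.normal_unique_lens hi₄ hn
  rw [norm_neg, norm_dir, one_smul] at h5
  have h6 := congrArg (inner ℝ (dir φ₁)) h5
  rw [inner_neg_right, inner_dir_dir, inner_dir_dir, sub_self, Real.cos_zero,
    ← Real.cos_neg, neg_sub] at h6
  nlinarith [Real.sin_sq_add_cos_sq (φ₄ - φ₁)]

/-- Reduction of the Quadrangle Property to areas of caps of `C`. The lens is smooth at the four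
points, each being interior to the other translate, and `c` is the midpoint of `x₁` and `x₄`, so
these two are seen from it at angles that differ by `π`. -/
theorem not_quadrangleProperty (h : SupportCurve γ ρ) {φ₁ φ₂ φ₃ φ₄ : ℝ} (h12 : φ₁ < φ₂)
    (h23 : φ₂ < φ₃) (h34 : φ₃ < φ₄) (h41 : φ₄ < φ₁ + Real.pi) {v w x₁ x₂ x₃ x₄ : Plane}
    (e₁ : x₁ = v + γ φ₁) (e₂ : x₂ = v + γ φ₂) (e₃ : x₃ = w + γ φ₃) (e₄ : x₄ = w + γ φ₄)
    (hi₁ : x₁ - w ∈ interior (region γ)) (hi₂ : x₂ - w ∈ interior (region γ))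
    (hi₃ : x₃ - v ∈ interior (region γ)) (hi₄ : x₄ - v ∈ interior (region γ))
    {a₁₃ b₁₃ a₁₄ b₁₄ a₂₃ b₂₃ a₂₄ b₂₄ : ℝ}
    (l₁₃ : a₁₃ < b₁₃) (u₁₃ : b₁₃ < a₁₃ + Real.pi) (c₁₃ : x₃ - x₁ = γ b₁₃ - γ a₁₃)
    (l₁₄ : a₁₄ < b₁₄) (u₁₄ : b₁₄ < a₁₄ + Real.pi) (c₁₄ : x₄ - x₁ = γ b₁₄ - γ a₁₄)
    (l₂₃ : a₂₃ < b₂₃) (u₂₃ : b₂₃ < a₂₃ + Real.pi) (c₂₃ : x₃ - x₂ = γ b₂₃ - γ a₂₃)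
    (l₂₄ : a₂₄ < b₂₄) (u₂₄ : b₂₄ < a₂₄ + Real.pi) (c₂₄ : x₄ - x₂ = γ b₂₄ - γ a₂₄)
    (hlt : capArea γ ρ a₁₃ b₁₃ + capArea γ ρ a₂₄ b₂₄ + 1 / 2 * det2 (x₂ - x₁) (x₄ - x₃) <
      capArea γ ρ a₁₄ b₁₄ + capArea γ ρ a₂₃ b₂₃) :
    ¬ QuadrangleProperty (region γ) := by
  intro hQ
  have hpi := Real.pi_pos
  have same : ∀ {v : Plane} {s t : ℝ}, s < t → t < s + Real.pi →
      inner ℝ (dir s) (v + γ t - (v + γ s)) < 0 ∧ 0 < inner ℝ (dir t) (v + γ t - (v + γ s)) :=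
    fun hs ht => by
      rw [add_sub_add_left_eq_sub]
      exact ⟨h.inner_chord_left_neg hs ht, h.inner_chord_right_pos hs ht⟩
  have mixed : ∀ {v w : Plane} {s t : ℝ}, v + γ s - w ∈ interior (region γ) →
      w + γ t - v ∈ interior (region γ) →
      inner ℝ (dir s) (w + γ t - (v + γ s)) < 0 ∧ 0 < inner ℝ (dir t) (w + γ t - (v + γ s)) :=
    fun {v w s t} hs ht => by
      have k1 := inner_lt_of_mem_interior hs t
      have k2 := inner_lt_of_mem_interior ht s
      simp only [inner_sub_right, inner_add_right] at *
      constructor <;> linarith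
  subst e₁ e₂ e₃ e₄
  have n12 := same (v := v) h12 (by linarith)
  have n34 := same (v := w) h34 (by linarith)
  have n13 := mixed hi₁ hi₃
  have n14 := mixed hi₁ hi₄
  have n23 := mixed hi₂ hi₃
  have n24 := mixed hi₂ hi₄
  have h123 := det2_pos_of_normals h12 h23 (by linarith) n12.1 n12.2 n23.1 n23.2
  have h124 := det2_pos_of_normals h12 (by linarith) h41 n12.1 n12.2 n24.1 n24.2
  have h134 := det2_pos_of_normals (by linarith) h34 h41 n13.1 n13.2 n34.1 n34.2
  have h234 := det2_pos_of_normals h23 h34 (by linarith) n23.1 n23.2 n34.1 n34.2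
  obtain ⟨c, θ₁, θ₂, θ₃, r₁, r₂, r₃, hc, t12, t23, t31, hr1, hr2, hr3, f1, f2, f3, f4⟩ :=
    exists_angles_of_quadrangle h123 h124 h134 h234
  set K := lens (region γ) v w with hK
  have hadd : ∀ v s, v + γ s - v ∈ region γ := fun v s => by
    rw [add_sub_cancel_left]; exact h.mem_region s
  have m1 : v + γ φ₁ ∈ K := ⟨hadd v φ₁, interior_subset hi₁⟩
  have m2 : v + γ φ₂ ∈ K := ⟨hadd v φ₂, interior_subset hi₂⟩
  have m3 : w + γ φ₃ ∈ K := ⟨interior_subset hi₃, hadd w φ₃⟩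
  have m4 : w + γ φ₄ ∈ K := ⟨interior_subset hi₄, hadd w φ₄⟩
  have hcK : c ∈ interior K := by
    apply mem_interior_lens
    · have := h.convex_region.combo_self_interior_mem_interior (hadd v φ₁) hi₄
        (a := 1 / 2) (b := 1 / 2) (by norm_num) (by norm_num) (by norm_num)
      convert this using 1
      rw [hc]; apply plane_ext <;> simp <;> ring
    · have := h.convex_region.combo_interior_self_mem_interior hi₁ (hadd w φ₄)
        (a := 1 / 2) (b := 1 / 2) (by norm_num) (by norm_num) (by norm_num)
      convert this using 1
      rw [hc]; apply plane_ext <;> simp <;> ring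
  have hSC : IsSpindleConvexDisk (region γ) K := h.isSpindleConvexDisk_lens ⟨c, hcK⟩
  have d0 : ∀ s, dir s ≠ 0 := fun s => norm_ne_zero_iff.1 (by rw [norm_dir]; exact one_ne_zero)
  have o1 : IsOuterNormal K (v + γ φ₁) (dir φ₁) := isOuterNormal_lens v w φ₁
  have o2 : IsOuterNormal K (v + γ φ₂) (dir φ₂) := isOuterNormal_lens v w φ₂
  have o3 : IsOuterNormal K (w + γ φ₃) (dir φ₃) := by
    rw [hK, lens_comm]; exact isOuterNormal_lens w v φ₃
  have o4 : IsOuterNormal K (w + γ φ₄) (dir φ₄) := by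
    rw [hK, lens_comm]; exact isOuterNormal_lens w v φ₄
  have hclosed : IsClosed K := isClosed_lens γ v w
  have hineq := hQ K hSC c hcK θ₁ θ₂ θ₃ (θ₁ + Real.pi) t12 t23 t31 (by linarith)
    (v + γ φ₁) (v + γ φ₂) (w + γ φ₃) (w + γ φ₄)
    ⟨o1.mem_frontier (d0 _) m1, r₁, hr1, f1⟩ ⟨o2.mem_frontier (d0 _) m2, r₂, hr2, f2⟩
    ⟨o3.mem_frontier (d0 _) m3, r₃, hr3, f3⟩ ⟨o4.mem_frontier (d0 _) m4, r₁, hr1, f4⟩ (by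
      rintro y ⟨θ, hθ, hyf, r, hr, hy⟩
      refine h.not_isAntipodal_lens (by linarith) h41 hi₁ hi₄ (hclosed.frontier_subset hyf) ?_
      rw [hy, f4, f1, dir_add_pi]
      have e : det2 (c + r₁ • -dir θ₁ - (c + r₁ • dir θ₁)) (c + r • dir θ - (c + r₁ • -dir θ₁)) =
          -(2 * r₁ * r * Real.sin (θ - θ₁)) := by
        rw [← det2_dir_dir]; simp only [det2, PiLp.sub_apply, PiLp.add_apply, PiLp.smul_apply,
          PiLp.neg_apply, smul_eq_mul]; ring
      rw [e, neg_nonpos]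
      exact mul_nonneg (by positivity)
        (Real.sin_nonneg_of_nonneg_of_le_pi (by linarith [hθ.1]) (by linarith [hθ.2])))
  have A13 := h.volume_arcRegion_add hSC m1 m3 l₁₃ u₁₃ c₁₃
  have A14 := h.volume_arcRegion_add hSC m1 m4 l₁₄ u₁₄ c₁₄
  have A23 := h.volume_arcRegion_add hSC m2 m3 l₂₃ u₂₃ c₂₃
  have A24 := h.volume_arcRegion_add hSC m2 m4 l₂₄ u₂₄ c₂₄
  -- Both areas are split at `x₃`. The part beyond `x₃x₄` is common to them and cancels, and the
  -- difference of the two triangles is half of `det2 (x₂ - x₁) (x₄ - x₃)`.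
  have R14 := volume_rightPart_add hclosed (h.convex_lens v w) m1 m3 m4 (d0 _) o1 (d0 _) o3
    (d0 _) o4 h134
  have R24 := volume_rightPart_add hclosed (h.convex_lens v w) m2 m3 m4 (d0 _) o2 (d0 _) o3
    (d0 _) o4 h234
  have capnn : ∀ {a b : ℝ}, a < b → b < a + Real.pi → 0 ≤ capArea γ ρ a b := fun {a b} l u => by
    refine mul_nonneg (by norm_num) (intervalIntegral.integral_nonneg l.le fun s hs => ?_)
    rw [det2_smul_right, det2_tang_right, inner_sub_right]
    exact mul_nonneg (h.pos s).le (sub_nonneg.2 (h.inner_le s a))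
  have fin : ∀ p q, volume (rightPart K p q) ≠ ∞ := fun p q =>
    ((measure_mono fun z hz => hz.1).trans_lt hSC.1.1.measure_lt_top).ne
  have finA : ∀ p q, volume (arcRegion (region γ) K p q) ≠ ∞ := fun p q =>
    ((measure_mono fun z hz => hz.1.1).trans_lt hSC.1.1.measure_lt_top).ne
  have toR : ∀ {p q : Plane} {a b : ℝ}, a < b → b < a + Real.pi →
      volume (arcRegion (region γ) K p q) + ENNReal.ofReal (capArea γ ρ a b) =
        volume (rightPart K p q) →
      (volume (arcRegion (region γ) K p q)).toReal + capArea γ ρ a b =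
        (volume (rightPart K p q)).toReal := fun {p q a b} l u e => by
    rw [← e, ENNReal.toReal_add (finA p q) ENNReal.ofReal_ne_top, ENNReal.toReal_ofReal (capnn l u)]
  have B13 := toR l₁₃ u₁₃ A13
  have B14 := toR l₁₄ u₁₄ A14
  have B23 := toR l₂₃ u₂₃ A23
  have B24 := toR l₂₄ u₂₄ A24
  have toR2 : ∀ {p q r : Plane} {d : ℝ}, 0 < d → volume (rightPart K p r) =
      volume (rightPart K p q) + volume (rightPart K q r) + ENNReal.ofReal (d / 2) →
      (volume (rightPart K p r)).toReal = (volume (rightPart K p q)).toReal +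
        (volume (rightPart K q r)).toReal + d / 2 := fun {p q r d} hd e => by
    rw [e, ENNReal.toReal_add (ENNReal.add_ne_top.2 ⟨fin _ _, fin _ _⟩) ENNReal.ofReal_ne_top,
      ENNReal.toReal_add (fin _ _) (fin _ _), ENNReal.toReal_ofReal (by positivity)]
  have S14 := toR2 h134 R14
  have S24 := toR2 h234 R24
  have hineq' := ENNReal.toReal_mono (ENNReal.add_ne_top.2 ⟨finA _ _, finA _ _⟩) hineq
  rw [ENNReal.toReal_add (finA _ _) (finA _ _), ENNReal.toReal_add (finA _ _) (finA _ _)] at hineq'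
  have hdet : det2 (w + γ φ₃ - (v + γ φ₁)) (w + γ φ₄ - (v + γ φ₁)) -
      det2 (w + γ φ₃ - (v + γ φ₂)) (w + γ φ₄ - (v + γ φ₂)) =
      det2 (v + γ φ₂ - (v + γ φ₁)) (w + γ φ₄ - (w + γ φ₃)) := by
    simp [det2]; ring
  linarith

end SupportCurve

/-! ### The second variation of the area of a cap -/

/-- The derivative of the area of a cap when its chord, with end normals `dir a` and `dir b`,
changes from `v` in the direction `w`. -/
noncomputable def capDeriv (a b : ℝ) (v w : Plane) : ℝ :=
  -(1 / 2) * ((inner ℝ (dir a) w * inner ℝ (dir b) v + inner ℝ (dir b) w * inner ℝ (dir a) v) /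
    Real.sin (b - a))

/-- The second derivative of the area of a cap in the directions `w` and `u`; here `r` and `r'`
are the radii of curvature at the ends of the chord `v`. -/
noncomputable def capHessian (a b r r' : ℝ) (v w u : Plane) : ℝ :=
  -(1 / 2) * (inner ℝ (dir a) u * inner ℝ (dir b) w + inner ℝ (dir a) w * inner ℝ (dir b) u) /
      Real.sin (b - a) -
    inner ℝ (dir a) w * inner ℝ (dir a) u * inner ℝ (dir a) v / (Real.sin (b - a) ^ 3 * r') +
    inner ℝ (dir b) w * inner ℝ (dir b) u * inner ℝ (dir b) v / (Real.sin (b - a) ^ 3 * r)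

theorem sin_mul_inner_tang_left (a b : ℝ) (x : Plane) :
    Real.sin (b - a) * inner ℝ (tang a) x =
      inner ℝ (dir b) x - Real.cos (b - a) * inner ℝ (dir a) x := by
  have h := Real.sin_sq_add_cos_sq a
  simp only [inner_plane, dir_apply_zero, dir_apply_one, tang_apply_zero, tang_apply_one,
    Real.sin_sub, Real.cos_sub]
  linear_combination (x 0 * Real.cos b + x 1 * Real.sin b) * h

theorem sin_mul_inner_tang_right (a b : ℝ) (x : Plane) :
    Real.sin (b - a) * inner ℝ (tang b) x =
      Real.cos (b - a) * inner ℝ (dir b) x - inner ℝ (dir a) x := by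
  have h := Real.sin_sq_add_cos_sq b
  simp only [inner_plane, dir_apply_zero, dir_apply_one, tang_apply_zero, tang_apply_one,
    Real.sin_sub, Real.cos_sub]
  linear_combination (-x 0 * Real.cos a - x 1 * Real.sin a) * h

namespace SupportCurve

variable {γ : ℝ → Plane} {ρ : ℝ → ℝ}

/-- Each end moves along its own tangent, which is orthogonal to its own normal. So the component
along `dir a` sees only the motion of the end `b`, and conversely. -/
theorem inner_deriv_chord (h : SupportCurve γ ρ) {a b : ℝ → ℝ} {a' b' t : ℝ} {u : Plane}
    (ha : HasDerivAt a a' t) (hb : HasDerivAt b b' t)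
    (hu : HasDerivAt (fun s => γ (b s) - γ (a s)) u t) :
    inner ℝ (dir (a t)) u = -(ρ (b t) * b' * Real.sin (b t - a t)) ∧
      inner ℝ (dir (b t)) u = -(ρ (a t) * a' * Real.sin (b t - a t)) := by
  have h1 := ((h.hasDerivAt (b t)).scomp t hb).sub ((h.hasDerivAt (a t)).scomp t ha)
  rw [hu.unique h1]
  simp only [inner_sub_right, inner_smul_right, inner_dir_tang, sub_self, Real.sin_zero]
  rw [← neg_sub (b t) (a t), Real.sin_neg]
  constructor <;> ring

/-- This separates the dependence on the two ends, so that the fundamental theorem of calculus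
applies to each integral. -/
theorem capArea_eq (h : SupportCurve γ ρ) (a b : ℝ) :
    capArea γ ρ a b = 1 / 2 * ((∫ s in (0 : ℝ)..b, det2 (γ s) (ρ s • tang s)) -
      (∫ s in (0 : ℝ)..a, det2 (γ s) (ρ s • tang s)) - det2 (γ a) (γ b)) := by
  have hc : Continuous fun s => ρ s • tang s := h.cont.smul continuous_tang
  have i1 : Continuous fun s => det2 (γ s) (ρ s • tang s) := continuous_det2 h.continuous hc
  have i2 : Continuous fun s => det2 (γ a) (ρ s • tang s) :=
    continuous_det2 continuous_const hc
  have e : ∫ s in a..b, det2 (γ a) (ρ s • tang s) = det2 (γ a) (γ b) - det2 (γ a) (γ a) := by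
    refine intervalIntegral.integral_eq_sub_of_hasDerivAt (f := fun s => det2 (γ a) (γ s))
      (fun s _ => ?_) (i2.intervalIntegrable _ _)
    refine (hasDerivAt_det2 (hasDerivAt_const s (γ a)) (h.hasDerivAt s)).congr_deriv ?_
    simp [det2]
  rw [capArea, intervalIntegral.integral_interval_sub_left (i1.intervalIntegrable _ _)
    (i1.intervalIntegrable _ _)]
  simp only [det2_sub_left]
  rw [intervalIntegral.integral_sub (i1.intervalIntegrable _ _) (i2.intervalIntegrable _ _), e,
    det2_self, sub_zero]

/-- Expressed through the velocity `u` of the chord instead of `a'` and `b'`, the derivative no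
longer contains `ρ`. This is why a second derivative exists although `ρ` is only continuous. -/
theorem hasDerivAt_capArea (h : SupportCurve γ ρ) {a b : ℝ → ℝ} {a' b' t : ℝ} {u : Plane}
    (ha : HasDerivAt a a' t) (hb : HasDerivAt b b' t)
    (hu : HasDerivAt (fun s => γ (b s) - γ (a s)) u t) (hS : Real.sin (b t - a t) ≠ 0) :
    HasDerivAt (fun s => capArea γ ρ (a s) (b s))
      (capDeriv (a t) (b t) (γ (b t) - γ (a t)) u) t := by
  have hc : Continuous fun s => det2 (γ s) (ρ s • tang s) :=
    continuous_det2 h.continuous (h.cont.smul continuous_tang)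
  have hB : ∀ x, HasDerivAt (fun y => ∫ s in (0 : ℝ)..y, det2 (γ s) (ρ s • tang s))
      (det2 (γ x) (ρ x • tang x)) x := fun x =>
    intervalIntegral.integral_hasDerivAt_right (hc.intervalIntegrable _ _)
      (hc.stronglyMeasurableAtFilter _ _) hc.continuousAt
  obtain ⟨e1, e2⟩ := h.inner_deriv_chord ha hb hu
  simp only [h.capArea_eq]
  refine ((((hB (b t)).comp t hb).sub ((hB (a t)).comp t ha)).sub
    (hasDerivAt_det2 ((h.hasDerivAt (a t)).scomp t ha)
      ((h.hasDerivAt (b t)).scomp t hb))).const_mul (1 / 2) |>.congr_deriv ?_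
  rw [capDeriv, e1, e2]
  have : (-(ρ (b t) * b' * Real.sin (b t - a t)) * inner ℝ (dir (b t)) (γ (b t) - γ (a t)) +
      -(ρ (a t) * a' * Real.sin (b t - a t)) * inner ℝ (dir (a t)) (γ (b t) - γ (a t))) /
      Real.sin (b t - a t) = -(ρ (b t) * b' * inner ℝ (dir (b t)) (γ (b t) - γ (a t))) -
        ρ (a t) * a' * inner ℝ (dir (a t)) (γ (b t) - γ (a t)) := by
    field_simp
    ring
  rw [this]
  simp only [Function.comp, det2_smul_right, det2_smul_left, det2_tang_right, det2_tang_left,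
    inner_sub_right]
  ring

/-- The angles turn with speeds that are `u` paired with the opposite normal, divided by a radius
and a sine; this brings the radii into the Hessian. Tangential components are eliminated through the
two normal ones. -/
theorem hasDerivAt_capDeriv (h : SupportCurve γ ρ) {a b : ℝ → ℝ} {a' b' t : ℝ} {u : Plane}
    (ha : HasDerivAt a a' t) (hb : HasDerivAt b b' t)
    (hu : HasDerivAt (fun s => γ (b s) - γ (a s)) u t) (hS : Real.sin (b t - a t) ≠ 0)
    (w : Plane) :
    HasDerivAt (fun s => capDeriv (a s) (b s) (γ (b s) - γ (a s)) w)
      (capHessian (a t) (b t) (ρ (a t)) (ρ (b t)) (γ (b t) - γ (a t)) w u) t := by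
  obtain ⟨e1, e2⟩ := h.inner_deriv_chord ha hb hu
  have hdw : ∀ {c : ℝ → ℝ} {c' : ℝ}, HasDerivAt c c' t →
      HasDerivAt (fun s => inner ℝ (dir (c s)) w) (c' * inner ℝ (tang (c t)) w) t :=
    fun {c c'} hc => by
      refine (((hasDerivAt_dir (c t)).scomp t hc).inner ℝ (hasDerivAt_const t w)).congr_deriv ?_
      simp [inner_smul_left]
  have hdv : ∀ {c : ℝ → ℝ} {c' : ℝ}, HasDerivAt c c' t →
      HasDerivAt (fun s => inner ℝ (dir (c s)) (γ (b s) - γ (a s)))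
        (inner ℝ (dir (c t)) u + c' * inner ℝ (tang (c t)) (γ (b t) - γ (a t))) t :=
    fun {c c'} hc => by
      refine (((hasDerivAt_dir (c t)).scomp t hc).inner ℝ hu).congr_deriv ?_
      simp [inner_smul_left]
  have hs : HasDerivAt (fun s => Real.sin (b s - a s)) (Real.cos (b t - a t) * (b' - a')) t :=
    (hb.sub ha).sin
  refine ((((hdw ha).mul (hdv hb)).add ((hdw hb).mul (hdv ha))).div hs hS).const_mul (-(1 / 2))
    |>.congr_deriv ?_
  have t1 := sin_mul_inner_tang_left (a t) (b t) w
  have t2 := sin_mul_inner_tang_right (a t) (b t) w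
  have t3 := sin_mul_inner_tang_left (a t) (b t) (γ (b t) - γ (a t))
  have t4 := sin_mul_inner_tang_right (a t) (b t) (γ (b t) - γ (a t))
  have hra := (h.pos (a t)).ne'
  have hrb := (h.pos (b t)).ne'
  simp only [Pi.add_apply, Pi.mul_apply]
  rw [capHessian]
  generalize inner ℝ (dir (a t)) w = wa at *
  generalize inner ℝ (dir (b t)) w = wb at *
  generalize inner ℝ (dir (a t)) (γ (b t) - γ (a t)) = va at *
  generalize inner ℝ (dir (b t)) (γ (b t) - γ (a t)) = vb at *
  generalize inner ℝ (tang (a t)) w = wa' at *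
  generalize inner ℝ (tang (b t)) w = wb' at *
  generalize inner ℝ (tang (a t)) (γ (b t) - γ (a t)) = va' at *
  generalize inner ℝ (tang (b t)) (γ (b t) - γ (a t)) = vb' at *
  generalize inner ℝ (dir (a t)) u = ua at *
  generalize inner ℝ (dir (b t)) u = ub at *
  generalize Real.cos (b t - a t) = C at *
  generalize Real.sin (b t - a t) = S at *
  generalize ρ (a t) = r at *
  generalize ρ (b t) = r' at *
  subst e1 e2
  have q1 : wa' = (wb - C * wa) / S := by rw [eq_div_iff hS, mul_comm]; exact t1
  have q2 : wb' = (C * wb - wa) / S := by rw [eq_div_iff hS, mul_comm]; exact t2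
  have q3 : va' = (vb - C * va) / S := by rw [eq_div_iff hS, mul_comm]; exact t3
  have q4 : vb' = (C * vb - va) / S := by rw [eq_div_iff hS, mul_comm]; exact t4
  rw [q1, q2, q3, q4]
  field_simp
  ring

/-- Inverse function theorem for `(a, b) ↦ γ b - γ a`. The differential has the independent columns
`tang α` and `tang β` up to nonzero factors; pairing with `dir β` or `dir α` removes one column and
gives the explicit inverse `g`. -/
theorem exists_chord_inverse (h : SupportCurve γ ρ) {α β : ℝ} (h1 : α < β)
    (h2 : β < α + Real.pi) :
    ∃ Λ : Plane → ℝ × ℝ, Λ (γ β - γ α) = (α, β) ∧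
      ∀ᶠ v in 𝓝 (γ β - γ α), ContinuousAt Λ v ∧ DifferentiableAt ℝ Λ v ∧
        γ (Λ v).2 - γ (Λ v).1 = v ∧ (Λ v).1 < (Λ v).2 ∧ (Λ v).2 < (Λ v).1 + Real.pi := by
  have hS : Real.sin (β - α) ≠ 0 :=
    (Real.sin_pos_of_pos_of_lt_pi (by linarith) (by linarith)).ne'
  have hα := (h.pos α).ne'
  have hβ := (h.pos β).ne'
  set E : ℝ × ℝ → Plane := fun x => γ x.2 - γ x.1 with hE
  let f : ℝ × ℝ →L[ℝ] Plane :=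
    (ContinuousLinearMap.snd ℝ ℝ ℝ).smulRight (ρ β • tang β) -
      (ContinuousLinearMap.fst ℝ ℝ ℝ).smulRight (ρ α • tang α)
  let g : Plane →L[ℝ] ℝ × ℝ :=
    ((-(Real.sin (β - α) * ρ α))⁻¹ • innerSL ℝ (dir β)).prod
      ((-(Real.sin (β - α) * ρ β))⁻¹ • innerSL ℝ (dir α))
  have hgf : Function.LeftInverse g f := by
    rintro ⟨x, y⟩
    have hsw : Real.sin (α - β) = -Real.sin (β - α) := by rw [← Real.sin_neg, neg_sub]
    ext
    · simp [f, g, inner_sub_right, inner_smul_right, inner_dir_tang]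
      field_simp
    · simp [f, g, inner_sub_right, inner_smul_right, inner_dir_tang, hsw]
      field_simp
  have hfg : Function.RightInverse g f := by
    intro w
    have hw := congrArg (fun y => (Real.sin (β - α))⁻¹ • y) (sin_smul_eq_tang α β w)
    simp only [smul_smul, inv_mul_cancel₀ hS, one_smul, smul_add] at hw
    have k1 : (-(Real.sin (β - α) * ρ β))⁻¹ * inner ℝ (dir α) w * ρ β =
        (Real.sin (β - α))⁻¹ * -inner ℝ (dir α) w := by field_simp
    have k2 : (-(Real.sin (β - α) * ρ α))⁻¹ * inner ℝ (dir β) w * ρ α =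
        -((Real.sin (β - α))⁻¹ * inner ℝ (dir β) w) := by field_simp
    refine Eq.trans ?_ hw.symm
    change ((-(Real.sin (β - α) * ρ β))⁻¹ * inner ℝ (dir α) w) • (ρ β • tang β) -
      ((-(Real.sin (β - α) * ρ α))⁻¹ * inner ℝ (dir β) w) • (ρ α • tang α) = _
    rw [smul_smul, smul_smul, k1, k2, neg_smul, sub_neg_eq_add]
  let e : (ℝ × ℝ) ≃L[ℝ] Plane := ContinuousLinearEquiv.equivOfInverse f g hgf hfg
  have hγ1 : ContDiff ℝ 1 γ := by
    rw [contDiff_one_iff_deriv]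
    refine ⟨fun s => (h.hasDerivAt s).differentiableAt, ?_⟩
    rw [funext fun s => (h.hasDerivAt s).deriv]
    exact h.cont.smul continuous_tang
  have hE1 : ContDiffAt ℝ 1 E (α, β) :=
    ((hγ1.comp contDiff_snd).sub (hγ1.comp contDiff_fst)).contDiffAt
  have hE' : HasFDerivAt E (e : ℝ × ℝ →L[ℝ] Plane) (α, β) := by
    have a1 : HasFDerivAt (fun x : ℝ × ℝ => γ x.2) _ (α, β) :=
      (h.hasDerivAt β).hasFDerivAt.comp (α, β) hasFDerivAt_snd
    have a2 : HasFDerivAt (fun x : ℝ × ℝ => γ x.1) _ (α, β) :=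
      (h.hasDerivAt α).hasFDerivAt.comp (α, β) hasFDerivAt_fst
    refine (a1.sub a2).congr_fderiv ?_
    ext <;> simp [e, f]
  refine ⟨hE1.localInverse hE' one_ne_zero, hE1.localInverse_apply_image hE' one_ne_zero, ?_⟩
  have hΛ := hE1.to_localInverse hE' one_ne_zero
  set Λ := hE1.localInverse hE' one_ne_zero
  have hΛ0 : Λ (γ β - γ α) = (α, β) := hE1.localInverse_apply_image hE' one_ne_zero
  have ev1 : ∀ᶠ v in 𝓝 (γ β - γ α), E (Λ v) = v :=
    (hE1.hasStrictFDerivAt' hE' one_ne_zero).eventually_right_inverse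
  have ev2 : ∀ᶠ v in 𝓝 (γ β - γ α), ContDiffAt ℝ 1 Λ v := hΛ.eventually (by simp)
  have hc : ContinuousAt Λ (γ β - γ α) := hΛ.continuousAt
  have ev3 : ∀ᶠ v in 𝓝 (γ β - γ α), (Λ v).1 < (Λ v).2 := by
    refine hc.fst.eventually_lt hc.snd ?_
    rw [hΛ0]; exact h1
  have ev4 : ∀ᶠ v in 𝓝 (γ β - γ α), (Λ v).2 < (Λ v).1 + Real.pi := by
    refine hc.snd.eventually_lt (hc.fst.add continuousAt_const) ?_
    rw [hΛ0]; exact h2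
  filter_upwards [ev1, ev2, ev3, ev4] with v k1 k2 k3 k4
  exact ⟨k2.continuousAt, k2.differentiableAt one_ne_zero, k1, k3, k4⟩

end SupportCurve

theorem continuousAt_capHessian {X : Type*} [TopologicalSpace X] {a b r r' : X → ℝ}
    {v w u : X → Plane} {x : X} (ha : ContinuousAt a x) (hb : ContinuousAt b x)
    (hr : ContinuousAt r x) (hr' : ContinuousAt r' x) (hv : ContinuousAt v x)
    (hw : ContinuousAt w x) (hu : ContinuousAt u x) (hS : Real.sin (b x - a x) ≠ 0)
    (hr0 : r x ≠ 0) (hr0' : r' x ≠ 0) :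
    ContinuousAt (fun y => capHessian (a y) (b y) (r y) (r' y) (v y) (w y) (u y)) x := by
  have hd : ∀ {c : X → ℝ} {z : X → Plane}, ContinuousAt c x → ContinuousAt z x →
      ContinuousAt (fun y => inner ℝ (dir (c y)) (z y)) x := fun hc hz =>
    (continuous_dir.continuousAt.comp hc).inner hz
  have hs : ContinuousAt (fun y => Real.sin (b y - a y)) x :=
    Real.continuous_sin.continuousAt.comp (hb.sub ha)
  unfold capHessian
  refine (ContinuousAt.sub ?_ ?_).add ?_
  · exact (continuousAt_const.mul (((hd ha hu).mul (hd hb hw)).add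
      ((hd ha hw).mul (hd hb hu)))).div hs hS
  · exact (((hd ha hw).mul (hd ha hu)).mul (hd ha hv)).div ((hs.pow 3).mul hr')
      (mul_ne_zero (pow_ne_zero 3 hS) hr0')
  · exact (((hd hb hw).mul (hd hb hu)).mul (hd hb hv)).div ((hs.pow 3).mul hr)
      (mul_ne_zero (pow_ne_zero 3 hS) hr0)

/-! ### From a chord with negative second variation to a violating lens -/

namespace SupportCurve

variable {γ : ℝ → Plane} {ρ : ℝ → ℝ}

/-- `F` increases up to `θ` and decreases after it, within half a turn on each side. If `α ≤ θ`,
then `F φ < F α` and `F β ≤ F θ`; if `θ < α`, then `F β < F α` and `F φ ≤ F θ`. The lower bound is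
similar, with `F (φ + π) = -F φ`. -/
theorem inner_corner_lt (h : SupportCurve γ ρ) {φ α β θ : ℝ} (h1 : φ < α) (h2 : α < β)
    (h3 : β < φ + Real.pi) (h4 : φ ≤ θ) (h5 : θ ≤ φ + Real.pi) :
    inner ℝ (dir θ) (γ φ + (γ β - γ α)) < inner ℝ (dir θ) (γ θ) ∧
      -inner ℝ (dir θ) (γ θ) < inner ℝ (dir θ) (γ φ + (γ β - γ α)) := by
  have hm := h.strictMonoOn θ
  have ha := h.strictAntiOn θ
  have hle := h.inner_le θ
  have hopp : inner ℝ (dir θ) (γ (φ + Real.pi)) = -inner ℝ (dir θ) (γ φ) := by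
    rw [h.antip, inner_neg_right]
  simp only [inner_add_right, inner_sub_right]
  set F : ℝ → ℝ := fun s => inner ℝ (dir θ) (γ s) with hF
  change F φ + (F β - F α) < F θ ∧ -F θ < F φ + (F β - F α)
  change F (φ + Real.pi) = -F φ at hopp
  have mem1 : ∀ s, φ ≤ s → s ≤ θ → s ∈ Icc (θ - Real.pi) θ := fun s a b => ⟨by linarith, b⟩
  have mem2 : ∀ s, θ ≤ s → s ≤ φ + Real.pi → s ∈ Icc θ (θ + Real.pi) := fun s a b =>
    ⟨a, by linarith⟩
  constructor
  · rcases le_or_gt α θ with h6 | h6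
    · have : F φ < F α := hm (mem1 φ le_rfl h4) (mem1 α h1.le h6) h1
      linarith [hle β]
    · have : F β < F α := ha (mem2 α h6.le (by linarith)) (mem2 β (by linarith) h3.le) h2
      linarith [hle φ]
  · rcases le_or_gt β θ with h6 | h6
    · have k1 : F α < F β := hm (mem1 α h1.le (by linarith)) (mem1 β (by linarith) h6) h2
      have k2 : F (φ + Real.pi) ≤ F θ := hle _
      linarith
    · have k1 : F (φ + Real.pi) < F β :=
        ha (mem2 β h6.le h3.le) (mem2 _ h5 le_rfl) h3
      linarith [hle α]

/-- This places the points of one arc strictly inside the other translate when the lens is built.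
Normals in the remaining half turn are covered by the lower bound of `inner_corner_lt` and central
symmetry. -/
theorem corner_mem_interior (h : SupportCurve γ ρ) {φ α β : ℝ} (h1 : φ < α) (h2 : α < β)
    (h3 : β < φ + Real.pi) : γ φ + (γ β - γ α) ∈ interior (region γ) := by
  refine h.mem_interior_region fun θ => ?_
  have hp : Function.Periodic (fun s => (dir s, γ s)) (2 * Real.pi) := fun s => by
    simp only [dir_periodic s, h.periodic s]
  obtain ⟨t, ht, e⟩ := hp.exists_mem_Ico Real.two_pi_pos θ φ
  rw [Prod.mk.injEq] at e
  rw [e.1, e.2]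
  rcases le_or_gt t (φ + Real.pi) with h4 | h4
  · exact (h.inner_corner_lt h1 h2 h3 ht.1 h4).1
  · have := (h.inner_corner_lt h1 h2 h3 (θ := t - Real.pi) (by linarith) (by linarith [ht.2])).2
    have e1 := dir_add_pi (t - Real.pi)
    have e2 := h.antip (t - Real.pi)
    rw [sub_add_cancel] at e1 e2
    rw [e1, e2, inner_neg_left, inner_neg_left, inner_neg_right]
    linarith

theorem neg_mem_interior (h : SupportCurve γ ρ) {x : Plane} (hx : x ∈ interior (region γ)) :
    -x ∈ interior (region γ) := by
  refine h.mem_interior_region fun θ => ?_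
  have := inner_lt_of_mem_interior hx (θ + Real.pi)
  rw [dir_add_pi, h.antip] at this
  simpa using this

/-- If the area of the caps of the region is strictly concave, at the chord from `γ α` to `γ β`,
in the direction that bisects the normals at the ends, then the Quadrangle Property fails. -/
theorem not_quadrangleProperty_of_chord (h : SupportCurve γ ρ) {α β : ℝ} (h1 : α < β)
    (h2 : β < α + Real.pi)
    (hcond : inner ℝ (dir β) (γ β - γ α) / ρ α - inner ℝ (dir α) (γ β - γ α) / ρ β <
      Real.sin (β - α) ^ 2) :
    ¬ QuadrangleProperty (region γ) := by
  have hpi := Real.pi_pos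
  have hS : 0 < Real.sin (β - α) := Real.sin_pos_of_pos_of_lt_pi (by linarith) (by linarith)
  -- `dir φ` is orthogonal to the bisector of `dir α` and `dir β`, so `tang φ` points along the
  -- bisector and has the same component along both normals.
  obtain ⟨φ, hφ⟩ : ∃ φ, φ = (α + β) / 2 - Real.pi / 2 := ⟨_, rfl⟩
  obtain ⟨v₀, hv₀⟩ : ∃ v₀, v₀ = γ β - γ α := ⟨_, rfl⟩
  obtain ⟨Λ, hΛ0, hΛ⟩ := h.exists_chord_inverse h1 h2
  rw [← hv₀] at hΛ0 hΛ hcond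
  have hcorner : γ φ + v₀ ∈ interior (region γ) := by
    rw [hv₀]; exact h.corner_mem_interior (by linarith) h1 (by linarith)
  -- `p` runs through one arc of the lens, starting at the origin, and `q` through the opposite arc,
  -- starting at `v₀`; their initial tangents are antiparallel. The cap areas involved are those
  -- with chord `q t - p s`.
  set p : ℝ → Plane := fun s => γ (φ + s) - γ φ with hp
  set p' : ℝ → Plane := fun s => ρ (φ + s) • tang (φ + s) with hp'
  set q : ℝ → Plane := fun t => v₀ - p t with hq
  have hp0 : p 0 = 0 := by simp [hp]
  have hdp : ∀ s, HasDerivAt p (p' s) s := fun s =>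
    ((h.hasDerivAt (φ + s)).comp_const_add φ s).sub_const (γ φ)
  have hdq : ∀ t, HasDerivAt q (-p' t) t := fun t => (hdp t).const_sub v₀
  have hpc : Continuous p := continuous_iff_continuousAt.2 fun s => (hdp s).continuousAt
  have hp'c : Continuous p' :=
    (h.cont.comp (continuous_const.add continuous_id)).smul
      (continuous_tang.comp (continuous_const.add continuous_id))
  have hqc : Continuous q := continuous_const.sub hpc
  set good : Plane → Prop := fun v => ContinuousAt Λ v ∧ DifferentiableAt ℝ Λ v ∧
        γ (Λ v).2 - γ (Λ v).1 = v ∧ (Λ v).1 < (Λ v).2 ∧ (Λ v).2 < (Λ v).1 + Real.pi with hgood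
  set H : Plane → Plane → Plane → ℝ := fun v w u =>
    capHessian (Λ v).1 (Λ v).2 (ρ (Λ v).1) (ρ (Λ v).2) v w u with hH
  have hvar : ∀ {c : ℝ → Plane} {u : Plane} {t : ℝ}, HasDerivAt c u t →
      (∀ᶠ r in 𝓝 t, good (c r)) →
      HasDerivAt (fun r => capArea γ ρ (Λ (c r)).1 (Λ (c r)).2)
        (capDeriv (Λ (c t)).1 (Λ (c t)).2 (c t) u) t ∧
      ∀ w, HasDerivAt (fun r => capDeriv (Λ (c r)).1 (Λ (c r)).2 (c r) w) (H (c t) w u) t := by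
    intro c u t hc hg
    obtain ⟨-, g2, g3, g4, g5⟩ := hg.self_of_nhds
    have hcomp := g2.hasFDerivAt.comp_hasDerivAt t hc
    have ha : HasDerivAt (fun r => (Λ (c r)).1) _ t :=
      hasFDerivAt_fst.comp_hasDerivAt t hcomp
    have hb : HasDerivAt (fun r => (Λ (c r)).2) _ t :=
      hasFDerivAt_snd.comp_hasDerivAt t hcomp
    have hev : (fun r => γ (Λ (c r)).2 - γ (Λ (c r)).1) =ᶠ[𝓝 t] c :=
      hg.mono fun r hr => hr.2.2.1
    have hu := hc.congr_of_eventuallyEq hev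
    have hs : Real.sin ((Λ (c t)).2 - (Λ (c t)).1) ≠ 0 :=
      (Real.sin_pos_of_pos_of_lt_pi (by linarith) (by linarith)).ne'
    refine ⟨?_, fun w => ?_⟩
    · have := h.hasDerivAt_capArea ha hb hu hs
      rwa [g3] at this
    · have := h.hasDerivAt_capDeriv ha hb hu hs w
      rw [g3] at this
      exact this.congr_of_eventuallyEq (hg.mono fun r hr => by simp only [hr.2.2.1])
  -- The mixed derivative in `s` and `t` of the cap area with chord `q t - p s`, plus the
  -- determinant that comes from the triangles. At the origin the determinant vanishes and `hcond`
  -- gives the sign.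
  set R : ℝ × ℝ → ℝ := fun x =>
    H (q x.2 - p x.1) (-p' x.2) (-p' x.1) + 1 / 2 * det2 (p' x.1) (-p' x.2) with hR
  have hchord : Continuous fun x : ℝ × ℝ => q x.2 - p x.1 :=
    (hqc.comp continuous_snd).sub (hpc.comp continuous_fst)
  have hchord0 : q ((0 : ℝ), (0 : ℝ)).2 - p ((0 : ℝ), (0 : ℝ)).1 = v₀ := by
    simp [hq, hp0]
  have hR0 : R (0, 0) < 0 := by
    have e1 : inner ℝ (dir α) (tang φ) = Real.cos ((β - α) / 2) := by
      rw [inner_dir_tang, ← Real.sin_pi_div_two_sub]; congr 1; rw [hφ]; ring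
    have e2 : inner ℝ (dir β) (tang φ) = Real.cos ((β - α) / 2) := by
      rw [inner_dir_tang, ← Real.cos_neg, ← Real.sin_pi_div_two_sub]; congr 1; rw [hφ]; ring
    have hcos : 0 < Real.cos ((β - α) / 2) :=
      Real.cos_pos_of_mem_Ioo ⟨by linarith, by linarith⟩
    have e3 : R (0, 0) = (ρ φ * Real.cos ((β - α) / 2)) ^ 2 / Real.sin (β - α) ^ 3 *
        (inner ℝ (dir β) v₀ / ρ α - inner ℝ (dir α) v₀ / ρ β - Real.sin (β - α) ^ 2) := by
      have k0 : q 0 - p 0 = v₀ := hchord0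
      have k1 : p' 0 = ρ φ • tang φ := by simp [hp']
      have hra := (h.pos α).ne'
      have hrb := (h.pos β).ne'
      have hSn := hS.ne'
      simp only [hR, hH, k0, k1, hΛ0, capHessian, inner_neg_right, inner_smul_right, e1, e2]
      rw [← smul_neg, det2_smul_left, det2_smul_right]
      have : det2 (tang φ) (-tang φ) = 0 := by simp [det2]; ring
      rw [this]
      field_simp
      ring
    rw [e3]
    exact mul_neg_of_pos_of_neg (div_pos (pow_pos (mul_pos (h.pos φ) hcos) 2) (pow_pos hS 3))
      (by linarith)
  have hΛc : ContinuousAt (fun x : ℝ × ℝ => Λ (q x.2 - p x.1)) (0, 0) := by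
    refine ContinuousAt.comp (f := fun x : ℝ × ℝ => q x.2 - p x.1) (g := Λ) ?_ hchord.continuousAt
    rw [hchord0]; exact hΛ.self_of_nhds.1
  have hRc : ContinuousAt R (0, 0) := by
    refine ContinuousAt.add (continuousAt_capHessian hΛc.fst hΛc.snd
      (h.cont.continuousAt.comp hΛc.fst) (h.cont.continuousAt.comp hΛc.snd)
      hchord.continuousAt (hp'c.comp continuous_snd).neg.continuousAt
      (hp'c.comp continuous_fst).neg.continuousAt ?_ (h.pos _).ne' (h.pos _).ne') ?_
    · rw [hchord0, hΛ0]; exact hS.ne'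
    · exact (continuous_const.mul (continuous_det2 (hp'c.comp continuous_fst)
        (hp'c.comp continuous_snd).neg)).continuousAt
  have hev : ∀ᶠ x : ℝ × ℝ in 𝓝 (0, 0), good (q x.2 - p x.1) ∧ R x < 0 ∧
      p x.1 - (v₀ + γ φ) ∈ interior (region γ) ∧ q x.2 + γ φ ∈ interior (region γ) := by
    refine Filter.Eventually.and ?_ (Filter.Eventually.and ?_ (Filter.Eventually.and ?_ ?_))
    · have := hchord.tendsto (0, 0)
      rw [hchord0] at this
      exact this.eventually hΛ
    · exact hRc.eventually (gt_mem_nhds hR0)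
    · have hc : Continuous fun x : ℝ × ℝ => p x.1 - (v₀ + γ φ) :=
        (hpc.comp continuous_fst).sub continuous_const
      refine hc.tendsto (0, 0) (isOpen_interior.mem_nhds ?_)
      simp only [hp0, zero_sub]
      rw [add_comm]; exact h.neg_mem_interior hcorner
    · have hc : Continuous fun x : ℝ × ℝ => q x.2 + γ φ :=
        (hqc.comp continuous_snd).add continuous_const
      refine hc.tendsto (0, 0) (isOpen_interior.mem_nhds ?_)
      simp only [hq, hp0, sub_zero]
      rw [add_comm]; exact hcorner
  obtain ⟨δ, hδ, hb⟩ := Metric.eventually_nhds_iff.1 hev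
  have hball : ∀ s t, |s| < δ → |t| < δ → good (q t - p s) ∧ R (s, t) < 0 ∧
      p s - (v₀ + γ φ) ∈ interior (region γ) ∧ q t + γ φ ∈ interior (region γ) :=
    fun s t hs ht => hb (y := (s, t)) (by
      rw [Prod.dist_eq]
      exact max_lt (by simpa using hs) (by simpa using ht))
  clear hb hev
  obtain ⟨κ, hκ0, hκδ, hκ1⟩ : ∃ κ : ℝ, 0 < κ ∧ 3 * κ ≤ δ ∧ 3 * κ ≤ 1 :=
    ⟨min δ 1 / 3, by positivity, by linarith [min_le_left δ 1], by linarith [min_le_right δ 1]⟩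
  have hd1 : ∀ s t, |s| < δ → |t| < δ →
      HasDerivAt (fun t => capArea γ ρ (Λ (q t - p s)).1 (Λ (q t - p s)).2)
        (capDeriv (Λ (q t - p s)).1 (Λ (q t - p s)).2 (q t - p s) (-p' t)) t := by
    intro s t hs ht
    refine (hvar (c := fun t => q t - p s) ((hdq t).sub_const (p s)) ?_).1
    filter_upwards [continuous_abs.continuousAt.eventually (gt_mem_nhds ht)] with r hr
    exact (hball s r hs hr).1
  have hd2 : ∀ s t, |s| < δ → |t| < δ →
      HasDerivAt (fun s => capDeriv (Λ (q t - p s)).1 (Λ (q t - p s)).2 (q t - p s) (-p' t) +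
        1 / 2 * det2 (p s) (-p' t)) (R (s, t)) s := by
    intro s t hs ht
    have k1 := (hvar (c := fun s => q t - p s) ((hdp s).const_sub (q t)) (by
      filter_upwards [continuous_abs.continuousAt.eventually (gt_mem_nhds hs)] with r hr
      exact (hball r t hr ht).1)).2 (-p' t)
    have k2 := (hasDerivAt_det2 (hdp s) (hasDerivAt_const s (-p' t))).const_mul (1 / 2)
    refine (k1.add k2).congr_deriv ?_
    simp [hR, det2]
  have abs0 : |(0 : ℝ)| < δ := by simpa using hδ
  have absκ : |κ| < δ := by rw [abs_of_pos hκ0]; linarith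
  have habst : ∀ t ∈ Icc (-(2 * κ)) (-κ), |t| < δ := fun t ht => by
    rw [abs_lt]; constructor <;> linarith [ht.1, ht.2]
  -- A difference in `s` between `0` and `κ`. Its increment in `t` is the required second
  -- difference, evaluated below by the mean value theorem first in `t`, then in `s`.
  set Φ : ℝ → ℝ := fun t => capArea γ ρ (Λ (q t - p 0)).1 (Λ (q t - p 0)).2 -
    capArea γ ρ (Λ (q t - p κ)).1 (Λ (q t - p κ)).2 - 1 / 2 * det2 (p κ - p 0) (q t) with hΦ
  have hdΦ : ∀ t ∈ Icc (-(2 * κ)) (-κ), HasDerivAt Φ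
      (capDeriv (Λ (q t - p 0)).1 (Λ (q t - p 0)).2 (q t - p 0) (-p' t) -
        capDeriv (Λ (q t - p κ)).1 (Λ (q t - p κ)).2 (q t - p κ) (-p' t) -
        1 / 2 * det2 (p κ - p 0) (-p' t)) t := fun t ht => by
    refine ((hd1 0 t abs0 (habst t ht)).sub (hd1 κ t absκ (habst t ht))).sub
      ((hasDerivAt_det2 (hasDerivAt_const t (p κ - p 0)) (hdq t)).const_mul (1 / 2)
        |>.congr_deriv ?_)
    simp [det2]
  -- The interval for `t` stays away from `0` on the negative side: `x₄` then has normal angle `φ +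
  -- π - κ`, strictly less than `π` beyond that of `x₁`, as the turning angle condition demands.
  obtain ⟨t, ht, et⟩ := exists_hasDerivAt_eq_slope Φ _ (show -(2 * κ) < -κ by linarith)
    (fun t ht => (hdΦ t ht).continuousAt.continuousWithinAt)
    (fun t ht => hdΦ t (Ioo_subset_Icc_self ht))
  have htδ := habst t (Ioo_subset_Icc_self ht)
  have habss : ∀ s ∈ Icc 0 κ, |s| < δ := fun s hs => by
    rw [abs_lt]; constructor <;> linarith [hs.1, hs.2]
  obtain ⟨s, hs, es⟩ := exists_hasDerivAt_eq_slope _ _ hκ0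
    (fun s hs => (hd2 s t (habss s hs) htδ).continuousAt.continuousWithinAt)
    (fun s hs => hd2 s t (habss s (Ioo_subset_Icc_self hs)) htδ)
  have hRst := (hball s t (habss s (Ioo_subset_Icc_self hs)) htδ).2.1
  have hpos : 0 < Φ (-κ) - Φ (-(2 * κ)) := by
    rw [es, sub_zero, div_lt_iff₀ hκ0, zero_mul] at hRst
    rw [det2_sub_left] at et
    have : 0 < (Φ (-κ) - Φ (-(2 * κ))) / (-κ - -(2 * κ)) := by
      rw [← et]; linarith
    exact (div_pos_iff_of_pos_right (by linarith)).1 this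
  have g13 := (hball 0 (-(2 * κ)) abs0 (habst _ ⟨le_rfl, by linarith⟩)).1
  have g14 := (hball 0 (-κ) abs0 (habst _ ⟨by linarith, le_rfl⟩)).1
  have g23 := (hball κ (-(2 * κ)) absκ (habst _ ⟨le_rfl, by linarith⟩)).1
  have g24 := (hball κ (-κ) absκ (habst _ ⟨by linarith, le_rfl⟩)).1
  have hpi3 := Real.pi_gt_three
  have hqγ : ∀ t, q t = v₀ + γ φ + γ (φ + Real.pi + t) := fun t => by
    rw [show φ + Real.pi + t = φ + t + Real.pi by ring, h.antip]; simp only [hq, hp]; abel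
  refine h.not_quadrangleProperty (φ₁ := φ) (φ₂ := φ + κ) (φ₃ := φ + Real.pi + -(2 * κ))
    (φ₄ := φ + Real.pi + -κ) (by linarith) (by linarith) (by linarith) (by linarith)
    (v := -γ φ) (w := v₀ + γ φ) (x₁ := p 0) (x₂ := p κ) (x₃ := q (-(2 * κ))) (x₄ := q (-κ))
    (by simp [hp]) (by simp only [hp]; abel) (hqγ _) (hqγ _)
    (hball 0 0 abs0 abs0).2.2.1 (hball κ 0 absκ abs0).2.2.1
    (by rw [sub_neg_eq_add]; exact (hball 0 _ abs0 (habst _ ⟨le_rfl, by linarith⟩)).2.2.2)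
    (by rw [sub_neg_eq_add]; exact (hball 0 _ abs0 (habst _ ⟨by linarith, le_rfl⟩)).2.2.2)
    g13.2.2.2.1 g13.2.2.2.2 g13.2.2.1.symm g14.2.2.2.1 g14.2.2.2.2 g14.2.2.1.symm
    g23.2.2.2.1 g23.2.2.2.2 g23.2.2.1.symm g24.2.2.2.1 g24.2.2.2.2 g24.2.2.1.symm ?_
  simp only [hΦ] at hpos
  rw [det2_sub_right]
  linarith

end SupportCurve

/-! ### Perturbation of support curves -/

/-- A curve whose radius of curvature `1 + cos (2nθ)` is maximal at the multiples of `π / n`,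
while its chord between two consecutive ones is shorter than that of the unit circle. -/
noncomputable def rippleCurve (n : ℕ) (θ : ℝ) : Plane :=
  (1 - Real.cos (2 * n * θ) / (4 * n ^ 2 - 1)) • dir θ +
    (2 * n * Real.sin (2 * n * θ) / (4 * n ^ 2 - 1)) • tang θ

theorem four_mul_sq_sub_one_pos {n : ℕ} (hn : 1 ≤ n) : (0 : ℝ) < 4 * n ^ 2 - 1 := by
  have : (1 : ℝ) ≤ n := by exact_mod_cast hn
  nlinarith

/-- The curve is `h • dir + h' • tang` for the support function `h = 1 - cos (2nθ) / (4n² - 1)`, and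
its radius of curvature is `h + h''`. -/
theorem hasDerivAt_rippleCurve {n : ℕ} (hn : 1 ≤ n) (θ : ℝ) :
    HasDerivAt (rippleCurve n) ((1 + Real.cos (2 * n * θ)) • tang θ) θ := by
  have hk := (four_mul_sq_sub_one_pos hn).ne'
  have hl : HasDerivAt (fun s : ℝ => 2 * n * s) (2 * n) θ := by
    simpa using (hasDerivAt_id θ).const_mul (2 * n : ℝ)
  have h1 := ((hl.cos.div_const (4 * (n : ℝ) ^ 2 - 1)).const_sub 1).smul (hasDerivAt_dir θ)
  have h2 := ((hl.sin.const_mul (2 * n : ℝ)).div_const (4 * (n : ℝ) ^ 2 - 1)).smul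
    (hasDerivAt_tang θ)
  refine (h1.add h2).congr_deriv ?_
  have e : 1 - Real.cos (2 * n * θ) / (4 * (n : ℝ) ^ 2 - 1) +
      2 * n * (Real.cos (2 * n * θ) * (2 * n)) / (4 * (n : ℝ) ^ 2 - 1) =
      1 + Real.cos (2 * n * θ) := by
    rw [sub_add, ← sub_div, sub_eq_add_neg, ← neg_div, neg_sub, add_right_inj, div_eq_iff hk]
    ring
  rw [← e]
  module

theorem rippleCurve_add_pi (n : ℕ) (θ : ℝ) : rippleCurve n (θ + Real.pi) = -rippleCurve n θ := by
  have e : (2 * n * (θ + Real.pi) : ℝ) = 2 * n * θ + n * (2 * Real.pi) := by ring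
  simp only [rippleCurve, e, Real.cos_add_nat_mul_two_pi, Real.sin_add_nat_mul_two_pi, dir_add_pi,
    tang_add_pi]
  module

theorem rippleCurve_zero (n : ℕ) : rippleCurve n 0 = (1 - 1 / (4 * (n : ℝ) ^ 2 - 1)) • dir 0 := by
  simp [rippleCurve]

theorem rippleCurve_pi_div {n : ℕ} (hn : 1 ≤ n) :
    rippleCurve n (Real.pi / n) = (1 - 1 / (4 * (n : ℝ) ^ 2 - 1)) • dir (Real.pi / n) := by
  have : (n : ℝ) ≠ 0 := by positivity
  have e : (2 * n * (Real.pi / n) : ℝ) = 2 * Real.pi := by field_simp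
  simp [rippleCurve, e]

section Compare

variable {γ γ' : ℝ → Plane} {ρ ρ' : ℝ → ℝ}

/-- The component along `dir b` is the integral of the radius against `sin (b - s)`, a nonnegative
weight, so it is monotone in the radius. The companion lemma is the same at the other end. -/
theorem inner_dir_chord_le (h : ∀ θ, HasDerivAt γ (ρ θ • tang θ) θ)
    (h' : ∀ θ, HasDerivAt γ' (ρ' θ • tang θ) θ) {a b : ℝ} (hab : a ≤ b) (hb : b ≤ a + Real.pi)
    (hρ : ∀ θ ∈ Icc a b, ρ θ ≤ ρ' θ) :
    inner ℝ (dir b) (γ b - γ a) ≤ inner ℝ (dir b) (γ' b - γ' a) := by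
  have hd : ∀ s, HasDerivAt (fun s => inner ℝ (dir b) (γ' s - γ s))
      ((ρ' s - ρ s) * Real.sin (b - s)) s := fun s => by
    refine (hasDerivAt_inner_const (dir b) ((h' s).sub (h s))).congr_deriv ?_
    rw [← sub_smul, inner_smul_right, inner_dir_tang]
  have hm : MonotoneOn (fun s => inner ℝ (dir b) (γ' s - γ s)) (Icc a b) := by
    refine monotoneOn_of_deriv_nonneg (convex_Icc _ _)
      (fun s _ => (hd s).continuousAt.continuousWithinAt)
      (fun s _ => (hd s).differentiableAt.differentiableWithinAt) fun s hs => ?_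
    rw [interior_Icc] at hs
    rw [(hd s).deriv]
    exact mul_nonneg (sub_nonneg.2 (hρ s ⟨hs.1.le, hs.2.le⟩))
      (Real.sin_nonneg_of_nonneg_of_le_pi (by linarith [hs.2]) (by linarith [hs.1]))
  have := hm ⟨le_rfl, hab⟩ ⟨hab, le_rfl⟩ hab
  simp only [inner_sub_right] at this ⊢
  linarith

theorem neg_inner_dir_chord_le (h : ∀ θ, HasDerivAt γ (ρ θ • tang θ) θ)
    (h' : ∀ θ, HasDerivAt γ' (ρ' θ • tang θ) θ) {a b : ℝ} (hab : a ≤ b) (hb : b ≤ a + Real.pi)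
    (hρ : ∀ θ ∈ Icc a b, ρ θ ≤ ρ' θ) :
    -inner ℝ (dir a) (γ b - γ a) ≤ -inner ℝ (dir a) (γ' b - γ' a) := by
  have hd : ∀ s, HasDerivAt (fun s => inner ℝ (dir a) (γ' s - γ s))
      ((ρ' s - ρ s) * Real.sin (a - s)) s := fun s => by
    refine (hasDerivAt_inner_const (dir a) ((h' s).sub (h s))).congr_deriv ?_
    rw [← sub_smul, inner_smul_right, inner_dir_tang]
  have hm : AntitoneOn (fun s => inner ℝ (dir a) (γ' s - γ s)) (Icc a b) := by
    refine antitoneOn_of_deriv_nonpos (convex_Icc _ _)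
      (fun s _ => (hd s).continuousAt.continuousWithinAt)
      (fun s _ => (hd s).differentiableAt.differentiableWithinAt) fun s hs => ?_
    rw [interior_Icc] at hs
    rw [(hd s).deriv]
    exact mul_nonpos_of_nonneg_of_nonpos (sub_nonneg.2 (hρ s ⟨hs.1.le, hs.2.le⟩))
      (Real.sin_nonpos_of_nonpos_of_neg_pi_le (by linarith [hs.1]) (by linarith [hs.2]))
  have := hm ⟨le_rfl, hab⟩ ⟨hab, le_rfl⟩ hab
  simp only [inner_sub_right] at this ⊢
  linarith

end Compare

namespace SupportCurve

variable {γ : ℝ → Plane} {ρ : ℝ → ℝ}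

theorem add_smul_rippleCurve (h : SupportCurve γ ρ) {n : ℕ} (hn : 1 ≤ n) {ε : ℝ} (hε : 0 ≤ ε) :
    SupportCurve (fun θ => γ θ + ε • rippleCurve n θ)
      fun θ => ρ θ + ε * (1 + Real.cos (2 * n * θ)) where
  hasDerivAt θ := by
    refine ((h.hasDerivAt θ).add ((hasDerivAt_rippleCurve hn θ).const_smul ε)).congr_deriv ?_
    module
  cont := by have := h.cont; fun_prop
  pos θ := add_pos_of_pos_of_nonneg (h.pos θ)
    (mul_nonneg hε (by linarith [Real.neg_one_le_cos (2 * n * θ)]))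
  antip θ := by rw [h.antip, rippleCurve_add_pi]; module

/-- Under these bounds each summand of the criterion is at most `m (1 - c) / M`, while `sin²`
factors as `(1 - c) (1 + c)`; the common factor `1 - c` is positive. -/
theorem not_quadrangleProperty_of_chord_le (h : SupportCurve γ ρ) {α β m M : ℝ} (h1 : α < β)
    (h2 : β < α + Real.pi) (hm : 0 < m) (hα : M ≤ ρ α) (hβ : M ≤ ρ β)
    (hcα : -inner ℝ (dir α) (γ β - γ α) ≤ m * (1 - Real.cos (β - α)))
    (hcβ : inner ℝ (dir β) (γ β - γ α) ≤ m * (1 - Real.cos (β - α)))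
    (hmM : 2 * m < (1 + Real.cos (β - α)) * M) : ¬ QuadrangleProperty (region γ) := by
  refine h.not_quadrangleProperty_of_chord h1 h2 ?_
  set c := Real.cos (β - α)
  have hc1 : c < 1 := by
    have := Real.cos_lt_cos_of_nonneg_of_le_pi le_rfl (by linarith : β - α ≤ Real.pi)
      (by linarith)
    rwa [Real.cos_zero] at this
  have hc0 : 0 ≤ 1 + c := by linarith [Real.neg_one_le_cos (β - α)]
  have hM : 0 < M := by
    by_contra hM
    nlinarith [mul_nonpos_of_nonneg_of_nonpos hc0 (not_lt.1 hM)]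
  have hq : 0 ≤ m * (1 - c) := mul_nonneg hm.le (by linarith)
  have b1 : inner ℝ (dir β) (γ β - γ α) / ρ α ≤ m * (1 - c) / M :=
    (div_le_div_of_nonneg_right hcβ (h.pos α).le).trans (div_le_div_of_nonneg_left hq hM hα)
  have b2 : -inner ℝ (dir α) (γ β - γ α) / ρ β ≤ m * (1 - c) / M :=
    (div_le_div_of_nonneg_right hcα (h.pos β).le).trans (div_le_div_of_nonneg_left hq hM hβ)
  have b3 : m * (1 - c) / M + m * (1 - c) / M < Real.sin (β - α) ^ 2 := by
    rw [Real.sin_sq, ← add_div, div_lt_iff₀ hM]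
    nlinarith [mul_lt_mul_of_pos_right hmM (sub_pos.2 hc1)]
  rw [neg_div] at b2
  linarith

/-- The perturbation is the ripple of amplitude `ε`, with so many waves that `ρ` is almost constant
on one of them and `cos (π / n)` is almost `1`. The chord runs from one crest of the radius to the
next. -/
theorem exists_near_not_quadrangleProperty (h : SupportCurve γ ρ) {ε : ℝ} (hε : 0 < ε) :
    ∃ γ' ρ', SupportCurve γ' ρ' ∧ (∀ θ, |ρ θ - ρ' θ| ≤ 2 * ε) ∧
      ∀ γ₁ ρ₁, SupportCurve γ₁ ρ₁ → (∀ θ, |ρ' θ - ρ₁ θ| ≤ ε / 8) →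
        ¬ QuadrangleProperty (region γ₁) := by
  -- At the ends of the chord the radius is at least `ρ 0 + 2ε` minus `ε / 8` for the variation of
  -- `ρ` and `ε / 8` for the later perturbation, which gives `M`. The mean is at most `ρ 0 + ε` plus
  -- the same two errors, which gives `m`. Since `m < M`, the limit `n → ∞` yields `2m < (1 + cos (π
  -- / n)) M`.
  set M := ρ 0 + 7 / 4 * ε with hM
  set m := ρ 0 + 5 / 4 * ε with hm
  have hr := h.pos 0
  obtain ⟨δ, hδ, hρ⟩ := Metric.continuousAt_iff.1 h.cont.continuousAt (ε / 8) (by positivity)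
  have hlim : Filter.Tendsto (fun n : ℕ => Real.pi / n) Filter.atTop (𝓝 0) :=
    tendsto_const_div_atTop_nhds_zero_nat _
  have hcos : Filter.Tendsto (fun n : ℕ => (1 + Real.cos (Real.pi / n)) * M) Filter.atTop
      (𝓝 ((1 + Real.cos 0) * M)) :=
    (((Real.continuous_cos.tendsto 0).comp hlim).const_add 1).mul_const M
  have hlt : 2 * m < (1 + Real.cos 0) * M := by rw [Real.cos_zero]; linarith
  obtain ⟨n, hnδ, hnM, hn2⟩ := ((hlim.eventually_lt_const hδ).and
    ((hcos.eventually_const_lt hlt).and (Filter.eventually_ge_atTop 2))).exists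
  have hn : 1 ≤ n := by omega
  have hn0 : (0 : ℝ) < n := by exact_mod_cast hn
  set β := Real.pi / n with hβ
  have hβ0 : 0 < β := div_pos Real.pi_pos hn0
  have hβπ : β < Real.pi := div_lt_self Real.pi_pos (by exact_mod_cast hn2)
  have hnear : ∀ θ ∈ Icc 0 β, |ρ θ - ρ 0| < ε / 8 := fun θ hθ => by
    refine hρ ?_
    rw [Real.dist_eq, sub_zero, abs_of_nonneg hθ.1]
    exact hθ.2.trans_lt hnδ
  refine ⟨_, _, h.add_smul_rippleCurve hn hε.le, fun θ => ?_, fun γ₁ ρ₁ h₁ hd => ?_⟩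
  · have a := Real.neg_one_le_cos (2 * n * θ)
    have b := Real.cos_le_one (2 * n * θ)
    rw [abs_le]
    constructor <;> nlinarith
  have ecos : Real.cos (2 * n * β) = 1 := by
    rw [show 2 * n * β = 2 * Real.pi by rw [hβ]; field_simp, Real.cos_two_pi]
  -- A comparison curve whose radius dominates that of `γ₁` on `[0, β]` and whose chord is explicit,
  -- because `rippleCurve` is a multiple of `dir` at both ends.
  have hg : ∀ θ, HasDerivAt (fun s => (ρ 0 + ε / 4) • dir s + ε • rippleCurve n s)
      ((ρ 0 + ε / 4 + ε * (1 + Real.cos (2 * n * θ))) • tang θ) θ := fun θ => by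
    refine (((hasDerivAt_dir θ).const_smul (ρ 0 + ε / 4)).add
      ((hasDerivAt_rippleCurve hn θ).const_smul ε)).congr_deriv ?_
    module
  have hle : ∀ θ ∈ Icc 0 β, ρ₁ θ ≤ ρ 0 + ε / 4 + ε * (1 + Real.cos (2 * n * θ)) :=
    fun θ hθ => by linarith [(abs_le.1 (hd θ)).1, (abs_lt.1 (hnear θ hθ)).2]
  have hk : 1 - 1 / (4 * (n : ℝ) ^ 2 - 1) ≤ 1 := by
    have := four_mul_sq_sub_one_pos hn
    linarith [one_div_pos.2 this]
  have hc1 : 0 ≤ 1 - Real.cos β := by linarith [Real.cos_le_one β]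
  have hprod := mul_le_mul_of_nonneg_left hk (mul_nonneg hε.le hc1)
  refine h₁.not_quadrangleProperty_of_chord_le (α := 0) (β := β) (m := m) (M := M) hβ0
    (by linarith) (by positivity) ?_ ?_ ?_ ?_ (by rwa [sub_zero])
  · have := (abs_le.1 (hd 0)).2
    simp only [mul_zero, Real.cos_zero] at this
    linarith
  · have a := (abs_le.1 (hd β)).2
    have b := (abs_lt.1 (hnear β ⟨hβ0.le, le_rfl⟩)).1
    rw [ecos] at a
    linarith
  · refine (neg_inner_dir_chord_le h₁.hasDerivAt hg hβ0.le (by linarith) hle).trans ?_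
    simp only [rippleCurve_zero, hβ, rippleCurve_pi_div hn]
    simp only [← hβ, inner_sub_right, inner_add_right, inner_smul_right, inner_dir_dir, sub_zero,
      zero_sub, Real.cos_neg, Real.cos_zero]
    rw [hm]
    linarith
  · refine (inner_dir_chord_le h₁.hasDerivAt hg hβ0.le (by linarith) hle).trans ?_
    simp only [rippleCurve_zero, hβ, rippleCurve_pi_div hn]
    simp only [← hβ, inner_sub_right, inner_add_right, inner_smul_right, inner_dir_dir, sub_zero,
      sub_self, Real.cos_zero]
    rw [hm]
    linarith

end SupportCurve

theorem theorem2 :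
    {C : {C : SymDisk // IsC2Plus C.1} | ¬ QuadrangleProperty C.1.1} ∈
      residual {C : SymDisk // IsC2Plus C.1} := by
  refine Filter.mem_of_superset (residual_of_dense_open isOpen_interior ?_) interior_subset
  rintro ⟨⟨C, hC, hs⟩, h2⟩
  obtain ⟨γ, ρ, h, rfl⟩ := exists_supportCurve hC hs h2
  refine EMetric.mem_closure_iff.2 fun r hr => ?_
  obtain ⟨τ, hτ0, hτr⟩ := ENNReal.lt_iff_exists_nnreal_btwn.1 hr
  have hτ : (0 : ℝ) < τ := by exact_mod_cast hτ0
  -- With `ε = τ / 4` the perturbation moves `ρ` by at most `τ / 2`, strictly less than `τ`, and the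
  -- ball of failures has radius `ε / 8 = τ / 32`.
  obtain ⟨γ', ρ', h', hnear, hball⟩ := h.exists_near_not_quadrangleProperty
    (show (0 : ℝ) < τ / 4 by positivity)
  refine ⟨⟨⟨region γ', h'.isConvexDisk_region, fun x => h'.neg_mem_region⟩, h'.isC2Plus_region⟩,
    mem_interior_iff_mem_nhds.2 (EMetric.mem_nhds_iff.2 ⟨(τ / 32 : ℝ≥0), ?_, ?_⟩), ?_⟩
  · have : 0 < τ / 32 := div_pos (by exact_mod_cast hτ0) (by norm_num)
    exact_mod_cast this
  · rintro ⟨⟨D, hD, hDs⟩, hD2⟩ hmem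
    obtain ⟨γ₁, ρ₁, h₁, rfl⟩ := exists_supportCurve hD hDs hD2
    refine hball γ₁ ρ₁ h₁ fun θ => ?_
    have hd : pmDist (region γ') (region γ₁) < (τ / 32 : ℝ≥0) := by
      rw [pmDist_comm]; exact hmem
    refine (h'.abs_radius_sub_le h₁ hd θ).trans (le_of_eq ?_)
    push_cast; ring
  · refine lt_of_le_of_lt (h.pmDist_le h' fun θ => ?_) hτr
    exact (hnear θ).trans_lt (by linarith)
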